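/- \textbf{Setting.} Let $d\ge 1$ and let $\mu,\sigma_0$ be probability measures on $\mathbb{R}^d$ with finite second moment that are absolutely continuous with respect to Lebesgue measure. For $\theta\in\mathbb{S}^{d-1}$ and a probability measure $\sigma$ on $\mathbb{R}^d$, let $\sigma^\theta$ be the pushforward of $\sigma$ by $x\mapsto\langle x,\theta\rangle$, and let $T_{\sigma^\theta}^{\mu^\theta}=F_{\mu^\theta}^{-1}\circ F_{\sigma^\theta}$ be the one-dimensional optimal transport map from $\sigma^\theta$ to $\mu^\theta$, where $F_\rho$ is the cumulative distribution function of $\rho$ and $F_\rho^{-1}$ its quantile function. For an orthonormal basis $P=[\theta_1,\dots,\theta_d]$ of $\mathbb{R}^d$ put $$T_{\sigma,P}(x)=\sum_{i=1}^d T_{\sigma^{\theta_i}}^{\mu^{\theta_i}}(\langle x,\theta_i\rangle)\,\theta_i .$$ Let $(\gamma_k)_{k\ge0}$ be step sizes with $0<\gamma_k\le 1$, $\sum_k\gamma_k=+\infty$ and $\sum_k\gamma_k^2<+\infty$, let $(P_k)_{k\ge1}$ be i.i.d.\ random orthonormal bases, distributed according to the Haar probability measure on the orthogonal group $O(d)$,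 and define the slice-matching iterates $$\sigma_{k+1}=\big((1-\gamma_k)\,\mathrm{Id}+\gamma_k\,T_{\sigma_k,P_{k+1}}\big)_\sharp\,\sigma_k,\qquad k\ge 0 .$$ Let $\mathscr{F}(\sigma)=\frac d2\,SW_2^2(\sigma,\mu)$, where $SW_2$ is the Sliced-Wasserstein distance, with Wasserstein gradient given by $$\nabla\mathscr{F}(\sigma)(x)=d\int_{\mathbb{S}^{d-1}}\big(\langle x,\theta\rangle-T_{\sigma^\theta}^{\mu^\theta}(\langle x,\theta\rangle)\big)\,\theta\;\mathrm{d}\mathcal{U}(\theta),$$ where $\mathcal{U}$ is the uniform distribution on $\mathbb{S}^{d-1}$, and let $\|f\|_\sigma^2=\int\|f(x)\|^2\,\mathrm{d}\sigma(x)$. \textbf{Proposition.} For any integer $K\ge1$, let $i(K)$ be a random index, defined on the same probability space as $(P_k)_{k\ge1}$, such that $\mathbb{P}(i(K)=k)=1/K$ for all $k\in\{1,\dots,K\}$. Then $\|\nabla\mathscr{F}(\sigma_{i(K)})\|_{\sigma_{i(K)}}^2$ converges to $0$ in probability as $K\to\infty$, i.e. $$\forall \epsilon>0,\qquad \lim_{K\to+\infty}\mathbb{P}\big(\|\nabla\mathscr{F}(\sigma_{i(K)})\|_{\sigma_{i(K)}}^2>\epsilon\big)=0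 .$$ -/

import Mathlib

open MeasureTheory ProbabilityTheory Filter Topology
open scoped ENNReal RealInnerProductSpace

noncomputable section

namespace SliceMatching

/-- `ℝ^d` with its Euclidean norm. -/
abbrev E (d : ℕ) : Type := EuclideanSpace ℝ (Fin d)

/-- Orthonormal bases of `ℝ^d`, i.e. orthogonal `d × d` matrices; the basis vectors are
the columns. -/
abbrev Orth (d : ℕ) : Type := Matrix.orthogonalGroup (Fin d) ℝ

/-- The Borel σ-algebra on the orthogonal group. -/
instance instMeasurableSpaceOrth (d : ℕ) : MeasurableSpace (Orth d) := borel (Orth d)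

instance instBorelSpaceOrth (d : ℕ) : BorelSpace (Orth d) := ⟨rfl⟩

/-- The `i`-th vector (column) of the orthonormal basis `P`. -/
def basisVec {d : ℕ} (P : Orth d) (i : Fin d) : E d :=
  WithLp.toLp 2 (fun j => (P : Matrix (Fin d) (Fin d) ℝ) j i)

/-- `σ ∈ 𝒫_{2,ac}(ℝ^d)`: a probability measure with finite second moment which is absolutely
continuous with respect to Lebesgue measure. -/
structure IsP2ac {d : ℕ} (σ : Measure (E d)) : Prop where
  isProbabilityMeasure : IsProbabilityMeasure σ
  secondMoment : ∫⁻ x, ‖x‖ₑ ^ 2 ∂σ < ∞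
  absolutelyContinuous : σ ≪ volume

/-- The projected measure `σ^θ`, the pushforward of `σ` by `x ↦ ⟨x, θ⟩`. -/
def proj {d : ℕ} (σ : Measure (E d)) (θ : E d) : Measure ℝ :=
  σ.map (fun x => ⟪x, θ⟫)

/-- The quantile function (generalized inverse of the cumulative distribution function). -/
def quantile (ν : Measure ℝ) (u : ℝ) : ℝ := sInf {s : ℝ | u ≤ cdf ν s}

/-- The one-dimensional optimal transport map `F_ν⁻¹ ∘ F_ρ` from `ρ` to `ν`. -/
def otMap (ρ ν : Measure ℝ) (s : ℝ) : ℝ := quantile ν (cdf ρ s)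

/-- The slice-matching map `T_{σ,P}(x) = ∑ i, t_{θ_i}(⟨x, θ_i⟩) θ_i`, where the `θ_i` are the
columns of `P` and `t_θ` is the optimal transport map from `σ^θ` to `μ^θ`. -/
def sliceMap {d : ℕ} (μ σ : Measure (E d)) (P : Orth d) (x : E d) : E d :=
  ∑ i, otMap (proj σ (basisVec P i)) (proj μ (basisVec P i)) ⟪x, basisVec P i⟫ • basisVec P i

/-- The iterates `σ_{k+1} = ((1 - γ_k) Id + γ_k T_{σ_k, P_k})_♯ σ_k` of the slice-matching scheme,
where `P k` is the basis drawn to pass from `σ_k` to `σ_{k+1}`. -/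
def iterate {d : ℕ} (μ σ₀ : Measure (E d)) (γ : ℕ → ℝ) (P : ℕ → Orth d) : ℕ → Measure (E d)
  | 0 => σ₀
  | k + 1 => (iterate μ σ₀ γ P k).map
      (fun x => (1 - γ k) • x + γ k • sliceMap μ (iterate μ σ₀ γ P k) (P k) x)

/-- The uniform probability distribution on the unit sphere (normalized surface measure). -/
def uniformSphere (d : ℕ) : Measure (Metric.sphere (0 : E d) 1) :=
  ((volume : Measure (E d)).toSphere Set.univ)⁻¹ • (volume : Measure (E d)).toSphere

/-- The Wasserstein gradient at `σ` of the loss `σ ↦ (d / 2) SW₂²(σ, μ)`, namely the vector field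
`x ↦ d ∫ (⟨x, θ⟩ - t_θ(⟨x, θ⟩)) θ dU(θ)`, with `t_θ` the optimal transport map from `σ^θ`
to `μ^θ` and `U` the uniform distribution on the sphere. -/
def gradLoss {d : ℕ} (μ σ : Measure (E d)) (x : E d) : E d :=
  (d : ℝ) • ∫ θ : Metric.sphere (0 : E d) 1,
    (⟪x, (θ : E d)⟫ - otMap (proj σ θ) (proj μ θ) ⟪x, (θ : E d)⟫) • (θ : E d) ∂(uniformSphere d)

/-- The squared norm `‖∇ℱ(σ)‖_σ²` of the Wasserstein gradient in `L²(σ)`. -/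
def gradNormSq {d : ℕ} (μ σ : Measure (E d)) : ℝ≥0∞ :=
  ∫⁻ x, ‖gradLoss μ σ x‖ₑ ^ 2 ∂σ

end SliceMatching

end

namespace SliceMatching

/-! ### Quantile functions and optimal transport on the line -/

/-! Write G_k for the squared gradient norm at σ_k. The heart of the matter is that G_k → 0 almost
surely; evaluating at a uniform index of {1, …, K} is then harmless, because any fixed initial
segment has probability O(1/K).

Descent. Moving σ_k by one step transports the optimal one-dimensional couplings along, so the cost
of the moved couplings bounds the new loss (`loss_map_le`). Each column of a Haar basis is uniform
on the sphere, so the mean displacement is minus the gradient. Expanding the square gives E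
loss(σ_{k+1}) + (2γ_k/d) E G_k ≤ E loss(σ_k) + γ_k² d L, where L bounds the loss along the whole
trajectory (`lintegral_loss_step_add_le`). Summing, ∑ γ_k G_k is almost surely finite.

From the weighted sum to convergence. Finiteness of ∑ γ_k G_k alone does not force G_k → 0; some
continuity of G along the trajectory is needed. The gradient involves the ranks of points under σ,
which can react violently to small perturbations if σ concentrates. A small gradient excludes this:
if x and y are close while most of their slices are transported at least τ apart, then monotonicity
of the transport maps makes the gradient large at x or at y. How often transported slices are close
depends only on μ, so the resulting anti-concentration is uniform in σ (`exists_concentration_le`).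
Hence ranks are stable near a measure with small gradient, and, approximating the quantiles of μ by
a continuous function in L², so is the gradient norm (`exists_gradNormSq_le`).

The trajectory moves in L² at speed at most C γ_k. If G_k > ε for a late k, then G stays above some
η on a whole window of total step size more than δ, which costs at least δη in the tail of a
convergent series (`eventually_le_of_tsum_ne_top`).

Throughout, absolute continuity is replaced by the weaker property of having no atoms. It implies
that almost every slice has no atoms, and it survives a step along a basis whose slices of σ and μ
have none (`nullSingletonClass_step`). -/

/-- Right-continuity puts the infimum into the set it is taken over. Positivity of `u` bounds that
set below and `hu'` makes it nonempty; otherwise `sInf` takes its default value 0. -/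
lemma quantile_le_iff (ν : Measure ℝ) {u : ℝ} (hu : 0 < u) (hu' : ∃ s, u ≤ cdf ν s)
    (t : ℝ) : quantile ν u ≤ t ↔ u ≤ cdf ν t := by
  have hbdd : BddBelow {s : ℝ | u ≤ cdf ν s} := by
    obtain ⟨b, hb⟩ := ((tendsto_cdf_atBot ν).eventually (gt_mem_nhds hu)).exists
    refine ⟨b, fun s hs => ?_⟩
    by_contra! h
    exact absurd (lt_of_le_of_lt (hs.trans (monotone_cdf ν h.le)) hb) (lt_irrefl _)
  constructor
  · intro h
    have hev : ∀ s, t < s → u ≤ cdf ν s := by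
      intro s hs
      obtain ⟨r, hr, hrs⟩ := exists_lt_of_csInf_lt hu' (lt_of_le_of_lt h hs)
      exact le_trans hr (monotone_cdf ν hrs.le)
    have hc : Tendsto (cdf ν) (𝓝[>] t) (𝓝 (cdf ν t)) :=
      ((cdf ν).right_continuous t).tendsto.mono_left (nhdsWithin_mono _ Set.Ioi_subset_Ici_self)
    exact ge_of_tendsto hc (eventually_nhdsWithin_of_forall fun s hs => hev s hs)
  · exact fun h => csInf_le hbdd h

lemma exists_le_cdf (ν : Measure ℝ) {u : ℝ} (hu : u < 1) : ∃ s, u ≤ cdf ν s :=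
  (((tendsto_cdf_atTop ν).eventually (lt_mem_nhds hu)).exists).imp fun _ h => h.le

lemma quantile_of_nonpos (ν : Measure ℝ) {u : ℝ} (hu : u ≤ 0) : quantile ν u = 0 := by
  have : {s : ℝ | u ≤ cdf ν s} = Set.univ := Set.eq_univ_of_forall fun s => hu.trans (cdf_nonneg ν s)
  rw [quantile, this, Real.sInf_univ]

lemma quantile_of_forall_lt (ν : Measure ℝ) {u : ℝ} (hu : ¬ ∃ s, u ≤ cdf ν s) :
    quantile ν u = 0 := by
  have : {s : ℝ | u ≤ cdf ν s} = ∅ := Set.eq_empty_of_forall_notMem fun s hs => hu ⟨s, hs⟩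
  rw [quantile, this, Real.sInf_empty]

lemma measurable_quantile_comp {α : Type*} [MeasurableSpace α] (ν : α → Measure ℝ) (u : α → ℝ)
    (hν : ∀ t : ℝ, Measurable fun a => cdf (ν a) t) (hu : Measurable u) :
    Measurable fun a => quantile (ν a) (u a) := by
  refine measurable_of_Iic fun t => ?_
  -- Natural levels suffice by monotonicity, and turn the existence condition into a countable
  -- union.
  have hex : MeasurableSet {a | ∃ n : ℕ, u a ≤ cdf (ν a) n} := by
    rw [Set.ofPred_exists]
    exact MeasurableSet.iUnion fun n => measurableSet_le hu (hν n)
  have hiff : ∀ a, (∃ n : ℕ, u a ≤ cdf (ν a) n) ↔ ∃ s : ℝ, u a ≤ cdf (ν a) s := by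
    intro a
    constructor
    · rintro ⟨n, hn⟩
      exact ⟨n, hn⟩
    · rintro ⟨s, hs⟩
      obtain ⟨n, hn⟩ := exists_nat_ge s
      exact ⟨n, hs.trans (monotone_cdf _ hn)⟩
  -- The first and third pieces are the degenerate cases, where the quantile is the default value 0
  -- and membership only asks whether `0 ≤ t`.
  have : (fun a => quantile (ν a) (u a)) ⁻¹' Set.Iic t =
      ({a | u a ≤ 0} ∩ {_a | 0 ≤ t}) ∪
      ({a | 0 < u a} ∩ {a | ∃ n : ℕ, u a ≤ cdf (ν a) n} ∩ {a | u a ≤ cdf (ν a) t}) ∪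
      ({a | 0 < u a} ∩ {a | ∃ n : ℕ, u a ≤ cdf (ν a) n}ᶜ ∩ {_a | 0 ≤ t}) := by
    ext a
    simp only [Set.mem_preimage, Set.mem_Iic, Set.mem_union, Set.mem_inter_iff, Set.mem_ofPred_eq,
      Set.mem_compl_iff, hiff]
    rcases le_or_gt (u a) 0 with h | h
    · simp [quantile_of_nonpos _ h, h, not_lt.2 h]
    · by_cases h' : ∃ s : ℝ, u a ≤ cdf (ν a) s
      · rw [quantile_le_iff _ h h']
        simp [h, h', not_le.2 h]
      · rw [quantile_of_forall_lt _ h']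
        simp only [h, h', not_le.2 h]
        simp
  rw [this]
  exact (((measurableSet_le hu measurable_const).inter (MeasurableSet.const _)).union
    (((measurableSet_lt measurable_const hu).inter hex).inter (measurableSet_le hu (hν t)))).union
    (((measurableSet_lt measurable_const hu).inter hex.compl).inter (MeasurableSet.const _))

lemma measurable_quantile (ν : Measure ℝ) : Measurable (quantile ν) :=
  measurable_quantile_comp (fun _ => ν) id (fun _ => measurable_const) measurable_id

lemma measurable_otMap (ρ ν : Measure ℝ) : Measurable (otMap ρ ν) :=
  (measurable_quantile ν).comp (monotone_cdf ρ).measurable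

lemma continuous_cdf (ρ : Measure ℝ) [IsProbabilityMeasure ρ] [NullSingletonClass ρ] :
    Continuous (cdf ρ) := by
  rw [continuous_iff_continuousAt]
  intro x
  have h : (cdf ρ).measure {x} = 0 := by rw [measure_cdf]; exact measure_singleton x
  rw [StieltjesFunction.measure_singleton, ENNReal.ofReal_eq_zero, sub_nonpos] at h
  rw [(monotone_cdf ρ).continuousAt_iff_leftLim_eq_rightLim, StieltjesFunction.rightLim_eq]
  exact le_antisymm ((monotone_cdf ρ).leftLim_le le_rfl) h

/-- By continuity the sublevel set is a closed half-line whose endpoint has distribution value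
exactly `u`. The extreme values are treated apart: for `u = 1` the set is the whole line, and for `u
= 0` it may be empty. -/
lemma measure_cdf_le (ρ : Measure ℝ) [IsProbabilityMeasure ρ] [NullSingletonClass ρ] {u : ℝ}
    (hu0 : 0 ≤ u) (hu1 : u ≤ 1) : ρ {s | cdf ρ s ≤ u} = ENNReal.ofReal u := by
  have hc := continuous_cdf ρ
  rcases hu1.eq_or_lt with rfl | hu1
  · have : {s | cdf ρ s ≤ 1} = Set.univ := Set.eq_univ_of_forall fun s => cdf_le_one ρ s
    rw [this]; simp
  rcases hu0.eq_or_lt with rfl | hu0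
  · rw [ENNReal.ofReal_zero]
    refine le_antisymm (le_of_forall_pos_le_add fun ε hε => ?_) bot_le
    rcases eq_or_ne ε ∞ with rfl | hε'
    · simp
    have hε2 : 0 < ε.toReal := ENNReal.toReal_pos hε.ne' hε'
    obtain ⟨b, hb⟩ := ((tendsto_cdf_atTop ρ).eventually (lt_mem_nhds one_pos)).exists
    by_cases hall : ∃ s, cdf ρ s ≤ 0
    · have hbdd : BddAbove {s | cdf ρ s ≤ 0} := by
        refine ⟨b, fun s hs => ?_⟩
        by_contra! h
        exact absurd (hb.trans_le ((monotone_cdf ρ h.le).trans hs)) (lt_irrefl _)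
      have hmem : cdf ρ (sSup {s | cdf ρ s ≤ 0}) ≤ 0 :=
        (isClosed_le hc continuous_const).csSup_mem hall hbdd
      calc ρ {s | cdf ρ s ≤ 0} ≤ ρ (Set.Iic (sSup {s | cdf ρ s ≤ 0})) :=
            measure_mono fun s hs => le_csSup hbdd hs
        _ = ENNReal.ofReal (cdf ρ (sSup {s | cdf ρ s ≤ 0})) := (ofReal_cdf ρ _).symm
        _ = 0 := by rw [ENNReal.ofReal_eq_zero]; exact hmem
        _ ≤ _ := bot_le
    · have : {s | cdf ρ s ≤ 0} = ∅ := Set.eq_empty_of_forall_notMem fun s hs => hall ⟨s, hs⟩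
      simp [this]
  obtain ⟨b, hb⟩ := ((tendsto_cdf_atTop ρ).eventually (lt_mem_nhds hu1)).exists
  obtain ⟨a, ha⟩ := ((tendsto_cdf_atBot ρ).eventually (gt_mem_nhds hu0)).exists
  have hbdd : BddAbove {s | cdf ρ s ≤ u} := by
    refine ⟨b, fun s hs => ?_⟩
    by_contra! h
    exact absurd (hb.trans_le ((monotone_cdf ρ h.le).trans hs)) (lt_irrefl _)
  have hne : {s | cdf ρ s ≤ u}.Nonempty := ⟨a, ha.le⟩
  have hmem : cdf ρ (sSup {s | cdf ρ s ≤ u}) ≤ u :=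
    (isClosed_le hc continuous_const).csSup_mem hne hbdd
  have heq : {s | cdf ρ s ≤ u} = Set.Iic (sSup {s | cdf ρ s ≤ u}) := by
    ext s
    exact ⟨fun hs => le_csSup hbdd hs, fun hs => (monotone_cdf ρ hs).trans hmem⟩
  have hval : cdf ρ (sSup {s | cdf ρ s ≤ u}) = u := by
    refine le_antisymm hmem ?_
    obtain ⟨x, hx⟩ := mem_range_of_exists_le_of_exists_ge hc ⟨a, ha.le⟩ ⟨b, hb.le⟩
    have := monotone_cdf ρ (le_csSup hbdd (show x ∈ {s | cdf ρ s ≤ u} from hx.le))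
    rwa [hx] at this
  rw [heq, ← ofReal_cdf, hval]

/-- The cumulative distribution function of an atomless law is uniformly distributed. -/
lemma map_cdf (ρ : Measure ℝ) [IsProbabilityMeasure ρ] [NullSingletonClass ρ] :
    ρ.map (cdf ρ) = volume.restrict (Set.Icc 0 1) := by
  have hm : Measurable (cdf ρ) := (monotone_cdf ρ).measurable
  have : IsProbabilityMeasure (ρ.map (cdf ρ)) := Measure.isProbabilityMeasure_map hm.aemeasurable
  refine Measure.ext_of_Iic _ _ fun u => ?_
  rw [Measure.map_apply hm measurableSet_Iic, Measure.restrict_apply measurableSet_Iic]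
  rcases lt_or_ge u 0 with hu | hu
  · have h1 : cdf ρ ⁻¹' Set.Iic u = ∅ := Set.eq_empty_of_forall_notMem fun s hs =>
      absurd (lt_of_le_of_lt hs hu) (not_lt.2 (cdf_nonneg ρ s))
    have h2 : Set.Iic u ∩ Set.Icc 0 1 = ∅ := Set.eq_empty_of_forall_notMem fun s hs =>
      absurd (lt_of_le_of_lt hs.1 hu) (not_lt.2 hs.2.1)
    rw [h1, h2]; simp
  rcases le_or_gt u 1 with hu1 | hu1
  · have h2 : Set.Iic u ∩ Set.Icc 0 1 = Set.Icc 0 u := by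
      ext s
      simp only [Set.mem_inter_iff, Set.mem_Iic, Set.mem_Icc]
      exact ⟨fun h => ⟨h.2.1, h.1⟩, fun h => ⟨h.2, h.1, h.2.trans hu1⟩⟩
    rw [h2, Real.volume_Icc, sub_zero]
    exact measure_cdf_le ρ hu hu1
  · have h1 : cdf ρ ⁻¹' Set.Iic u = Set.univ :=
      Set.eq_univ_of_forall fun s => (cdf_le_one ρ s).trans hu1.le
    have h2 : Set.Iic u ∩ Set.Icc 0 1 = Set.Icc 0 1 :=
      Set.inter_eq_right.2 fun s hs => hs.2.trans hu1.le
    rw [h1, h2]; simp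

lemma ae_uniform_mem_Ioo :
    ∀ᵐ u ∂(volume.restrict (Set.Icc (0 : ℝ) 1)), u ∈ Set.Ioo (0 : ℝ) 1 := by
  rw [← Measure.restrict_congr_set (Ioo_ae_eq_Icc (a := (0 : ℝ)) (b := 1))]
  exact ae_restrict_mem measurableSet_Ioo

lemma ae_cdf_mem_Ioo (ρ : Measure ℝ) [IsProbabilityMeasure ρ] [NullSingletonClass ρ] :
    ∀ᵐ s ∂ρ, cdf ρ s ∈ Set.Ioo (0 : ℝ) 1 := by
  have := ae_uniform_mem_Ioo
  rw [← map_cdf ρ] at this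
  exact ae_of_ae_map (monotone_cdf ρ).measurable.aemeasurable this

/-- The quantile function pushes the uniform law forward to the given law. -/
lemma map_quantile (ν : Measure ℝ) [IsProbabilityMeasure ν] :
    (volume.restrict (Set.Icc (0 : ℝ) 1)).map (quantile ν) = ν := by
  have hm := measurable_quantile ν
  have : IsProbabilityMeasure (volume.restrict (Set.Icc (0 : ℝ) 1)) := ⟨by simp⟩
  have := Measure.isProbabilityMeasure_map (μ := volume.restrict (Set.Icc (0 : ℝ) 1))
    hm.aemeasurable
  refine Measure.ext_of_Iic _ _ fun t => ?_
  rw [Measure.map_apply hm measurableSet_Iic, ← ofReal_cdf]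
  have : (quantile ν ⁻¹' Set.Iic t : Set ℝ) =ᵐ[volume.restrict (Set.Icc (0 : ℝ) 1)]
      Set.Iic (cdf ν t) := by
    filter_upwards [ae_uniform_mem_Ioo] with u hu
    exact propext (quantile_le_iff ν hu.1 (exists_le_cdf ν hu.2) t)
  rw [measure_congr this, Measure.restrict_apply measurableSet_Iic]
  have h2 : Set.Iic (cdf ν t) ∩ Set.Icc 0 1 = Set.Icc 0 (cdf ν t) := by
    ext s
    simp only [Set.mem_inter_iff, Set.mem_Iic, Set.mem_Icc]
    exact ⟨fun h => ⟨h.2.1, h.1⟩, fun h => ⟨h.2, h.1, h.2.trans (cdf_le_one ν t)⟩⟩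
  rw [h2, Real.volume_Icc, sub_zero]

/-- The map factors through the uniform law on the unit interval. Only the source has to be
atomless. -/
lemma map_otMap (ρ ν : Measure ℝ) [IsProbabilityMeasure ρ] [NullSingletonClass ρ] [IsProbabilityMeasure ν] :
    ρ.map (otMap ρ ν) = ν := by
  have h := (Measure.map_map (μ := ρ) (measurable_quantile ν) (monotone_cdf ρ).measurable).symm
  rw [map_cdf ρ, map_quantile] at h
  exact h

lemma monotoneOn_quantile (ν : Measure ℝ) : MonotoneOn (quantile ν) (Set.Ioo 0 1) := by
  intro u hu v hv huv
  rw [quantile_le_iff ν hu.1 (exists_le_cdf ν hu.2)]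
  exact huv.trans ((quantile_le_iff ν hv.1 (exists_le_cdf ν hv.2) _).1 le_rfl)

lemma otMap_le_iff (ρ ν : Measure ℝ) {s : ℝ} (hs : cdf ρ s ∈ Set.Ioo (0 : ℝ) 1) (t : ℝ) :
    otMap ρ ν s ≤ t ↔ cdf ρ s ≤ cdf ν t :=
  quantile_le_iff ν hs.1 (exists_le_cdf ν hs.2) t

end SliceMatching

/-! ### Optimality of the monotone coupling for the quadratic cost -/

namespace SliceMatching

/-- The area of the triangle `a ≤ u ≤ v < b`. -/
lemma lintegral_triangle (a b : ℝ) :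
    ∫⁻ u : ℝ, ∫⁻ v : ℝ, (if u ≤ v ∧ a ≤ u ∧ v < b then (1 : ℝ≥0∞) else 0) =
      ENNReal.ofReal ((max (b - a) 0) ^ 2 / 2) := by
  have h1 : ∀ u : ℝ, ∫⁻ v : ℝ, (if u ≤ v ∧ a ≤ u ∧ v < b then (1 : ℝ≥0∞) else 0) =
      Set.indicator (Set.Ici a) (fun u => ENNReal.ofReal (b - u)) u := by
    intro u
    by_cases hu : a ≤ u
    · have : (fun v : ℝ => if u ≤ v ∧ a ≤ u ∧ v < b then (1 : ℝ≥0∞) else 0) =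
          (Set.Ico u b).indicator 1 := by
        ext v; simp [Set.indicator_apply, hu]
      rw [this, lintegral_indicator_one measurableSet_Ico, Real.volume_Ico]
      simp [hu]
    · simp [hu]
  simp_rw [h1]
  rw [lintegral_indicator measurableSet_Ici]
  rcases le_or_gt b a with hab | hab
  · rw [max_eq_right (by linarith)]
    rw [setLIntegral_congr_fun (g := fun _ => 0) measurableSet_Ici
      (fun u hu => ENNReal.ofReal_of_nonpos (by have : a ≤ u := hu; linarith))]
    simp
  · rw [max_eq_left (by linarith)]
    have h2 : ∫⁻ u in Set.Ici a, ENNReal.ofReal (b - u) =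
        ∫⁻ u in Set.Ioc a b, ENNReal.ofReal (b - u) := by
      rw [setLIntegral_congr (Ioi_ae_eq_Ici (a := a)).symm, ← Set.Ioc_union_Ioi_eq_Ioi hab.le,
        lintegral_union measurableSet_Ioi (Set.Ioc_disjoint_Ioi le_rfl)]
      rw [setLIntegral_congr_fun (f := fun u => ENNReal.ofReal (b - u)) (g := fun _ => 0)
        measurableSet_Ioi
        (fun u hu => ENNReal.ofReal_of_nonpos (by have : b < u := hu; linarith))]
      simp
    rw [h2, ← ofReal_integral_eq_lintegral_ofReal, ← intervalIntegral.integral_of_le hab.le]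
    · congr 1
      rw [intervalIntegral.integral_sub (by simp) (by simp), integral_id]
      simp; ring
    · exact (continuous_const.sub continuous_id).integrableOn_Ioc
    · filter_upwards [ae_restrict_mem measurableSet_Ioc] with u hu
      simpa using hu.2

/-- The square is twice the area of the triangle spanned between the two numbers; depending on their
order, at least one of the two indicators vanishes. In this form Tonelli expresses a quadratic cost
through probabilities of the events `A ≤ u`, `B > v`. -/
lemma ofReal_sq_sub_eq (a b : ℝ) :
    ENNReal.ofReal ((a - b) ^ 2) = 2 * ∫⁻ u : ℝ, ∫⁻ v : ℝ,
      ((if u ≤ v ∧ a ≤ u ∧ v < b then (1 : ℝ≥0∞) else 0) +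
        (if u ≤ v ∧ b ≤ u ∧ v < a then (1 : ℝ≥0∞) else 0)) := by
  have hmeas : ∀ a b : ℝ, Measurable fun p : ℝ × ℝ =>
      (if p.1 ≤ p.2 ∧ a ≤ p.1 ∧ p.2 < b then (1 : ℝ≥0∞) else 0) := by
    intro a b
    refine Measurable.ite ?_ measurable_const measurable_const
    exact (measurableSet_le measurable_fst measurable_snd).inter
      ((measurableSet_le measurable_const measurable_fst).inter
        (measurableSet_lt measurable_snd measurable_const))
  have h1 : ∀ u : ℝ, ∫⁻ v : ℝ, ((if u ≤ v ∧ a ≤ u ∧ v < b then (1 : ℝ≥0∞) else 0) +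
        (if u ≤ v ∧ b ≤ u ∧ v < a then (1 : ℝ≥0∞) else 0)) =
      (∫⁻ v : ℝ, (if u ≤ v ∧ a ≤ u ∧ v < b then (1 : ℝ≥0∞) else 0)) +
      ∫⁻ v : ℝ, (if u ≤ v ∧ b ≤ u ∧ v < a then (1 : ℝ≥0∞) else 0) := fun u =>
    lintegral_add_left ((hmeas a b).comp measurable_prodMk_left) _
  simp_rw [h1]
  rw [lintegral_add_left (hmeas a b).lintegral_prod_right', lintegral_triangle, lintegral_triangle,
    ← ENNReal.ofReal_add (by positivity) (by positivity), ← ENNReal.ofReal_ofNat 2,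
    ← ENNReal.ofReal_mul (by norm_num)]
  congr 1
  rcases le_total a b with h | h
  · rw [max_eq_left (by linarith), max_eq_right (by linarith)]; ring
  · rw [max_eq_right (by linarith), max_eq_left (by linarith)]; ring

/-- The quadratic cost of a coupling in terms of its joint distribution function. -/
lemma lintegral_sq_sub_eq {α : Type*} [MeasurableSpace α] (m : Measure α) [SFinite m]
    {A B : α → ℝ} (hA : Measurable A) (hB : Measurable B) :
    ∫⁻ x, ENNReal.ofReal ((A x - B x) ^ 2) ∂m = 2 * ∫⁻ u : ℝ, ∫⁻ v : ℝ,
      (if u ≤ v then m ({x | A x ≤ u} \ {x | B x ≤ v}) + m ({x | B x ≤ u} \ {x | A x ≤ v})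
        else 0) := by
  have hmeas : ∀ {A B : α → ℝ}, Measurable A → Measurable B →
      Measurable fun p : α × ℝ × ℝ =>
      (if p.2.1 ≤ p.2.2 ∧ A p.1 ≤ p.2.1 ∧ p.2.2 < B p.1 then (1 : ℝ≥0∞) else 0) := by
    intro A B hA hB
    refine Measurable.ite ?_ measurable_const measurable_const
    have h1 : Measurable fun p : α × ℝ × ℝ => p.2.1 := measurable_snd.fst
    have h2 : Measurable fun p : α × ℝ × ℝ => p.2.2 := measurable_snd.snd
    exact (measurableSet_le h1 h2).inter
      ((measurableSet_le (hA.comp measurable_fst) h1).inter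
        (measurableSet_lt h2 (hB.comp measurable_fst)))
  have hsum := (hmeas hA hB).add (hmeas hB hA)
  simp_rw [ofReal_sq_sub_eq]
  rw [lintegral_const_mul' _ _ (by simp)]
  congr 1
  have hsum1 : Measurable fun p : (α × ℝ) × ℝ =>
      ((if p.1.2 ≤ p.2 ∧ A p.1.1 ≤ p.1.2 ∧ p.2 < B p.1.1 then (1 : ℝ≥0∞) else 0) +
        (if p.1.2 ≤ p.2 ∧ B p.1.1 ≤ p.1.2 ∧ p.2 < A p.1.1 then (1 : ℝ≥0∞) else 0)) :=
    hsum.comp (f := fun p : (α × ℝ) × ℝ => (p.1.1, p.1.2, p.2)) (by fun_prop)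
  rw [lintegral_lintegral_swap hsum1.lintegral_prod_right'.aemeasurable]
  refine lintegral_congr fun u => ?_
  have hsum2 : Measurable fun p : α × ℝ =>
      ((if u ≤ p.2 ∧ A p.1 ≤ u ∧ p.2 < B p.1 then (1 : ℝ≥0∞) else 0) +
        (if u ≤ p.2 ∧ B p.1 ≤ u ∧ p.2 < A p.1 then (1 : ℝ≥0∞) else 0)) :=
    hsum.comp (f := fun p : α × ℝ => (p.1, u, p.2)) (by fun_prop)
  rw [lintegral_lintegral_swap hsum2.aemeasurable]
  refine lintegral_congr fun v => ?_
  have key : ∀ {A B : α → ℝ}, Measurable A → Measurable B →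
      ∫⁻ x, (if u ≤ v ∧ A x ≤ u ∧ v < B x then (1 : ℝ≥0∞) else 0) ∂m =
        if u ≤ v then m ({x | A x ≤ u} \ {x | B x ≤ v}) else 0 := by
    intro A B hA hB
    by_cases h : u ≤ v
    · have : (fun x => if u ≤ v ∧ A x ≤ u ∧ v < B x then (1 : ℝ≥0∞) else 0) =
          ({x | A x ≤ u} \ {x | B x ≤ v}).indicator 1 := by
        ext x; simp [Set.indicator_apply, h]
      rw [this, lintegral_indicator_one ((measurableSet_le hA measurable_const).diff
        (measurableSet_le hB measurable_const)), if_pos h]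
    · simp [h]
  have hsum3 : Measurable fun x : α => (if u ≤ v ∧ A x ≤ u ∧ v < B x then (1 : ℝ≥0∞) else 0) :=
    (hmeas hA hB).comp (f := fun x => (x, u, v)) (by fun_prop)
  rw [lintegral_add_left hsum3, key hA hB, key hB hA]
  split_ifs <;> simp

/-- For nested sets the general lower bound on the measure of a difference is attained, with
truncated subtraction. This is what makes the monotone coupling optimal. -/
lemma measure_diff_of_nested {α : Type*} [MeasurableSpace α] (m : Measure α) [IsFiniteMeasure m]
    {s t : Set α} (ht : MeasurableSet t) (h : s ⊆ t ∨ t ⊆ s) : m (s \ t) = m s - m t := by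
  rcases h with h | h
  · rw [Set.sdiff_eq_empty.2 h, measure_empty, tsub_eq_zero_of_le (measure_mono h)]
  · exact measure_sdiff h ht.nullMeasurableSet (measure_ne_top _ _)

/-- Among all couplings with the same marginals, the monotone one has the least quadratic cost. -/
lemma lintegral_sq_sub_otMap_le {α : Type*} [MeasurableSpace α] (m : Measure α)
    [IsProbabilityMeasure m] {A B : α → ℝ} (hA : Measurable A) (hB : Measurable B)
    (ρ ν : Measure ℝ) [IsProbabilityMeasure ρ] [NullSingletonClass ρ] [IsProbabilityMeasure ν]
    (hAρ : m.map A = ρ) (hBν : m.map B = ν) :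
    ∫⁻ s, ENNReal.ofReal ((s - otMap ρ ν s) ^ 2) ∂ρ ≤ ∫⁻ x, ENNReal.ofReal ((A x - B x) ^ 2) ∂m := by
  have hot := measurable_otMap ρ ν
  rw [lintegral_sq_sub_eq m hA hB, show ∫⁻ s, ENNReal.ofReal ((s - otMap ρ ν s) ^ 2) ∂ρ = _ from
    lintegral_sq_sub_eq ρ measurable_id hot]
  gcongr with u v
  split_ifs with huv
  swap
  · exact le_rfl
  have hν : ∀ t, ρ {s | otMap ρ ν s ≤ t} = ν (Set.Iic t) := fun t => by
    conv_rhs => rw [← map_otMap ρ ν, Measure.map_apply hot measurableSet_Iic]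
    rfl
  have hBm : ∀ t, m {x | B x ≤ t} = ν (Set.Iic t) := fun t => by
    rw [← hBν, Measure.map_apply hB measurableSet_Iic]; rfl
  have hAm : ∀ t, m {x | A x ≤ t} = ρ (Set.Iic t) := fun t => by
    rw [← hAρ, Measure.map_apply hA measurableSet_Iic]; rfl
  have hcm : ∀ t, MeasurableSet {s | cdf ρ s ≤ cdf ν t} := fun t =>
    measurableSet_le (monotone_cdf ρ).measurable measurable_const
  have hL : ∀ t, ({s | otMap ρ ν s ≤ t} : Set ℝ) =ᵐ[ρ] {s | cdf ρ s ≤ cdf ν t} := fun t => by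
    filter_upwards [ae_cdf_mem_Ioo ρ] with s hs
    exact propext (otMap_le_iff ρ ν hs t)
  -- Lower sets of a line are totally ordered by inclusion, so the sublevel sets of the two
  -- coordinates of the monotone coupling are nested, up to null sets. Both differences then have
  -- the least measure allowed by the marginals.
  have hlow : ∀ t, IsLowerSet {s | cdf ρ s ≤ cdf ν t} := fun t a b hba ha =>
    (monotone_cdf ρ hba).trans ha
  have e1 : ρ (Set.Iic u \ {s | otMap ρ ν s ≤ v}) = ρ (Set.Iic u) - ν (Set.Iic v) := by
    rw [measure_congr ((ae_eq_refl _).diff (hL v)), measure_diff_of_nested ρ (hcm v)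
      ((isLowerSet_Iic u).total (hlow v)), ← hν v, measure_congr (hL v)]
  have e2 : ρ ({s | otMap ρ ν s ≤ u} \ Set.Iic v) = ν (Set.Iic u) - ρ (Set.Iic v) := by
    rw [measure_congr ((hL u).diff (ae_eq_refl (Set.Iic v))), measure_diff_of_nested ρ measurableSet_Iic
      ((hlow u).total (isLowerSet_Iic v)), ← hν u, measure_congr (hL u)]
  change ρ (Set.Iic u \ {s | otMap ρ ν s ≤ v}) + ρ ({s | otMap ρ ν s ≤ u} \ Set.Iic v) ≤ _
  rw [e1, e2, ← hAm u, ← hBm v, ← hBm u, ← hAm v]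
  exact add_le_add le_measure_sdiff le_measure_sdiff

end SliceMatching

namespace SliceMatching

/-! ### Random orthonormal bases and the uniform distribution on the sphere -/

instance instSecondCountableTopologyOrth (d : ℕ) : SecondCountableTopology (Orth d) :=
  have : SecondCountableTopology (Matrix (Fin d) (Fin d) ℝ) :=
    inferInstanceAs (SecondCountableTopology (Fin d → Fin d → ℝ))
  TopologicalSpace.Subtype.secondCountableTopology _

/-- A left-invariant probability measure on a group is right-invariant. -/
lemma isMulRightInvariant_of_isMulLeftInvariant {G : Type*} [Group G] [MeasurableSpace G]
    [MeasurableMul₂ G] [MeasurableInv G] (H : Measure G) [IsProbabilityMeasure H]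
    [H.IsMulLeftInvariant] : H.IsMulRightInvariant := by
  have : IsProbabilityMeasure H.inv := Measure.isProbabilityMeasure_map measurable_inv.aemeasurable
  -- Integrate `f (x * y)` against the product of `H.inv` and `H` in both orders: left invariance of
  -- `H` removes `x`, right invariance of `H.inv` removes `y`.
  have key : H = H.inv := by
    refine Measure.ext_of_lintegral _ fun f hf => ?_
    calc ∫⁻ y, f y ∂H = ∫⁻ x, ∫⁻ y, f (x * y) ∂H ∂H.inv := by
          simp [lintegral_mul_left_eq_self]
      _ = ∫⁻ y, ∫⁻ x, f (x * y) ∂H.inv ∂H :=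
          lintegral_lintegral_swap (hf.comp measurable_mul).aemeasurable
      _ = ∫⁻ y, f y ∂H.inv := by simp [lintegral_mul_right_eq_self]
  rw [key]
  infer_instance

variable {d : ℕ}

lemma orthonormal_basisVec (P : Orth d) : Orthonormal ℝ (basisVec P) := by
  rw [orthonormal_iff_ite]
  intro i j
  have h := (Matrix.mem_orthogonalGroup_iff' (Fin d) ℝ).1 P.2
  have h2 := congrFun (congrFun h i) j
  rw [Matrix.mul_apply, Matrix.one_apply] at h2
  simp only [basisVec, EuclideanSpace.inner_eq_star_dotProduct, dotProduct]
  rw [← h2]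
  exact Finset.sum_congr rfl fun k _ => by simp [Matrix.transpose_apply, mul_comm]

lemma norm_basisVec (P : Orth d) (i : Fin d) : ‖basisVec P i‖ = 1 := (orthonormal_basisVec P).1 i

lemma basisVec_ne_zero (P : Orth d) (i : Fin d) : basisVec P i ≠ 0 := by
  rw [← norm_ne_zero_iff, norm_basisVec]; exact one_ne_zero

lemma exists_orthonormalBasis_eq_basisVec (P : Orth d) :
    ∃ b : OrthonormalBasis (Fin d) ℝ (E d), ∀ i, b i = basisVec P i := by
  obtain ⟨b, hb⟩ := Orthonormal.exists_orthonormalBasis_extension_of_card_eq (𝕜 := ℝ) (E := E d)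
    (ι := Fin d) (by simp) (v := basisVec P) (s := Set.univ)
    ((orthonormal_basisVec P).comp _ Subtype.val_injective)
  exact ⟨b, fun i => hb i (Set.mem_univ i)⟩

/-- The orthonormal basis whose vectors are the columns of `P`. -/
noncomputable def orthBasis (P : Orth d) : OrthonormalBasis (Fin d) ℝ (E d) :=
  (exists_orthonormalBasis_eq_basisVec P).choose

@[simp] lemma orthBasis_apply (P : Orth d) (i : Fin d) : orthBasis P i = basisVec P i :=
  (exists_orthonormalBasis_eq_basisVec P).choose_spec i

lemma sum_inner_smul_basisVec (P : Orth d) (x : E d) :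
    ∑ i, ⟪x, basisVec P i⟫ • basisVec P i = x := by
  conv_rhs => rw [← (orthBasis P).sum_repr' x]
  simp [real_inner_comm]

lemma sum_sq_inner_basisVec (P : Orth d) (x : E d) :
    ∑ i, ⟪x, basisVec P i⟫ ^ 2 = ‖x‖ ^ 2 := by
  rw [← (orthBasis P).sum_sq_norm_inner_left x]
  simp

lemma norm_sq_sum_smul_basisVec (P : Orth d) (c : Fin d → ℝ) :
    ‖∑ i, c i • basisVec P i‖ ^ 2 = ∑ i, c i ^ 2 := by
  rw [← sum_sq_inner_basisVec P]
  refine Finset.sum_congr rfl fun i _ => ?_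
  rw [(orthonormal_basisVec P).inner_left_fintype]; simp

lemma inner_sum_smul_basisVec (P : Orth d) (c : Fin d → ℝ) (i : Fin d) :
    ⟪∑ j, c j • basisVec P j, basisVec P i⟫ = c i := by
  rw [(orthonormal_basisVec P).inner_left_fintype]; simp

lemma continuous_basisVec (i : Fin d) : Continuous fun P : Orth d => basisVec P i := by
  refine (PiLp.continuous_toLp 2 _).comp (continuous_pi fun j => ?_)
  exact (continuous_subtype_val (p := fun M => M ∈ Matrix.orthogonalGroup (Fin d) ℝ)).matrix_elem j i

/-- The rotation with matrix `P`. -/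
noncomputable def rot (P : Orth d) : E d ≃ₗᵢ[ℝ] E d :=
  (EuclideanSpace.basisFun (Fin d) ℝ).equiv (orthBasis P) (Equiv.refl _)

lemma rot_apply (P : Orth d) (x : E d) : rot P x = ∑ j, x j • basisVec P j := by
  conv_lhs => rw [← (EuclideanSpace.basisFun (Fin d) ℝ).sum_repr x]
  rw [map_sum]
  refine Finset.sum_congr rfl fun j _ => ?_
  rw [map_smul, rot, OrthonormalBasis.equiv_apply_basis]
  simp

/-- This links the action on the sphere with multiplication in the group, so that invariance of Haar
measure can be compared with rotation invariance. -/
lemma rot_basisVec (P R : Orth d) (i : Fin d) : rot P (basisVec R i) = basisVec (P * R) i := by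
  rw [rot_apply]
  ext k
  simp [basisVec, Matrix.mul_apply, mul_comm]

lemma exists_basisVec_eq (i : Fin d) {θ : E d} (hθ : ‖θ‖ = 1) : ∃ R : Orth d, basisVec R i = θ := by
  obtain ⟨b, hb⟩ := Orthonormal.exists_orthonormalBasis_extension_of_card_eq (𝕜 := ℝ) (E := E d)
    (ι := Fin d) (by simp) (v := fun _ => θ) (s := {i})
    ⟨fun _ => hθ, fun a b hab => absurd (Subsingleton.elim a b) hab⟩
  refine ⟨⟨_, (EuclideanSpace.basisFun (Fin d) ℝ).toMatrix_orthonormalBasis_mem_orthogonal b⟩, ?_⟩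
  ext k
  rw [← hb i rfl]
  simp [basisVec, Module.Basis.toMatrix_apply]

/-- The action of a rotation on the unit sphere. -/
noncomputable def rotSphere (P : Orth d) (θ : Metric.sphere (0 : E d) 1) : Metric.sphere (0 : E d) 1 :=
  ⟨rot P θ, by simp⟩

/-- A column of an orthogonal matrix as a point of the unit sphere. -/
noncomputable def colSphere (i : Fin d) (P : Orth d) : Metric.sphere (0 : E d) 1 :=
  ⟨basisVec P i, by simp [norm_basisVec]⟩

@[simp] lemma coe_colSphere (i : Fin d) (P : Orth d) : (colSphere i P : E d) = basisVec P i := rfl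

lemma measurable_colSphere (i : Fin d) : Measurable (colSphere (d := d) i) :=
  (continuous_basisVec i).subtype_mk _ |>.measurable

lemma measurable_rotSphere :
    Measurable fun p : Orth d × Metric.sphere (0 : E d) 1 => rotSphere p.1 p.2 := by
  refine Measurable.subtype_mk (Continuous.measurable ?_)
  simp_rw [rot_apply]
  refine continuous_finsetSum _ fun j _ => ?_
  have h1 : Continuous fun p : Orth d × Metric.sphere (0 : E d) 1 => (p.2 : E d) j :=
    (PiLp.continuous_apply 2 _ j).comp (continuous_subtype_val.comp continuous_snd)
  exact h1.smul ((continuous_basisVec j).comp continuous_fst)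

lemma measurable_rotSphere_right (P : Orth d) : Measurable (rotSphere P) :=
  (((rot P).continuous.comp continuous_subtype_val).subtype_mk _).measurable

-- Surface measure is defined by the volume of the cone over a set; rotations carry cones to cones
-- and preserve volume.
open scoped Pointwise in
lemma map_rotSphere (P : Orth d) : (uniformSphere d).map (rotSphere P) = uniformSphere d := by
  have hm := measurable_rotSphere_right P
  rw [uniformSphere, Measure.map_smul]
  congr 1
  ext s hs
  rw [Measure.map_apply hm hs, Measure.toSphere_apply' _ (hm hs), Measure.toSphere_apply' _ hs]
  congr 1
  have : Set.Ioo (0 : ℝ) 1 • ((↑) '' (rotSphere P ⁻¹' s) : Set (E d)) =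
      rot P ⁻¹' (Set.Ioo (0 : ℝ) 1 • ((↑) '' s : Set (E d))) := by
    ext x
    simp only [Set.mem_smul, Set.mem_image, Set.mem_preimage]
    constructor
    · rintro ⟨r, hr, _, ⟨θ, hθ, rfl⟩, rfl⟩
      exact ⟨r, hr, _, ⟨_, hθ, rfl⟩, by simp [rotSphere]⟩
    · rintro ⟨r, hr, _, ⟨θ, hθ, rfl⟩, h⟩
      refine ⟨r, hr, _, ⟨⟨(rot P).symm θ, by simp⟩, ?_, rfl⟩, ?_⟩
      · convert hθ
        ext1
        simp [rotSphere]
      · rw [← map_smul, h, LinearIsometryEquiv.symm_apply_apply]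
  rw [this]
  exact (rot P).measurePreserving.measure_preimage_equiv (f := (rot P).toMeasurableEquiv) _

/-- In dimension 0 the sphere is empty and cannot be normalized. -/
lemma isProbabilityMeasure_uniformSphere (hd : 1 ≤ d) : IsProbabilityMeasure (uniformSphere d) := by
  have : Nontrivial (E d) := by
    have : Nonempty (Fin d) := ⟨⟨0, hd⟩⟩
    infer_instance
  constructor
  rw [uniformSphere, Measure.smul_apply, smul_eq_mul]
  exact ENNReal.inv_mul_cancel (Measure.measure_univ_ne_zero.2 (Measure.toSphere_ne_zero _))
    (measure_ne_top _ _)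

/-- Each column of a Haar distributed orthogonal matrix is uniform on the sphere. -/
lemma map_colSphere (hd : 1 ≤ d) (H : Measure (Orth d)) [IsProbabilityMeasure H]
    [H.IsMulLeftInvariant] (i : Fin d) : H.map (colSphere i) = uniformSphere d := by
  have := isProbabilityMeasure_uniformSphere hd
  have := isMulRightInvariant_of_isMulLeftInvariant H
  refine Measure.ext_of_lintegral _ fun f hf => ?_
  rw [lintegral_map hf (measurable_colSphere i)]
  symm
  -- Average `f` at the rotated point over both `P` and `θ`. Rotation invariance of the sphere makes
  -- `P` irrelevant; writing `θ` as the `i`-th column of some `R`, right invariance of `H` makes `θ`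
  -- irrelevant.
  calc ∫⁻ θ, f θ ∂(uniformSphere d)
      = ∫⁻ P, ∫⁻ θ, f (rotSphere P θ) ∂(uniformSphere d) ∂H := by
        have : ∀ P : Orth d, ∫⁻ θ, f (rotSphere P θ) ∂(uniformSphere d) =
            ∫⁻ θ, f θ ∂(uniformSphere d) := fun P => by
          conv_rhs => rw [← map_rotSphere P, lintegral_map hf
            (measurable_rotSphere_right _)]
        simp [this]
    _ = ∫⁻ θ, ∫⁻ P, f (rotSphere P θ) ∂H ∂(uniformSphere d) :=
        lintegral_lintegral_swap (hf.comp measurable_rotSphere).aemeasurable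
    _ = ∫⁻ _θ, ∫⁻ P, f (colSphere i P) ∂H ∂(uniformSphere d) := by
        refine lintegral_congr fun θ => ?_
        obtain ⟨R, hR⟩ := exists_basisVec_eq i (by simp : ‖(θ : E d)‖ = 1)
        have : ∀ P, rotSphere P θ = colSphere i (P * R) := fun P => by
          ext1
          rw [coe_colSphere, ← rot_basisVec, hR]
          rfl
        simp_rw [this]
        exact lintegral_mul_right_eq_self (fun P => f (colSphere i P)) R
    _ = ∫⁻ P, f (colSphere i P) ∂H := by simp

/-- The cone over this great subsphere lies in the hyperplane orthogonal to `z`, which is Lebesgue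
null. -/
lemma uniformSphere_inner_eq_zero {z : E d} (hz : z ≠ 0) :
    uniformSphere d {θ | ⟪z, (θ : E d)⟫ = 0} = 0 := by
  have hms : MeasurableSet {θ : Metric.sphere (0 : E d) 1 | ⟪z, (θ : E d)⟫ = 0} :=
    (isClosed_eq (by fun_prop) continuous_const).measurableSet
  rw [uniformSphere, Measure.smul_apply, Measure.toSphere_apply' _ hms]
  have : (volume : Measure (E d)) ((ℝ ∙ z)ᗮ : Submodule ℝ (E d)) = 0 := by
    refine Measure.addHaar_submodule _ _ fun h => hz ?_
    have : z ∈ ((ℝ ∙ z)ᗮ : Submodule ℝ (E d)) := by rw [h]; trivial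
    rw [Submodule.mem_orthogonal_singleton_iff_inner_right] at this
    exact inner_self_eq_zero.1 this
  rw [measure_mono_null _ this]
  · simp
  · rintro x ⟨r, hr, _, ⟨θ, hθ, rfl⟩, rfl⟩
    rw [SetLike.mem_coe, Submodule.mem_orthogonal_singleton_iff_inner_right]
    simp only [inner_smul_right]
    rw [show ⟪z, (θ : E d)⟫ = 0 from hθ, mul_zero]

/-- Slabs around hyperplanes have uniformly small spherical measure. -/
lemma exists_uniformSphere_slab_le (hd : 1 ≤ d) {κ : ℝ≥0∞} (hκ : 0 < κ) :
    ∃ s : ℝ, 0 < s ∧ ∀ z : E d, z ≠ 0 →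
      uniformSphere d {θ | |⟪z, (θ : E d)⟫| ≤ s * ‖z‖} ≤ κ := by
  have := isProbabilityMeasure_uniformSphere hd
  set e : E d := basisVec 1 ⟨0, hd⟩ with he
  have hms : ∀ (z : E d) (s : ℝ),
      MeasurableSet {θ : Metric.sphere (0 : E d) 1 | |⟪z, (θ : E d)⟫| ≤ s} := fun z s =>
    (isClosed_le (by fun_prop) continuous_const).measurableSet
  have hlim : Tendsto (fun n : ℕ => uniformSphere d {θ | |⟪e, (θ : E d)⟫| ≤ 1 / ((n : ℝ) + 1)}) atTop
      (𝓝 (uniformSphere d (⋂ n : ℕ, {θ | |⟪e, (θ : E d)⟫| ≤ 1 / ((n : ℝ) + 1)}))) := by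
    refine tendsto_measure_iInter_atTop (fun n => (hms _ _).nullMeasurableSet) ?_
      ⟨0, measure_ne_top _ _⟩
    intro m n hmn θ hθ
    exact le_trans (show |⟪e, (θ : E d)⟫| ≤ 1 / ((n : ℝ) + 1) from hθ) (Nat.one_div_le_one_div hmn)
  have h0 : uniformSphere d (⋂ n : ℕ, {θ | |⟪e, (θ : E d)⟫| ≤ 1 / ((n : ℝ) + 1)}) = 0 := by
    refine measure_mono_null (fun θ hθ => ?_) (uniformSphere_inner_eq_zero (z := e)
      (basisVec_ne_zero _ _))
    rw [Set.mem_iInter] at hθ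
    have : |⟪e, (θ : E d)⟫| ≤ 0 :=
      ge_of_tendsto' tendsto_one_div_add_atTop_nhds_zero_nat hθ
    exact abs_eq_zero.1 (le_antisymm this (abs_nonneg _))
  rw [h0] at hlim
  obtain ⟨n, hn⟩ := (hlim.eventually (gt_mem_nhds hκ)).exists
  refine ⟨1 / ((n : ℝ) + 1), by positivity, fun z hz => ?_⟩
  -- The width was chosen for the single vector `e`; rotating `e` onto the direction of `z` makes it
  -- valid for every `z`.
  obtain ⟨R, hR⟩ := exists_basisVec_eq (⟨0, hd⟩ : Fin d) (norm_smul_inv_norm (𝕜 := ℝ) hz)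
  have hRe : rot R e = ((‖z‖⁻¹ : ℝ)) • z := by
    rw [he, rot_basisVec, mul_one, hR]; simp
  have hzR : z = ‖z‖ • rot R e := by
    rw [hRe, smul_smul, mul_inv_cancel₀ (norm_ne_zero_iff.2 hz), one_smul]
  refine le_trans (le_of_eq ?_) hn.le
  conv_lhs => rw [← map_rotSphere R]
  rw [Measure.map_apply (measurable_rotSphere_right _) (hms _ _)]
  congr 1
  ext θ
  simp only [Set.mem_preimage, Set.mem_ofPred_eq, rotSphere]
  nth_rewrite 1 [hzR]
  rw [real_inner_smul_left, LinearIsometryEquiv.inner_map_map, abs_mul, abs_norm, mul_comm,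
    mul_le_mul_iff_left₀ (norm_pos_iff.2 hz)]

end SliceMatching

namespace SliceMatching

variable {d : ℕ}

/-! ### Slices of a measure -/

/-- The rank of `x` under `σ` in direction `θ`. -/
noncomputable def rank (σ : Measure (E d)) (θ x : E d) : ℝ := cdf (proj σ θ) ⟪x, θ⟫

/-- The optimal transport map in direction `θ` evaluated at the projection of `x`. -/
noncomputable def sliceVal (μ σ : Measure (E d)) (θ x : E d) : ℝ :=
  otMap (proj σ θ) (proj μ θ) ⟪x, θ⟫

/-- The squared sliced Wasserstein distance. -/
noncomputable def loss (μ σ : Measure (E d)) : ℝ≥0∞ :=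
  ∫⁻ x, ∫⁻ θ : Metric.sphere (0 : E d) 1, ‖⟪x, (θ : E d)⟫ - sliceVal μ σ θ x‖ₑ ^ 2
    ∂(uniformSphere d) ∂σ

/-- Atomless probability measures with finite second moment. -/
structure IsP2 (σ : Measure (E d)) : Prop where
  isProbabilityMeasure : IsProbabilityMeasure σ
  secondMoment : ∫⁻ x, ‖x‖ₑ ^ 2 ∂σ < ∞
  nullSingletonClass : NullSingletonClass σ

lemma IsP2ac.isP2 (hd : 1 ≤ d) {σ : Measure (E d)} (h : IsP2ac σ) : IsP2 σ := by
  have : Nonempty (Fin d) := ⟨⟨0, hd⟩⟩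
  exact ⟨h.1, h.2, ⟨fun x => h.3 (measure_singleton x)⟩⟩

lemma enorm_sq_eq_ofReal (r : ℝ) : ‖r‖ₑ ^ 2 = ENNReal.ofReal (r ^ 2) := by
  rw [Real.enorm_eq_ofReal_abs, ← ENNReal.ofReal_pow (abs_nonneg r), sq_abs]

lemma enorm_sq_eq_ofReal_norm_sq (x : E d) : ‖x‖ₑ ^ 2 = ENNReal.ofReal (‖x‖ ^ 2) := by
  rw [← ofReal_norm, ENNReal.ofReal_pow (norm_nonneg x)]

lemma measurable_inner_right (θ : E d) : Measurable fun x : E d => ⟪x, θ⟫ := by fun_prop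

instance isProbabilityMeasure_proj (σ : Measure (E d)) [IsProbabilityMeasure σ] (θ : E d) :
    IsProbabilityMeasure (proj σ θ) :=
  Measure.isProbabilityMeasure_map (measurable_inner_right θ).aemeasurable

lemma cdf_proj (σ : Measure (E d)) [IsProbabilityMeasure σ] (θ : E d) (t : ℝ) :
    cdf (proj σ θ) t = (σ {x | ⟪x, θ⟫ ≤ t}).toReal := by
  rw [cdf_eq_real, measureReal_def, proj,
    Measure.map_apply (measurable_inner_right θ) measurableSet_Iic]
  rfl

lemma gradLoss_eq (μ σ : Measure (E d)) (x : E d) :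
    gradLoss μ σ x = (d : ℝ) • ∫ θ : Metric.sphere (0 : E d) 1,
      (⟪x, (θ : E d)⟫ - sliceVal μ σ θ x) • (θ : E d) ∂(uniformSphere d) := rfl

/-! ### Joint measurability when the measure itself is random, given by a Markov kernel -/

section Measurability

variable {α : Type*} [MeasurableSpace α] (κ : Kernel α (E d)) [IsMarkovKernel κ]

lemma measurable_cdf_proj :
    Measurable fun p : α × E d × ℝ => cdf (proj (κ p.1) p.2.1) p.2.2 := by
  simp_rw [cdf_proj]
  refine Measurable.ennreal_toReal ?_
  let η : Kernel (α × E d × ℝ) (E d) := κ.comap Prod.fst measurable_fst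
  have hs : MeasurableSet {q : (α × E d × ℝ) × E d | ⟪q.2, q.1.2.1⟫ ≤ q.1.2.2} :=
    measurableSet_le (by fun_prop) (by fun_prop)
  exact Kernel.measurable_kernel_prodMk_left (κ := η) hs

lemma measurable_rank : Measurable fun p : α × E d × E d => rank (κ p.1) p.2.1 p.2.2 :=
  (measurable_cdf_proj κ).comp (f := fun p : α × E d × E d => (p.1, p.2.1, ⟪p.2.2, p.2.1⟫))
    (by fun_prop)

lemma measurable_cdf_proj_right (μ : Measure (E d)) [IsProbabilityMeasure μ] (t : ℝ) :
    Measurable fun θ : E d => cdf (proj μ θ) t :=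
  (measurable_cdf_proj (Kernel.const Unit μ)).comp (f := fun θ : E d => ((), θ, t)) (by fun_prop)

variable (μ : Measure (E d)) [IsProbabilityMeasure μ]

lemma measurable_quantile_proj : Measurable fun p : E d × ℝ => quantile (proj μ p.1) p.2 :=
  measurable_quantile_comp _ _ (fun t => (measurable_cdf_proj_right μ t).comp measurable_fst)
    measurable_snd

lemma measurable_sliceVal :
    Measurable fun p : α × E d × E d => sliceVal μ (κ p.1) p.2.1 p.2.2 :=
  (measurable_quantile_proj μ).comp (f := fun p : α × E d × E d =>
    (p.2.1, rank (κ p.1) p.2.1 p.2.2)) (measurable_snd.fst.prodMk (measurable_rank κ))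

lemma measurable_sliceMap :
    Measurable fun p : (α × Orth d) × E d => sliceMap μ (κ p.1.1) p.1.2 p.2 := by
  refine Finset.measurable_sum _ fun i _ => ?_
  have hb : Measurable fun p : (α × Orth d) × E d => basisVec p.1.2 i :=
    (continuous_basisVec i).measurable.comp (by fun_prop)
  have h1 : Measurable fun p : (α × Orth d) × E d =>
      (p.1.1, basisVec p.1.2 i, p.2) := by fun_prop
  exact ((measurable_sliceVal κ μ).comp h1).smul hb

attribute [local irreducible] sliceVal sliceMap

lemma measurable_slice_residual : Measurable fun p : (α × E d) × Metric.sphere (0 : E d) 1 =>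
    ⟪p.1.2, (p.2 : E d)⟫ - sliceVal μ (κ p.1.1) p.2 p.1.2 := by
  have h1 : Measurable fun p : (α × E d) × Metric.sphere (0 : E d) 1 =>
      (p.1.1, (p.2 : E d), p.1.2) := by fun_prop
  have h2 : Measurable fun p : (α × E d) × Metric.sphere (0 : E d) 1 => ⟪p.1.2, (p.2 : E d)⟫ := by
    fun_prop
  have h3 : Measurable fun p : (α × E d) × Metric.sphere (0 : E d) 1 =>
    sliceVal μ (κ p.1.1) p.2 p.1.2 := (measurable_sliceVal κ μ).comp h1
  exact h2.sub h3

lemma measurable_gradLoss [SFinite (uniformSphere d)] :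
    Measurable fun p : α × E d => gradLoss μ (κ p.1) p.2 := by
  have h : Measurable fun p : (α × E d) × Metric.sphere (0 : E d) 1 =>
      (⟪p.1.2, (p.2 : E d)⟫ - sliceVal μ (κ p.1.1) p.2 p.1.2) • (p.2 : E d) :=
    (measurable_slice_residual κ μ).smul (by fun_prop)
  simp_rw [gradLoss_eq]
  exact (h.stronglyMeasurable.integral_prod_right' (ν := uniformSphere d)).measurable.const_smul
    (d : ℝ)

lemma measurable_gradNormSq [SFinite (uniformSphere d)] :
    Measurable fun a => gradNormSq μ (κ a) :=
  Measurable.lintegral_kernel_prod_right (f := fun a x => ‖gradLoss μ (κ a) x‖ₑ ^ 2)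
    ((measurable_gradLoss κ μ).enorm.pow_const 2)

lemma measurable_loss [SFinite (uniformSphere d)] : Measurable fun a => loss μ (κ a) :=
  Measurable.lintegral_kernel_prod_right
    (f := fun a x => ∫⁻ θ : Metric.sphere (0 : E d) 1,
      ‖⟪x, (θ : E d)⟫ - sliceVal μ (κ a) θ x‖ₑ ^ 2 ∂(uniformSphere d))
    ((measurable_slice_residual κ μ).enorm.pow_const 2).lintegral_prod_right'

/-- The map moving the measure `κ a` one step along the slice-matching scheme. -/
noncomputable def stepKernel (g : ℝ) : Kernel (α × Orth d) (E d) where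
  toFun p := (κ p.1).map fun x => (1 - g) • x + g • sliceMap μ (κ p.1) p.2 x
  measurable' := by
    have hm : Measurable fun p : (α × Orth d) × E d =>
        (1 - g) • p.2 + g • sliceMap μ (κ p.1.1) p.1.2 p.2 := by
      have h := measurable_sliceMap κ μ
      fun_prop
    refine Measure.measurable_of_measurable_coe _ fun s hs => ?_
    have hm' : ∀ p : α × Orth d, Measurable fun x => (1 - g) • x + g • sliceMap μ (κ p.1) p.2 x :=
      fun p => hm.comp (measurable_prodMk_left (x := p))
    simp_rw [fun p => Measure.map_apply (μ := κ p.1) (hm' p) hs]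
    have := Kernel.measurable_kernel_prodMk_left
      (κ := κ.comap (Prod.fst : α × Orth d → α) measurable_fst) (hm hs)
    simpa only [Kernel.comap_apply, ← Set.preimage_comp, Function.comp_def] using this

lemma stepKernel_apply (g : ℝ) (p : α × Orth d) : stepKernel κ μ g p =
    (κ p.1).map fun x => (1 - g) • x + g • sliceMap μ (κ p.1) p.2 x := rfl

end Measurability

/-! ### Laws and atoms of the slices of a fixed measure -/

section Fixed

variable (μ σ : Measure (E d)) [IsProbabilityMeasure μ] [IsProbabilityMeasure σ]

attribute [local irreducible] sliceMap

lemma measurable_rank_uncurry : Measurable fun p : E d × E d => rank σ p.1 p.2 :=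
  (measurable_rank (Kernel.const Unit σ)).comp (f := fun p : E d × E d => ((), p.1, p.2))
    (by fun_prop)

lemma measurable_sliceVal_uncurry : Measurable fun p : E d × E d => sliceVal μ σ p.1 p.2 :=
  (measurable_sliceVal (Kernel.const Unit σ) μ).comp (f := fun p : E d × E d => ((), p.1, p.2))
    (by fun_prop)

lemma measurable_sliceMap_uncurry : Measurable fun p : Orth d × E d => sliceMap μ σ p.1 p.2 :=
  (measurable_sliceMap (Kernel.const Unit σ) μ).comp
    (f := fun p : Orth d × E d => (((), p.1), p.2)) (by fun_prop)

lemma measurable_gradLoss_right [SFinite (uniformSphere d)] : Measurable (gradLoss μ σ) :=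
  (measurable_gradLoss (Kernel.const Unit σ) μ).comp (f := fun x : E d => ((), x)) (by fun_prop)

lemma measurable_stepMap (g : ℝ) (P : Orth d) :
    Measurable fun x => (1 - g) • x + g • sliceMap μ σ P x := by
  have h : Measurable fun x => sliceMap μ σ P x :=
    (measurable_sliceMap_uncurry μ σ).comp (measurable_prodMk_left (x := P))
  fun_prop

omit [IsProbabilityMeasure μ] [IsProbabilityMeasure σ] in
lemma measurable_sliceVal_right (θ : E d) : Measurable (sliceVal μ σ θ) :=
  (measurable_otMap _ _).comp (measurable_inner_right θ)

lemma map_sliceVal (θ : E d) [NullSingletonClass (proj σ θ)] :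
    σ.map (sliceVal μ σ θ) = proj μ θ := by
  rw [← map_otMap (proj σ θ) (proj μ θ)]
  conv_rhs => rw [proj]
  rw [Measure.map_map (measurable_otMap _ _) (measurable_inner_right θ)]
  rfl

lemma map_rank (θ : E d) [NullSingletonClass (proj σ θ)] :
    σ.map (rank σ θ) = volume.restrict (Set.Icc 0 1) := by
  rw [← map_cdf (proj σ θ)]
  conv_rhs => rw [proj]
  rw [Measure.map_map (monotone_cdf _).measurable (measurable_inner_right θ)]
  rfl

lemma ae_rank_mem_Ioo (θ : E d) [NullSingletonClass (proj σ θ)] :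
    ∀ᵐ x ∂σ, rank σ θ x ∈ Set.Ioo (0 : ℝ) 1 :=
  ae_of_ae_map (f := fun x => ⟪x, θ⟫) (measurable_inner_right θ).aemeasurable
    (ae_cdf_mem_Ioo (proj σ θ))

-- Ranks must lie strictly between 0 and 1, since the default values of the quantile outside that
-- range can break monotonicity.
omit [IsProbabilityMeasure μ] [IsProbabilityMeasure σ] in
lemma sliceVal_le_of_inner_le {θ x y : E d} (hx : rank σ θ x ∈ Set.Ioo (0 : ℝ) 1)
    (hy : rank σ θ y ∈ Set.Ioo (0 : ℝ) 1) (h : ⟪x, θ⟫ ≤ ⟪y, θ⟫) :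
    sliceVal μ σ θ x ≤ sliceVal μ σ θ y :=
  monotoneOn_quantile _ hx hy (monotone_cdf _ h)

/-- The transported slice has the law of the slice of `μ`, whatever `σ` is. -/
lemma lintegral_sliceVal_sq (θ : E d) [NullSingletonClass (proj σ θ)] :
    ∫⁻ x, ‖sliceVal μ σ θ x‖ₑ ^ 2 ∂σ = ∫⁻ y, ‖⟪y, θ⟫‖ₑ ^ 2 ∂μ := by
  have hm : Measurable fun t : ℝ => ‖t‖ₑ ^ 2 := by fun_prop
  have h1 := lintegral_map (μ := σ) hm (measurable_sliceVal_right μ σ θ)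
  have h2 := lintegral_map (μ := μ) hm (measurable_inner_right θ)
  rw [map_sliceVal] at h1
  exact h1.symm.trans h2

/-- A measure whose product does not charge `⟨x - y, θ⟩ = 0` has an atomless slice. -/
lemma nullSingletonClass_proj_of_prod {θ : E d}
    (h : (σ.prod σ) {p | ⟪p.1 - p.2, θ⟫ = 0} = 0) : NullSingletonClass (proj σ θ) := by
  refine ⟨fun c => ?_⟩
  rw [proj, Measure.map_apply (measurable_inner_right θ) (measurableSet_singleton c)]
  -- An atom of mass p in the slice would let two independent points agree there with probability at
  -- least p².
  have h2 : (σ.prod σ) (((fun x => ⟪x, θ⟫) ⁻¹' {c}) ×ˢ ((fun x => ⟪x, θ⟫) ⁻¹' {c})) = 0 := by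
    refine measure_mono_null ?_ h
    rintro ⟨x, y⟩ ⟨hx, hy⟩
    have hx : ⟪x, θ⟫ = c := hx
    have hy : ⟪y, θ⟫ = c := hy
    change ⟪x - y, θ⟫ = 0
    rw [inner_sub_left, hx, hy, sub_self]
  rw [Measure.prod_prod, mul_self_eq_zero] at h2
  exact h2

lemma prod_diagonal_eq_zero [NullSingletonClass σ] : (σ.prod σ) {p | p.1 = p.2} = 0 := by
  rw [Measure.measure_prod_null (measurableSet_eq_fun measurable_fst measurable_snd)]
  refine ae_of_all _ fun x => ?_
  have : Prod.mk x ⁻¹' {p : E d × E d | p.1 = p.2} = {x} := by ext y; simp [eq_comm]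
  change σ (Prod.mk x ⁻¹' {p : E d × E d | p.1 = p.2}) = 0
  rw [this, measure_singleton]

lemma measurableSet_inner_sub_eq_zero {α : Type*} [MeasurableSpace α] {f g h : α → E d}
    (hf : Measurable f) (hg : Measurable g) (hh : Measurable h) :
    MeasurableSet {a | ⟪f a - g a, h a⟫ = 0} :=
  measurableSet_eq_fun ((hf.sub hg).inner hh) measurable_const

lemma measurableSet_setOf_inner_eq_zero :
    MeasurableSet {q : Metric.sphere (0 : E d) 1 × E d × E d | ⟪q.2.1 - q.2.2, (q.1 : E d)⟫ = 0} :=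
  measurableSet_inner_sub_eq_zero (by fun_prop) (by fun_prop) (by fun_prop)

/-- Integrate over the direction first: almost every pair consists of distinct points, and the
directions orthogonal to a nonzero difference form a null set. Reading the result in the other order
shows that almost every slice is atomless. -/
lemma prod_inner_eq_zero [IsFiniteMeasure (uniformSphere d)] [NullSingletonClass σ] :
    ((uniformSphere d).prod (σ.prod σ)) {q : Metric.sphere (0 : E d) 1 × E d × E d |
      ⟪q.2.1 - q.2.2, (q.1 : E d)⟫ = 0} = 0 := by
  have hms := measurableSet_setOf_inner_eq_zero (d := d)
  rw [Measure.prod_apply_symm hms,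
    lintegral_eq_zero_iff' (measurable_measure_prodMk_right hms).aemeasurable]
  have : ∀ᵐ p ∂(σ.prod σ), p.1 ≠ p.2 := by
    rw [ae_iff]; simpa using prod_diagonal_eq_zero σ
  filter_upwards [this] with p hp
  change uniformSphere d {θ | ⟪p.1 - p.2, (θ : E d)⟫ = 0} = 0
  exact uniformSphere_inner_eq_zero (sub_ne_zero.2 hp)

/-- Almost every slice of an atomless measure is atomless. -/
lemma ae_nullSingletonClass_proj [IsFiniteMeasure (uniformSphere d)] [NullSingletonClass σ] :
    ∀ᵐ θ : Metric.sphere (0 : E d) 1 ∂(uniformSphere d), NullSingletonClass (proj σ θ) := by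
  have h0 := prod_inner_eq_zero σ
  rw [Measure.measure_prod_null measurableSet_setOf_inner_eq_zero] at h0
  filter_upwards [h0] with θ hθ
  exact nullSingletonClass_proj_of_prod σ hθ

end Fixed

end SliceMatching

namespace SliceMatching

variable {d : ℕ}

/-! ### One step of the slice-matching scheme -/

lemma enorm_sq_sum_smul_basisVec (P : Orth d) (c : Fin d → ℝ) :
    ‖∑ i, c i • basisVec P i‖ₑ ^ 2 = ∑ i, ‖c i‖ₑ ^ 2 := by
  rw [enorm_sq_eq_ofReal_norm_sq, norm_sq_sum_smul_basisVec,
    ENNReal.ofReal_sum_of_nonneg fun i _ => sq_nonneg _]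
  exact Finset.sum_congr rfl fun i _ => (enorm_sq_eq_ofReal _).symm

lemma sliceMap_eq (μ σ : Measure (E d)) (P : Orth d) (x : E d) :
    sliceMap μ σ P x = ∑ i, sliceVal μ σ (basisVec P i) x • basisVec P i := rfl

lemma inner_sliceMap (μ σ : Measure (E d)) (P : Orth d) (x : E d) (i : Fin d) :
    ⟪sliceMap μ σ P x, basisVec P i⟫ = sliceVal μ σ (basisVec P i) x :=
  inner_sum_smul_basisVec P _ i

lemma sliceMap_sub_eq (μ σ : Measure (E d)) (P : Orth d) (x : E d) :
    sliceMap μ σ P x - x =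
      ∑ i, (sliceVal μ σ (basisVec P i) x - ⟪x, basisVec P i⟫) • basisVec P i := by
  conv_lhs => rw [← sum_inner_smul_basisVec P x, sum_inner_smul_basisVec P x, sliceMap_eq]
  simp_rw [sub_smul, Finset.sum_sub_distrib, sum_inner_smul_basisVec]

attribute [local irreducible] sliceMap sliceVal rank

lemma enorm_add_sq_le {F : Type*} [NormedAddCommGroup F] (x y : F) :
    ‖x + y‖ₑ ^ 2 ≤ 2 * (‖x‖ₑ ^ 2 + ‖y‖ₑ ^ 2) := by
  calc ‖x + y‖ₑ ^ 2 ≤ (‖x‖ₑ + ‖y‖ₑ) ^ 2 := by gcongr; exact enorm_add_le x y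
    _ ≤ _ := by
      have := ENNReal.rpow_add_le_mul_rpow_add_rpow ‖x‖ₑ ‖y‖ₑ (p := 2) (by norm_num)
      norm_num at this
      exact this

section Step

variable (μ σ : Measure (E d)) [IsProbabilityMeasure μ] [IsProbabilityMeasure σ]

/-- In the basis `P` each coordinate of the image has the law of the corresponding coordinate of
`μ`, and by Pythagoras the second moment sees only these marginals. The joint law need not be `μ`.
-/
lemma lintegral_sliceMap_sq (P : Orth d)
    (hP : ∀ i, NullSingletonClass (proj σ (basisVec P i))) :
    ∫⁻ x, ‖sliceMap μ σ P x‖ₑ ^ 2 ∂σ = ∫⁻ y, ‖y‖ₑ ^ 2 ∂μ := by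
  have h : ∀ y : E d, ‖y‖ₑ ^ 2 = ∑ i, ‖⟪y, basisVec P i⟫‖ₑ ^ 2 := fun y => by
    conv_lhs => rw [← sum_inner_smul_basisVec P y, enorm_sq_sum_smul_basisVec]
  simp_rw [sliceMap_eq, enorm_sq_sum_smul_basisVec, h]
  rw [lintegral_finsetSum _ fun i _ => (measurable_sliceVal_right μ σ _).enorm.pow_const 2,
    lintegral_finsetSum _ fun i _ => (measurable_inner_right _).enorm.pow_const 2]
  refine Finset.sum_congr rfl fun i _ => ?_
  have := hP i
  exact lintegral_sliceVal_sq μ σ _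

lemma enorm_sq_convexComb_le {g : ℝ} (hg0 : 0 ≤ g) (hg1 : g ≤ 1) (x y : E d) :
    ‖(1 - g) • x + g • y‖ₑ ^ 2 ≤ ENNReal.ofReal (1 - g) * ‖x‖ₑ ^ 2 + ENNReal.ofReal g * ‖y‖ₑ ^ 2 := by
  simp_rw [enorm_sq_eq_ofReal_norm_sq]
  rw [← ENNReal.ofReal_mul (by linarith), ← ENNReal.ofReal_mul hg0,
    ← ENNReal.ofReal_add (mul_nonneg (by linarith) (by positivity)) (by positivity)]
  refine ENNReal.ofReal_le_ofReal ?_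
  have h1 : ‖(1 - g) • x + g • y‖ ≤ (1 - g) * ‖x‖ + g * ‖y‖ := by
    refine (norm_add_le _ _).trans_eq ?_
    rw [norm_smul, norm_smul, Real.norm_of_nonneg hg0, Real.norm_of_nonneg (by linarith)]
  calc ‖(1 - g) • x + g • y‖ ^ 2 ≤ ((1 - g) * ‖x‖ + g * ‖y‖) ^ 2 := by gcongr
    _ ≤ _ := by nlinarith [mul_nonneg (mul_nonneg hg0 (sub_nonneg.2 hg1)) (sq_nonneg (‖x‖ - ‖y‖))]

/-- One step does not increase a common bound on the second moments. -/
lemma lintegral_step_sq_le {g : ℝ} (hg0 : 0 ≤ g) (hg1 : g ≤ 1) (P : Orth d)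
    (hP : ∀ i, NullSingletonClass (proj σ (basisVec P i))) {M : ℝ≥0∞}
    (hσM : ∫⁻ x, ‖x‖ₑ ^ 2 ∂σ ≤ M) (hμM : ∫⁻ x, ‖x‖ₑ ^ 2 ∂μ ≤ M) :
    ∫⁻ x, ‖x‖ₑ ^ 2 ∂(σ.map fun x => (1 - g) • x + g • sliceMap μ σ P x) ≤ M := by
  have hm : Measurable fun x : E d => ‖x‖ₑ ^ 2 := by fun_prop
  rw [lintegral_map hm (measurable_stepMap μ σ g P)]
  calc _ ≤ ∫⁻ x, (ENNReal.ofReal (1 - g) * ‖x‖ₑ ^ 2 +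
        ENNReal.ofReal g * ‖sliceMap μ σ P x‖ₑ ^ 2) ∂σ :=
        lintegral_mono fun x => enorm_sq_convexComb_le hg0 hg1 _ _
    _ = ENNReal.ofReal (1 - g) * ∫⁻ x, ‖x‖ₑ ^ 2 ∂σ +
        ENNReal.ofReal g * ∫⁻ y, ‖y‖ₑ ^ 2 ∂μ := by
        rw [lintegral_add_left (hm.const_mul _), lintegral_const_mul' _ _ (by simp),
          lintegral_const_mul' _ _ (by simp), lintegral_sliceMap_sq μ σ P hP]
    _ ≤ ENNReal.ofReal (1 - g) * M + ENNReal.ofReal g * M := by gcongr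
    _ = M := by
        rw [← add_mul, ← ENNReal.ofReal_add (by linarith) hg0, sub_add_cancel, ENNReal.ofReal_one,
          one_mul]

/-- On the fibre over a point, the `i`-th coordinate forces a sum of two nondecreasing functions of
`⟪y, θ⟫` to be constant. As `g > 0`, the transported coordinate is then constant on the fibre, which
is null because that coordinate has the atomless law `proj μ θ`. One good column is enough. -/
lemma nullSingletonClass_step {g : ℝ} (hg0 : 0 < g) (hg1 : g ≤ 1) (P : Orth d) (i : Fin d)
    [NullSingletonClass (proj σ (basisVec P i))] [NullSingletonClass (proj μ (basisVec P i))] :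
    NullSingletonClass (σ.map fun x => (1 - g) • x + g • sliceMap μ σ P x) := by
  refine ⟨fun c => ?_⟩
  rw [Measure.map_apply (measurable_stepMap μ σ g P) (measurableSet_singleton c)]
  set θ := basisVec P i
  set A := {x | (1 - g) • x + g • sliceMap μ σ P x = c ∧ rank σ θ x ∈ Set.Ioo (0 : ℝ) 1} with hA
  have hsub : (((fun x => (1 - g) • x + g • sliceMap μ σ P x) ⁻¹' {c} : Set (E d))) =ᵐ[σ] A := by
    filter_upwards [ae_rank_mem_Ioo σ θ] with x hx
    exact propext ⟨fun h => ⟨h, hx⟩, fun h => h.1⟩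
  rw [measure_congr hsub]
  rcases A.eq_empty_or_nonempty with h | ⟨x, hx⟩
  · rw [h, measure_empty]
  have hinner : ∀ y ∈ A, (1 - g) * ⟪y, θ⟫ + g * sliceVal μ σ θ y = ⟪c, θ⟫ := fun y hy => by
    rw [← hy.1, inner_add_left, real_inner_smul_left, real_inner_smul_left, inner_sliceMap]
  have hconst : A ⊆ sliceVal μ σ θ ⁻¹' {sliceVal μ σ θ x} := fun y hy => by
    have e1 := hinner x hx
    have e2 := hinner y hy
    have h1g : 0 ≤ 1 - g := by linarith
    change sliceVal μ σ θ y = sliceVal μ σ θ x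
    rcases le_total ⟪x, θ⟫ ⟪y, θ⟫ with h | h
    · have h2 := sliceVal_le_of_inner_le μ σ hx.2 hy.2 h
      refine le_antisymm (le_of_mul_le_mul_left ?_ hg0) h2
      nlinarith [mul_le_mul_of_nonneg_left h h1g]
    · have h2 := sliceVal_le_of_inner_le μ σ hy.2 hx.2 h
      refine le_antisymm h2 (le_of_mul_le_mul_left ?_ hg0)
      nlinarith [mul_le_mul_of_nonneg_left h h1g]
  refine measure_mono_null hconst ?_
  rw [← Measure.map_apply (measurable_sliceVal_right μ σ θ) (measurableSet_singleton _),
    map_sliceVal, measure_singleton]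

lemma measurable_residual : Measurable fun p : E d × Metric.sphere (0 : E d) 1 =>
    ⟪p.1, (p.2 : E d)⟫ - sliceVal μ σ p.2 p.1 := by
  have h := measurable_slice_residual (Kernel.const Unit σ) μ
  exact h.comp (f := fun p : E d × Metric.sphere (0 : E d) 1 => (((), p.1), p.2)) (by fun_prop)

lemma lintegral_lintegral_inner_sq_le [IsProbabilityMeasure (uniformSphere d)] (ρ : Measure (E d)) :
    ∫⁻ θ : Metric.sphere (0 : E d) 1, ∫⁻ y, ‖⟪y, (θ : E d)⟫‖ₑ ^ 2 ∂ρ ∂(uniformSphere d) ≤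
      ∫⁻ y, ‖y‖ₑ ^ 2 ∂ρ := by
  calc _ ≤ ∫⁻ _θ : Metric.sphere (0 : E d) 1, ∫⁻ y, ‖y‖ₑ ^ 2 ∂ρ ∂(uniformSphere d) := by
        refine lintegral_mono fun θ => lintegral_mono fun y => ?_
        gcongr
        rw [enorm_le_iff_norm_le]
        simpa using norm_inner_le_norm (𝕜 := ℝ) y (θ : E d)
    _ = _ := by simp

lemma loss_eq_lintegral_lintegral [IsProbabilityMeasure (uniformSphere d)] :
    loss μ σ = ∫⁻ θ : Metric.sphere (0 : E d) 1, ∫⁻ x, ‖⟪x, (θ : E d)⟫ - sliceVal μ σ θ x‖ₑ ^ 2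
      ∂σ ∂(uniformSphere d) :=
  lintegral_lintegral_swap ((measurable_residual μ σ).enorm.pow_const 2).aemeasurable

/-- Since second moments stay bounded along the scheme, this yields one finite bound on the loss at
all times. -/
lemma loss_le [IsProbabilityMeasure (uniformSphere d)] [NullSingletonClass σ] :
    loss μ σ ≤ 2 * (∫⁻ x, ‖x‖ₑ ^ 2 ∂σ + ∫⁻ x, ‖x‖ₑ ^ 2 ∂μ) := by
  rw [loss_eq_lintegral_lintegral]
  calc _ ≤ ∫⁻ θ : Metric.sphere (0 : E d) 1, 2 * (∫⁻ x, ‖⟪x, (θ : E d)⟫‖ₑ ^ 2 ∂σ +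
        ∫⁻ x, ‖⟪x, (θ : E d)⟫‖ₑ ^ 2 ∂μ) ∂(uniformSphere d) := by
        refine lintegral_mono_ae ?_
        filter_upwards [ae_nullSingletonClass_proj σ] with θ hθ
        rw [← lintegral_sliceVal_sq μ σ θ, ← lintegral_add_left
          ((measurable_inner_right _).enorm.pow_const 2), ← lintegral_const_mul' _ _ (by simp)]
        refine lintegral_mono fun x => ?_
        have := enorm_add_sq_le ⟪x, (θ : E d)⟫ (-sliceVal μ σ θ x)
        rwa [enorm_neg, ← sub_eq_add_neg] at this
    _ ≤ _ := by
        have hm : Measurable fun p : Metric.sphere (0 : E d) 1 × E d =>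
          ‖⟪p.2, (p.1 : E d)⟫‖ₑ ^ 2 := by fun_prop
        rw [lintegral_const_mul' _ _ (by simp), lintegral_add_left hm.lintegral_prod_right']
        gcongr
        · exact lintegral_lintegral_inner_sq_le σ
        · exact lintegral_lintegral_inner_sq_le μ

/-- The loss after a step is at most the cost of the transported couplings. -/
lemma loss_map_le [IsProbabilityMeasure (uniformSphere d)] [NullSingletonClass σ] {S : E d → E d}
    (hS : Measurable S) [NullSingletonClass (σ.map S)] :
    loss μ (σ.map S) ≤ ∫⁻ x, ∫⁻ θ : Metric.sphere (0 : E d) 1,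
      ‖⟪S x, (θ : E d)⟫ - sliceVal μ σ θ x‖ₑ ^ 2 ∂(uniformSphere d) ∂σ := by
  have : IsProbabilityMeasure (σ.map S) := Measure.isProbabilityMeasure_map hS.aemeasurable
  have hm : Measurable fun p : E d × Metric.sphere (0 : E d) 1 =>
      ‖⟪S p.1, (p.2 : E d)⟫ - sliceVal μ σ p.2 p.1‖ₑ ^ 2 := by
    have h1 := measurable_sliceVal_uncurry μ σ
    have h2 : Measurable fun p : E d × Metric.sphere (0 : E d) 1 => sliceVal μ σ p.2 p.1 :=
      h1.comp (f := fun p : E d × Metric.sphere (0 : E d) 1 => ((p.2 : E d), p.1)) (by fun_prop)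
    fun_prop
  have hswap := lintegral_lintegral_swap (μ := σ) (ν := uniformSphere d)
    (f := fun x (θ : Metric.sphere (0 : E d) 1) =>
      ‖⟪S x, (θ : E d)⟫ - sliceVal μ σ θ x‖ₑ ^ 2) hm.aemeasurable
  rw [loss_eq_lintegral_lintegral, hswap]
  refine lintegral_mono_ae ?_
  filter_upwards [ae_nullSingletonClass_proj σ, ae_nullSingletonClass_proj (σ.map S)] with θ h1 h2
  have hA : Measurable fun x => ⟪S x, (θ : E d)⟫ := by fun_prop
  -- Keeping the old target `sliceVal μ σ θ x` for the moved point `S x` couples the right two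
  -- marginals, though in general not optimally.
  have key := lintegral_sq_sub_otMap_le σ hA (measurable_sliceVal_right μ σ θ)
    (proj (σ.map S) θ) (proj μ θ) (by
      rw [proj, Measure.map_map (measurable_inner_right _) hS]; rfl) (map_sliceVal μ σ θ)
  simp_rw [enorm_sq_eq_ofReal]
  refine le_trans (le_of_eq ?_) key
  have hot := measurable_otMap (proj (σ.map S) θ) (proj μ θ)
  conv_rhs => rw [proj]
  rw [lintegral_map (by fun_prop) (measurable_inner_right _)]
  unfold sliceVal
  rfl

end Step

end SliceMatching

namespace SliceMatching

variable {d : ℕ}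

attribute [local irreducible] sliceMap sliceVal rank

/-! ### Expected descent -/

lemma integral_add_add {α : Type*} [MeasurableSpace α] {m : Measure α} {f g h : α → ℝ}
    (hf : Integrable f m) (hg : Integrable g m) (hh : Integrable h m) :
    ∫ a, (f a + g a + h a) ∂m = ∫ a, f a ∂m + ∫ a, g a ∂m + ∫ a, h a ∂m := by
  have h1 : Integrable (fun a => f a + g a) m := hf.add hg
  rw [integral_add h1 hh, integral_add hf hg]

/-- Expansion of a randomly perturbed square, for independent `θ` and `P`. -/
lemma lintegral_lintegral_sq_add_le {S O : Type*} [MeasurableSpace S] [MeasurableSpace O]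
    (U : Measure S) (H : Measure O) [IsProbabilityMeasure U] [IsProbabilityMeasure H]
    {w : S → ℝ} {e : S → E d} {v : O → E d} (he : Measurable e) (he1 : ∀ θ, ‖e θ‖ ≤ 1)
    (hw : MemLp w 2 U) (hv : MemLp v 2 H) {g : ℝ}
    (hneg : g * ⟪∫ P, v P ∂H, ∫ θ, w θ • e θ ∂U⟫ ≤ 0) :
    ∫⁻ P, ∫⁻ θ, ‖w θ + g * ⟪v P, e θ⟫‖ₑ ^ 2 ∂U ∂H +
      ENNReal.ofReal (-(2 * g * ⟪∫ P, v P ∂H, ∫ θ, w θ • e θ ∂U⟫)) ≤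
      ∫⁻ θ, ‖w θ‖ₑ ^ 2 ∂U + ENNReal.ofReal (g ^ 2) * ∫⁻ P, ‖v P‖ₑ ^ 2 ∂H := by
  have hw1 : Integrable w U := hw.integrable (by norm_num)
  have hv1 : Integrable v H := hv.integrable (by norm_num)
  have hw2 : Integrable (fun θ => w θ ^ 2) U := hw.integrable_sq
  have hv2 : Integrable (fun P => ‖v P‖ ^ 2) H := hv.norm.integrable_sq
  have hwe : Integrable (fun θ => w θ • e θ) U := by
    refine hw1.norm.mono' (hw1.1.smul he.aestronglyMeasurable) (ae_of_all _ fun θ => ?_)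
    rw [norm_smul]
    exact mul_le_of_le_one_right (norm_nonneg _) (he1 θ)
  have hi : ∀ P θ, |⟪v P, e θ⟫| ≤ ‖v P‖ := fun P θ =>
    (abs_real_inner_le_norm _ _).trans (mul_le_of_le_one_right (norm_nonneg _) (he1 θ))
  have hin : ∀ P, Integrable (fun θ => w θ * ⟪v P, e θ⟫) U := fun P => by
    have := hwe.const_inner (𝕜 := ℝ) (v P)
    simpa only [real_inner_smul_right] using this
  have hisq : ∀ P, Integrable (fun θ => ⟪v P, e θ⟫ ^ 2) U := fun P => by
    refine Integrable.mono' (integrable_const (‖v P‖ ^ 2)) (by fun_prop) (ae_of_all _ fun θ => ?_)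
    rw [Real.norm_of_nonneg (sq_nonneg _), ← sq_abs]
    exact pow_le_pow_left₀ (abs_nonneg _) (hi P θ) 2
  set W := ∫ θ, w θ • e θ ∂U
  -- The quadratic term is bounded crudely by `‖v P‖ ^ 2`; it only meets the summable factor `g ^
  -- 2`.
  have hinner : ∀ P, ∫ θ, (w θ + g * ⟪v P, e θ⟫) ^ 2 ∂U ≤
      ∫ θ, w θ ^ 2 ∂U + 2 * g * ⟪v P, W⟫ + g ^ 2 * ‖v P‖ ^ 2 := fun P => by
    have e1 : ∀ θ, (w θ + g * ⟪v P, e θ⟫) ^ 2 =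
        w θ ^ 2 + 2 * g * (w θ * ⟪v P, e θ⟫) + g ^ 2 * ⟪v P, e θ⟫ ^ 2 := fun θ => by ring
    simp_rw [e1]
    rw [integral_add_add hw2 ((hin P).const_mul _) ((hisq P).const_mul _), integral_const_mul,
      integral_const_mul]
    have e2 : ∫ θ, w θ * ⟪v P, e θ⟫ ∂U = ⟪v P, W⟫ := by
      rw [← integral_inner hwe]
      simp only [real_inner_smul_right]
    rw [e2]
    gcongr
    calc ∫ θ, ⟪v P, e θ⟫ ^ 2 ∂U ≤ ∫ _θ, ‖v P‖ ^ 2 ∂U := by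
          refine integral_mono (hisq P) (integrable_const _) fun θ => ?_
          rw [← sq_abs ⟪v P, e θ⟫]
          exact pow_le_pow_left₀ (abs_nonneg _) (hi P θ) 2
      _ = ‖v P‖ ^ 2 := by simp
  have hsqint : ∀ P, Integrable (fun θ => (w θ + g * ⟪v P, e θ⟫) ^ 2) U := fun P => by
    have e1 : ∀ θ, (w θ + g * ⟪v P, e θ⟫) ^ 2 =
        w θ ^ 2 + 2 * g * (w θ * ⟪v P, e θ⟫) + g ^ 2 * ⟪v P, e θ⟫ ^ 2 := fun θ => by ring
    simp_rw [e1]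
    exact (hw2.add ((hin P).const_mul _)).add ((hisq P).const_mul _)
  have hrhs : Integrable (fun P => ∫ θ, w θ ^ 2 ∂U + 2 * g * ⟪v P, W⟫ + g ^ 2 * ‖v P‖ ^ 2) H :=
    ((integrable_const _).add ((hv1.inner_const (𝕜 := ℝ) W).const_mul _)).add (hv2.const_mul _)
  have hval : ∫ P, (∫ θ, w θ ^ 2 ∂U + 2 * g * ⟪v P, W⟫ + g ^ 2 * ‖v P‖ ^ 2) ∂H =
      ∫ θ, w θ ^ 2 ∂U + 2 * g * ⟪∫ P, v P ∂H, W⟫ + g ^ 2 * ∫ P, ‖v P‖ ^ 2 ∂H := by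
    rw [integral_add_add (integrable_const _) ((hv1.inner_const (𝕜 := ℝ) W).const_mul _)
      (hv2.const_mul _), integral_const_mul, integral_const_mul]
    have : ∫ P, ⟪v P, W⟫ ∂H = ⟪∫ P, v P ∂H, W⟫ := by
      simp_rw [fun P => real_inner_comm W (v P)]
      rw [integral_inner (𝕜 := ℝ) hv1 W, real_inner_comm]
    rw [this]; simp
  have hpos : ∀ P, 0 ≤ ∫ θ, w θ ^ 2 ∂U + 2 * g * ⟪v P, W⟫ + g ^ 2 * ‖v P‖ ^ 2 := fun P =>
    (integral_nonneg fun θ => sq_nonneg _).trans (hinner P)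
  have h1 : ∫⁻ P, ∫⁻ θ, ‖w θ + g * ⟪v P, e θ⟫‖ₑ ^ 2 ∂U ∂H ≤ ENNReal.ofReal
      (∫ θ, w θ ^ 2 ∂U + 2 * g * ⟪∫ P, v P ∂H, W⟫ + g ^ 2 * ∫ P, ‖v P‖ ^ 2 ∂H) := by
    rw [← hval, ofReal_integral_eq_lintegral_ofReal hrhs (ae_of_all _ hpos)]
    refine lintegral_mono fun P => ?_
    simp_rw [enorm_sq_eq_ofReal]
    rw [← ofReal_integral_eq_lintegral_ofReal (hsqint P) (ae_of_all _ fun θ => sq_nonneg _)]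
    exact ENNReal.ofReal_le_ofReal (hinner P)
  have h2 : ∫⁻ θ, ‖w θ‖ₑ ^ 2 ∂U = ENNReal.ofReal (∫ θ, w θ ^ 2 ∂U) := by
    simp_rw [enorm_sq_eq_ofReal]
    rw [ofReal_integral_eq_lintegral_ofReal hw2 (ae_of_all _ fun θ => sq_nonneg _)]
  have h3 : ∫⁻ P, ‖v P‖ₑ ^ 2 ∂H = ENNReal.ofReal (∫ P, ‖v P‖ ^ 2 ∂H) := by
    simp_rw [enorm_sq_eq_ofReal_norm_sq]
    rw [ofReal_integral_eq_lintegral_ofReal hv2 (ae_of_all _ fun θ => sq_nonneg _)]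
  have hnn : 0 ≤ ∫ θ, w θ ^ 2 ∂U + 2 * g * ⟪∫ P, v P ∂H, W⟫ + g ^ 2 * ∫ P, ‖v P‖ ^ 2 ∂H := by
    rw [← hval]; exact integral_nonneg hpos
  rw [h2, h3, ← ENNReal.ofReal_mul (sq_nonneg _),
    ← ENNReal.ofReal_add (integral_nonneg fun θ => sq_nonneg _)
      (mul_nonneg (sq_nonneg _) (integral_nonneg fun θ => sq_nonneg _))]
  refine (add_le_add_left h1 _).trans ?_
  -- By `hneg` the cross term moved to the left is nonnegative, so `ENNReal.ofReal` truncates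
  -- nothing.
  rw [← ENNReal.ofReal_add hnn (by linarith)]
  exact ENNReal.ofReal_le_ofReal (by linarith)

section Descent

variable (μ σ : Measure (E d)) [IsProbabilityMeasure μ] [IsProbabilityMeasure σ]

lemma measurable_residual_right (x : E d) : Measurable fun θ : Metric.sphere (0 : E d) 1 =>
    ⟪x, (θ : E d)⟫ - sliceVal μ σ θ x :=
  (measurable_residual μ σ).comp (f := fun θ : Metric.sphere (0 : E d) 1 => (x, θ)) (by fun_prop)

/-- The residual of almost every point is square integrable over the directions. -/
lemma ae_memLp_residual (hσ : loss μ σ ≠ ∞) [SFinite (uniformSphere d)] :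
    ∀ᵐ x ∂σ, MemLp (fun θ : Metric.sphere (0 : E d) 1 => ⟪x, (θ : E d)⟫ - sliceVal μ σ θ x) 2
      (uniformSphere d) := by
  have hm := ((measurable_residual μ σ).enorm.pow_const 2).lintegral_prod_right' (ν := uniformSphere d)
  filter_upwards [ae_lt_top hm hσ] with x hx
  refine ⟨(measurable_residual_right μ σ x).aestronglyMeasurable, ?_⟩
  rw [eLpNorm_lt_top_iff_lintegral_rpow_enorm_lt_top (by norm_num) (by norm_num)]
  simpa using hx

lemma measurable_displacement (x : E d) : Measurable fun P : Orth d => sliceMap μ σ P x - x := by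
  have h := measurable_sliceMap_uncurry μ σ
  have h1 : Measurable fun P : Orth d => sliceMap μ σ P x :=
    h.comp (f := fun P : Orth d => (P, x)) (by fun_prop)
  exact h1.sub_const x

variable (H : Measure (Orth d)) [IsProbabilityMeasure H] [H.IsMulLeftInvariant]

/-- Averaging the squared displacement over random bases. -/
lemma lintegral_displacement_sq (hd : 1 ≤ d) (x : E d) :
    ∫⁻ P, ‖sliceMap μ σ P x - x‖ₑ ^ 2 ∂H =
      d * ∫⁻ θ : Metric.sphere (0 : E d) 1, ‖⟪x, (θ : E d)⟫ - sliceVal μ σ θ x‖ₑ ^ 2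
        ∂(uniformSphere d) := by
  have hm : Measurable fun θ : Metric.sphere (0 : E d) 1 =>
    ‖⟪x, (θ : E d)⟫ - sliceVal μ σ θ x‖ₑ ^ 2 := (measurable_residual_right μ σ x).enorm.pow_const 2
  have h1 : ∀ P : Orth d, ‖sliceMap μ σ P x - x‖ₑ ^ 2 =
      ∑ i, ‖⟪x, (colSphere i P : E d)⟫ - sliceVal μ σ (colSphere i P) x‖ₑ ^ 2 := fun P => by
    rw [sliceMap_sub_eq, enorm_sq_sum_smul_basisVec]
    refine Finset.sum_congr rfl fun i _ => ?_
    rw [← enorm_neg, neg_sub, coe_colSphere]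
  simp_rw [h1]
  have hmc : ∀ i : Fin d, Measurable fun P : Orth d =>
    ‖⟪x, (colSphere i P : E d)⟫ - sliceVal μ σ (colSphere i P) x‖ₑ ^ 2 :=
    fun i => hm.comp (measurable_colSphere i)
  rw [lintegral_finsetSum _ fun i _ => hmc i]
  have h2 : ∀ i : Fin d, ∫⁻ P, ‖⟪x, (colSphere i P : E d)⟫ -
      sliceVal μ σ (colSphere i P) x‖ₑ ^ 2 ∂H = ∫⁻ θ : Metric.sphere (0 : E d) 1,
        ‖⟪x, (θ : E d)⟫ - sliceVal μ σ θ x‖ₑ ^ 2 ∂(uniformSphere d) := fun i => by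
    rw [← map_colSphere hd H i, lintegral_map hm (measurable_colSphere i)]
  simp only [h2, Finset.sum_const, Finset.card_univ, Fintype.card_fin, nsmul_eq_mul]

/-- The mean displacement over random bases is the negative gradient. -/
lemma integral_displacement (hd : 1 ≤ d) {x : E d}
    (hx : MemLp (fun θ : Metric.sphere (0 : E d) 1 => ⟪x, (θ : E d)⟫ - sliceVal μ σ θ x) 2
      (uniformSphere d)) :
    ∫ P, (sliceMap μ σ P x - x) ∂H = -gradLoss μ σ x := by
  have := isProbabilityMeasure_uniformSphere hd
  set f : Metric.sphere (0 : E d) 1 → E d :=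
    fun θ => (⟪x, (θ : E d)⟫ - sliceVal μ σ θ x) • (θ : E d) with hf
  have hm : Measurable f := (measurable_residual_right μ σ x).smul (by fun_prop)
  have hfi : Integrable f (uniformSphere d) := by
    refine (hx.integrable (by norm_num)).norm.mono' hm.aestronglyMeasurable (ae_of_all _ fun θ => ?_)
    rw [hf, norm_smul]; simp
  have h1 : ∀ P : Orth d, sliceMap μ σ P x - x = -∑ i, f (colSphere i P) := fun P => by
    rw [sliceMap_sub_eq, ← Finset.sum_neg_distrib]
    refine Finset.sum_congr rfl fun i _ => ?_
    rw [hf, ← neg_smul, neg_sub, coe_colSphere]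
  simp_rw [h1]
  have hint : ∀ i : Fin d, Integrable (fun P => f (colSphere i P)) H := fun i => by
    have h := hfi
    rw [← map_colSphere hd H i] at h
    exact h.comp_measurable (measurable_colSphere i)
  rw [integral_neg, integral_finsetSum _ fun i _ => hint i, gradLoss_eq]
  have h2 : ∀ i : Fin d, ∫ P, f (colSphere i P) ∂H = ∫ θ, f θ ∂(uniformSphere d) := fun i => by
    rw [← map_colSphere hd H i, integral_map (measurable_colSphere i).aemeasurable
      hm.aestronglyMeasurable]
  simp only [h2, Finset.sum_const, Finset.card_univ, Fintype.card_fin]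
  rw [Nat.cast_smul_eq_nsmul]

/-- Expected decrease of the loss in one step. -/
lemma lintegral_loss_step_add_le (hd : 1 ≤ d) [NullSingletonClass σ] (hσ : loss μ σ ≠ ∞)
    {g : ℝ} (hg : 0 ≤ g)
    (hstep : ∀ᵐ P ∂H, NullSingletonClass (σ.map fun x => (1 - g) • x + g • sliceMap μ σ P x)) :
    ∫⁻ P, loss μ (σ.map fun x => (1 - g) • x + g • sliceMap μ σ P x) ∂H +
      ENNReal.ofReal (2 * g / d) * gradNormSq μ σ ≤
      loss μ σ + ENNReal.ofReal (g ^ 2) * (d * loss μ σ) := by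
  have := isProbabilityMeasure_uniformSphere hd
  have hd0 : (0 : ℝ) < d := by exact_mod_cast hd
  have hmS : Measurable fun p : Orth d × E d => sliceMap μ σ p.1 p.2 :=
    measurable_sliceMap_uncurry μ σ
  have hmV := measurable_sliceVal_uncurry μ σ
  have hm : Measurable fun q : (Orth d × E d) × Metric.sphere (0 : E d) 1 =>
      ‖(⟪q.1.2, (q.2 : E d)⟫ - sliceVal μ σ q.2 q.1.2) +
        g * ⟪sliceMap μ σ q.1.1 q.1.2 - q.1.2, (q.2 : E d)⟫‖ₑ ^ 2 := by
    have h1 : Measurable fun q : (Orth d × E d) × Metric.sphere (0 : E d) 1 =>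
      sliceVal μ σ q.2 q.1.2 := hmV.comp
        (f := fun q : (Orth d × E d) × Metric.sphere (0 : E d) 1 => ((q.2 : E d), q.1.2))
        (by fun_prop)
    have h2 : Measurable fun q : (Orth d × E d) × Metric.sphere (0 : E d) 1 =>
      sliceMap μ σ q.1.1 q.1.2 := hmS.comp
        (f := fun q : (Orth d × E d) × Metric.sphere (0 : E d) 1 => q.1) (by fun_prop)
    fun_prop
  have h1 : ∫⁻ P, loss μ (σ.map fun x => (1 - g) • x + g • sliceMap μ σ P x) ∂H ≤
      ∫⁻ P, ∫⁻ x, ∫⁻ θ : Metric.sphere (0 : E d) 1,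
        ‖(⟪x, (θ : E d)⟫ - sliceVal μ σ θ x) + g * ⟪sliceMap μ σ P x - x, (θ : E d)⟫‖ₑ ^ 2
          ∂(uniformSphere d) ∂σ ∂H := by
    refine lintegral_mono_ae ?_
    filter_upwards [hstep] with P hP
    refine (loss_map_le μ σ (measurable_stepMap μ σ g P)).trans_eq ?_
    refine lintegral_congr fun x => lintegral_congr fun θ => ?_
    congr 2
    rw [inner_add_left, real_inner_smul_left, real_inner_smul_left, inner_sub_left]
    ring
  -- Averaging over the basis before the particle allows the square to be expanded for each fixed
  -- `x`.
  have hswap := lintegral_lintegral_swap (μ := H) (ν := σ) (f := fun P x =>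
    ∫⁻ θ : Metric.sphere (0 : E d) 1,
        ‖(⟪x, (θ : E d)⟫ - sliceVal μ σ θ x) + g * ⟪sliceMap μ σ P x - x, (θ : E d)⟫‖ₑ ^ 2
          ∂(uniformSphere d)) hm.lintegral_prod_right'.aemeasurable
  rw [hswap] at h1
  have hmg : Measurable fun x => ‖gradLoss μ σ x‖ₑ ^ 2 :=
    (measurable_gradLoss_right μ σ).enorm.pow_const 2
  refine (add_le_add_left h1 _).trans ?_
  rw [gradNormSq, ← lintegral_const_mul' _ _ (by simp), ← lintegral_add_right _ (hmg.const_mul _)]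
  have hR : loss μ σ + ENNReal.ofReal (g ^ 2) * (d * loss μ σ) =
      ∫⁻ x, (∫⁻ θ : Metric.sphere (0 : E d) 1, ‖⟪x, (θ : E d)⟫ - sliceVal μ σ θ x‖ₑ ^ 2
        ∂(uniformSphere d) + ENNReal.ofReal (g ^ 2) * (d * ∫⁻ θ : Metric.sphere (0 : E d) 1,
          ‖⟪x, (θ : E d)⟫ - sliceVal μ σ θ x‖ₑ ^ 2 ∂(uniformSphere d))) ∂σ := by
    have hml := ((measurable_residual μ σ).enorm.pow_const 2).lintegral_prod_right'
      (ν := uniformSphere d)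
    rw [lintegral_add_left hml, lintegral_const_mul' _ _ (by simp),
      lintegral_const_mul' _ _ (by simp)]
    rfl
  rw [hR]
  refine lintegral_mono_ae ?_
  filter_upwards [ae_memLp_residual μ σ hσ] with x hx
  have hv : MemLp (fun P : Orth d => sliceMap μ σ P x - x) 2 H := by
    refine ⟨(measurable_displacement μ σ x).aestronglyMeasurable, ?_⟩
    rw [eLpNorm_lt_top_iff_lintegral_rpow_enorm_lt_top (by norm_num) (by norm_num)]
    have h := hx.2
    rw [eLpNorm_lt_top_iff_lintegral_rpow_enorm_lt_top (by norm_num) (by norm_num)] at h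
    have h2 := lintegral_displacement_sq μ σ H hd x
    simp only [ENNReal.toReal_ofNat, ENNReal.rpow_ofNat] at h ⊢
    rw [h2]
    exact ENNReal.mul_lt_top (by simp) h
  have hW : ∫ θ : Metric.sphere (0 : E d) 1, (⟪x, (θ : E d)⟫ - sliceVal μ σ θ x) • (θ : E d)
      ∂(uniformSphere d) = (d : ℝ)⁻¹ • gradLoss μ σ x := by
    rw [gradLoss_eq, smul_smul, inv_mul_cancel₀ hd0.ne', one_smul]
  -- The mean displacement is minus the gradient and the averaged residual is the gradient over `d`;
  -- their product is the source of the factor `2 * g / d`.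
  have hin : g * ⟪∫ P, (sliceMap μ σ P x - x) ∂H, ∫ θ : Metric.sphere (0 : E d) 1,
      (⟪x, (θ : E d)⟫ - sliceVal μ σ θ x) • (θ : E d) ∂(uniformSphere d)⟫ =
      -(g / d * ‖gradLoss μ σ x‖ ^ 2) := by
    rw [hW, integral_displacement μ σ H hd hx, inner_neg_left, real_inner_smul_right,
      real_inner_self_eq_norm_sq]
    ring
  have key := lintegral_lintegral_sq_add_le (uniformSphere d) H (e := fun θ => (θ : E d))
    (by fun_prop) (fun θ => by simp) hx hv (g := g) (by rw [hin]; simp only [Left.neg_nonpos_iff]; positivity)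
  rw [mul_assoc, hin, lintegral_displacement_sq μ σ H hd x] at key
  refine le_trans (le_of_eq ?_) key
  congr 1
  rw [enorm_sq_eq_ofReal_norm_sq, ← ENNReal.ofReal_mul (by positivity)]
  congr 1
  ring

end Descent

end SliceMatching

namespace SliceMatching

variable {d : ℕ}

attribute [local irreducible] sliceMap sliceVal rank

/-! ### A small gradient prevents concentration -/

lemma measurableSet_slab (τ : ℝ) :
    MeasurableSet {q : Metric.sphere (0 : E d) 1 × E d × E d |
      |⟪q.2.1 - q.2.2, (q.1 : E d)⟫| ≤ τ} :=
  measurableSet_le (by fun_prop) (by fun_prop)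

/-- Two independent points have slices within `τ` with small probability. -/
lemma exists_prod_slab_le [IsFiniteMeasure (uniformSphere d)] (μ : Measure (E d))
    [IsProbabilityMeasure μ] [NullSingletonClass μ] {κ : ℝ≥0∞} (hκ : 0 < κ) :
    ∃ τ : ℝ, 0 < τ ∧ ((uniformSphere d).prod (μ.prod μ))
      {q | |⟪q.2.1 - q.2.2, (q.1 : E d)⟫| ≤ τ} ≤ κ := by
  set s : ℕ → Set (Metric.sphere (0 : E d) 1 × E d × E d) :=
    fun n => {q | |⟪q.2.1 - q.2.2, (q.1 : E d)⟫| ≤ 1 / ((n : ℝ) + 1)}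
  have hlim := tendsto_measure_iInter_atTop (μ := (uniformSphere d).prod (μ.prod μ)) (s := s)
    (fun n => (measurableSet_slab _).nullMeasurableSet) (fun m n hmn q hq =>
      le_trans (show |⟪q.2.1 - q.2.2, (q.1 : E d)⟫| ≤ 1 / ((n : ℝ) + 1) from hq)
        (Nat.one_div_le_one_div hmn)) ⟨0, measure_ne_top _ _⟩
  have h0 : ((uniformSphere d).prod (μ.prod μ)) (⋂ n, s n) = 0 := by
    refine measure_mono_null (fun q hq => ?_) (prod_inner_eq_zero μ)
    rw [Set.mem_iInter] at hq
    have : |⟪q.2.1 - q.2.2, (q.1 : E d)⟫| ≤ 0 :=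
      ge_of_tendsto' tendsto_one_div_add_atTop_nhds_zero_nat hq
    exact abs_eq_zero.1 (le_antisymm this (abs_nonneg _))
  rw [h0] at hlim
  obtain ⟨n, hn⟩ := (hlim.eventually (gt_mem_nhds hκ)).exists
  exact ⟨1 / ((n : ℝ) + 1), by positivity, hn.le⟩

section

variable (μ σ : Measure (E d)) [IsProbabilityMeasure μ] [IsProbabilityMeasure σ]

lemma measurableSet_sliceVal_sub_le (τ : ℝ) :
    MeasurableSet {q : Metric.sphere (0 : E d) 1 × E d × E d |
      |sliceVal μ σ q.1 q.2.1 - sliceVal μ σ q.1 q.2.2| ≤ τ} := by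
  have h := measurable_sliceVal_uncurry μ σ
  have h1 : Measurable fun q : Metric.sphere (0 : E d) 1 × E d × E d => sliceVal μ σ q.1 q.2.1 :=
    h.comp (f := fun q : Metric.sphere (0 : E d) 1 × E d × E d => ((q.1 : E d), q.2.1))
      (by fun_prop)
  have h2 : Measurable fun q : Metric.sphere (0 : E d) 1 × E d × E d => sliceVal μ σ q.1 q.2.2 :=
    h.comp (f := fun q : Metric.sphere (0 : E d) 1 × E d × E d => ((q.1 : E d), q.2.2))
      (by fun_prop)
  exact measurableSet_le (by fun_prop) measurable_const

/-- For almost every direction, two independent transported slices have a joint law depending on `μ`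
alone. This makes the anti-concentration estimate uniform in `σ`. -/
lemma prod_sliceVal_sub_le_eq [IsFiniteMeasure (uniformSphere d)] [NullSingletonClass σ] (τ : ℝ) :
    ((uniformSphere d).prod (σ.prod σ)) {q |
      |sliceVal μ σ q.1 q.2.1 - sliceVal μ σ q.1 q.2.2| ≤ τ} =
    ((uniformSphere d).prod (μ.prod μ)) {q | |⟪q.2.1 - q.2.2, (q.1 : E d)⟫| ≤ τ} := by
  rw [Measure.prod_apply (measurableSet_sliceVal_sub_le μ σ τ),
    Measure.prod_apply (measurableSet_slab τ)]
  refine lintegral_congr_ae ?_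
  filter_upwards [ae_nullSingletonClass_proj σ] with θ hθ
  have hs : MeasurableSet {p : ℝ × ℝ | |p.1 - p.2| ≤ τ} :=
    measurableSet_le (by fun_prop) (by fun_prop)
  have hv := measurable_sliceVal_right μ σ (θ : E d)
  have hi := measurable_inner_right (θ : E d)
  have e1 : (σ.prod σ).map (Prod.map (sliceVal μ σ θ) (sliceVal μ σ θ)) =
      (proj μ θ).prod (proj μ θ) := by
    rw [← Measure.map_prod_map _ _ hv hv, map_sliceVal]
  have e2 : (μ.prod μ).map (Prod.map (fun y => ⟪y, (θ : E d)⟫) (fun y => ⟪y, (θ : E d)⟫)) =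
      (proj μ θ).prod (proj μ θ) := by
    rw [← Measure.map_prod_map _ _ hi hi]; rfl
  have h1 := congrArg (fun ρ => ρ {p : ℝ × ℝ | |p.1 - p.2| ≤ τ}) (e1.trans e2.symm)
  rw [Measure.map_apply (hv.prodMap hv) hs, Measure.map_apply (hi.prodMap hi) hs] at h1
  refine Eq.trans ?_ (h1.trans ?_)
  · rfl
  · congr 1
    ext p
    simp [inner_sub_left]

lemma ae_ae_rank_mem_Ioo [IsFiniteMeasure (uniformSphere d)] [NullSingletonClass σ] :
    ∀ᵐ x ∂σ, ∀ᵐ θ : Metric.sphere (0 : E d) 1 ∂(uniformSphere d),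
      rank σ θ x ∈ Set.Ioo (0 : ℝ) 1 := by
  have h1 : Measurable fun q : Metric.sphere (0 : E d) 1 × E d => rank σ q.1 q.2 :=
    (measurable_rank_uncurry σ).comp
      (f := fun q : Metric.sphere (0 : E d) 1 × E d => ((q.1 : E d), q.2)) (by fun_prop)
  have hms : MeasurableSet {q : Metric.sphere (0 : E d) 1 × E d |
      rank σ q.1 q.2 ∈ Set.Ioo (0 : ℝ) 1} := h1 measurableSet_Ioo
  refine (Measure.ae_ae_comm (p := fun (θ : Metric.sphere (0 : E d) 1) (x : E d) =>
    rank σ θ x ∈ Set.Ioo (0 : ℝ) 1) hms).1 ?_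
  filter_upwards [ae_nullSingletonClass_proj σ] with θ hθ
  exact ae_rank_mem_Ioo σ (θ : E d)

/-- The gradient separates nearby points whose slices are transported apart. -/
lemma mul_le_of_gradLoss_le [IsProbabilityMeasure (uniformSphere d)] {x y : E d}
    (hx : MemLp (fun θ : Metric.sphere (0 : E d) 1 => ⟪x, (θ : E d)⟫ - sliceVal μ σ θ x) 2
      (uniformSphere d))
    (hy : MemLp (fun θ : Metric.sphere (0 : E d) 1 => ⟪y, (θ : E d)⟫ - sliceVal μ σ θ y) 2
      (uniformSphere d))
    (hrx : ∀ᵐ θ : Metric.sphere (0 : E d) 1 ∂(uniformSphere d), rank σ θ x ∈ Set.Ioo (0 : ℝ) 1)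
    (hry : ∀ᵐ θ : Metric.sphere (0 : E d) 1 ∂(uniformSphere d), rank σ θ y ∈ Set.Ioo (0 : ℝ) 1)
    (hxy : x ≠ y) {s τ c : ℝ} (hs : 0 ≤ s) (hτ : 0 ≤ τ)
    (hU1 : uniformSphere d {θ | |⟪x - y, (θ : E d)⟫| ≤ s * ‖x - y‖} ≤ ENNReal.ofReal (1 / 2))
    (hU2 : uniformSphere d {θ | |sliceVal μ σ θ x - sliceVal μ σ θ y| ≤ τ} ≤ ENNReal.ofReal (1 / 4))
    (hcx : ‖gradLoss μ σ x‖ ≤ c) (hcy : ‖gradLoss μ σ y‖ ≤ c) :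
    d * (τ * s) / 4 ≤ d * ‖x - y‖ + 2 * c := by
  set z := x - y with hz
  have hz0 : 0 < ‖z‖ := norm_pos_iff.2 (sub_ne_zero.2 hxy)
  set U := uniformSphere d
  set w : E d → Metric.sphere (0 : E d) 1 → ℝ := fun x θ => ⟪x, (θ : E d)⟫ - sliceVal μ σ θ x with hw
  have hsm : ∀ {x}, MemLp (w x) 2 U → Integrable (fun θ => w x θ • (θ : E d)) U := fun {x} hx => by
    refine (hx.integrable (by norm_num)).norm.mono' ((measurable_residual_right μ σ x).smul
      (by fun_prop)).aestronglyMeasurable (ae_of_all _ fun θ => ?_)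
    rw [norm_smul]; simp [hw]
  have hin : ∀ {x}, MemLp (w x) 2 U → Integrable (fun θ => w x θ * ⟪z, (θ : E d)⟫) U :=
    fun {x} hx => by simpa only [real_inner_smul_right] using (hsm hx).const_inner (𝕜 := ℝ) z
  have hg : ∀ {x}, MemLp (w x) 2 U → ⟪z, gradLoss μ σ x⟫ = d * ∫ θ, w x θ * ⟪z, (θ : E d)⟫ ∂U :=
    fun {x} hx => by
      rw [gradLoss_eq, real_inner_smul_right, ← integral_inner (hsm hx)]
      simp only [real_inner_smul_right, hw]
  have hzi : ∀ θ : Metric.sphere (0 : E d) 1, |⟪z, (θ : E d)⟫| ≤ ‖z‖ := fun θ => by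
    simpa using abs_real_inner_le_norm z (θ : E d)
  have hzsq : ∀ θ : Metric.sphere (0 : E d) 1, ⟪z, (θ : E d)⟫ ^ 2 ≤ ‖z‖ ^ 2 := fun θ => by
    rw [← sq_abs]; exact pow_le_pow_left₀ (abs_nonneg _) (hzi θ) 2
  have hz2 : Integrable (fun θ : Metric.sphere (0 : E d) 1 => ⟪z, (θ : E d)⟫ ^ 2) U := by
    refine Integrable.mono' (integrable_const (‖z‖ ^ 2)) (by fun_prop) (ae_of_all _ fun θ => ?_)
    rw [Real.norm_of_nonneg (sq_nonneg _)]
    exact hzsq θ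
  set f : Metric.sphere (0 : E d) 1 → ℝ :=
    fun θ => (sliceVal μ σ θ x - sliceVal μ σ θ y) * ⟪z, (θ : E d)⟫ with hf
  have hfeq : f = fun θ : Metric.sphere (0 : E d) 1 => ⟪z, (θ : E d)⟫ ^ 2 - (w x θ * ⟪z, (θ : E d)⟫ - w y θ * ⟪z, (θ : E d)⟫) := by
    ext θ
    simp only [hf, hw, hz, inner_sub_left]; ring
  have hwi : Integrable (fun θ => w x θ * ⟪z, (θ : E d)⟫ - w y θ * ⟪z, (θ : E d)⟫) U :=
    (hin hx).sub (hin hy)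
  have hfi : Integrable f U := by rw [hfeq]; exact hz2.sub hwi
  -- Pairing `z` with the difference of the two gradients gives `d` times the integral of `⟪z, θ⟫ ^
  -- 2 - f θ`; Cauchy–Schwarz and the bounds by `c` control it.
  have hfint : d * ∫ θ, f θ ∂U ≤ d * ‖z‖ ^ 2 + 2 * c * ‖z‖ := by
    rw [hfeq, integral_sub hz2 hwi, integral_sub (hin hx) (hin hy), mul_sub, mul_sub, ← hg hx,
      ← hg hy]
    have h1 : ∫ θ : Metric.sphere (0 : E d) 1, ⟪z, (θ : E d)⟫ ^ 2 ∂U ≤ ‖z‖ ^ 2 := by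
      calc _ ≤ ∫ _θ : Metric.sphere (0 : E d) 1, ‖z‖ ^ 2 ∂U :=
            integral_mono hz2 (integrable_const _) hzsq
        _ = ‖z‖ ^ 2 := by simp
    have h2 := (abs_le.1 (abs_real_inner_le_norm z (gradLoss μ σ x))).1
    have h3 := (abs_le.1 (abs_real_inner_le_norm z (gradLoss μ σ y))).2
    have h4 := mul_le_mul_of_nonneg_left hcx hz0.le
    have h5 := mul_le_mul_of_nonneg_left hcy hz0.le
    have h6 := mul_le_mul_of_nonneg_left h1 (Nat.cast_nonneg (α := ℝ) d)
    linarith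
  -- Transport maps preserve order, so both factors of `f` have compatible signs.
  have hfpos : 0 ≤ᵐ[U] f := by
    filter_upwards [hrx, hry] with θ h1 h2
    simp only [hf, hz, inner_sub_left]
    rcases le_total ⟪x, (θ : E d)⟫ ⟪y, (θ : E d)⟫ with h | h
    · exact mul_nonneg_of_nonpos_of_nonpos
        (sub_nonpos.2 (sliceVal_le_of_inner_le μ σ h1 h2 h)) (sub_nonpos.2 h)
    · exact mul_nonneg (sub_nonneg.2 (sliceVal_le_of_inner_le μ σ h2 h1 h)) (sub_nonneg.2 h)
  have hmark := mul_meas_ge_le_integral_of_nonneg hfpos hfi (τ * (s * ‖z‖))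
  -- The two exceptional sets have total measure at most 3/4; off them both factors of `f` are
  -- large, and Markov's inequality bounds the integral below.
  have hU : (1 / 4 : ℝ) ≤ U.real {θ | τ * (s * ‖z‖) ≤ f θ} := by
    have hcov : (1 : ℝ≥0∞) ≤ ENNReal.ofReal (3 / 4) + U {θ | τ * (s * ‖z‖) ≤ f θ} := by
      calc (1 : ℝ≥0∞) = U Set.univ := measure_univ.symm
        _ ≤ U (({θ | |⟪z, (θ : E d)⟫| ≤ s * ‖z‖} ∪
              {θ | |sliceVal μ σ θ x - sliceVal μ σ θ y| ≤ τ}) ∪ {θ | τ * (s * ‖z‖) ≤ f θ}) := by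
            refine measure_mono_ae ?_
            filter_upwards [hfpos] with θ hθ _
            by_cases h1 : |⟪z, (θ : E d)⟫| ≤ s * ‖z‖
            · exact Or.inl (Or.inl h1)
            by_cases h2 : |sliceVal μ σ θ x - sliceVal μ σ θ y| ≤ τ
            · exact Or.inl (Or.inr h2)
            refine Or.inr ?_
            change τ * (s * ‖z‖) ≤ f θ
            have : f θ = |f θ| := (abs_of_nonneg hθ).symm
            rw [this, hf, abs_mul]
            exact mul_le_mul (not_le.1 h2).le (not_le.1 h1).le (by positivity) (abs_nonneg _)
        _ ≤ ENNReal.ofReal (1 / 2) + ENNReal.ofReal (1 / 4) + U {θ | τ * (s * ‖z‖) ≤ f θ} :=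
            (measure_union_le _ _).trans (add_le_add_left
              ((measure_union_le _ _).trans (add_le_add hU1 hU2)) _)
        _ = _ := by rw [← ENNReal.ofReal_add (by norm_num) (by norm_num)]; norm_num
    have h := ENNReal.toReal_mono (by finiteness) hcov
    rw [ENNReal.toReal_add (by finiteness) (by finiteness), ENNReal.toReal_ofReal (by norm_num)] at h
    simp only [ENNReal.toReal_one] at h
    rw [measureReal_def]
    linarith
  have h1 : τ * (s * ‖z‖) * (1 / 4) ≤ ∫ θ, f θ ∂U :=
    (mul_le_mul_of_nonneg_left hU (by positivity)).trans hmark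
  have h2 := mul_le_mul_of_nonneg_left h1 (Nat.cast_nonneg (α := ℝ) d)
  refine le_of_mul_le_mul_right ?_ hz0
  calc d * (τ * s) / 4 * ‖z‖ = d * (τ * (s * ‖z‖) * (1 / 4)) := by ring
    _ ≤ d * ‖z‖ ^ 2 + 2 * c * ‖z‖ := h2.trans hfint
    _ = _ := by ring

lemma measure_gradLoss_ge_le [SFinite (uniformSphere d)] {c : ℝ} (hc : 0 < c) :
    σ {x | c ≤ ‖gradLoss μ σ x‖} ≤ gradNormSq μ σ / ENNReal.ofReal (c ^ 2) := by
  have hm : Measurable fun x => ‖gradLoss μ σ x‖ₑ ^ 2 :=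
    (measurable_gradLoss_right μ σ).enorm.pow_const 2
  refine le_trans (measure_mono fun x hx => ?_) (meas_ge_le_lintegral_div hm.aemeasurable
    (by simpa using hc.ne') ENNReal.ofReal_ne_top)
  change ENNReal.ofReal (c ^ 2) ≤ ‖gradLoss μ σ x‖ₑ ^ 2
  rw [enorm_sq_eq_ofReal_norm_sq]
  exact ENNReal.ofReal_le_ofReal (pow_le_pow_left₀ hc.le hx 2)

end

/-- A measure with small gradient does not concentrate near points, uniformly in the measure. -/
lemma exists_concentration_le (hd : 1 ≤ d) (μ : Measure (E d)) [IsProbabilityMeasure μ]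
    [NullSingletonClass μ] {κ : ℝ≥0∞} (hκ : 0 < κ) :
    ∃ r : ℝ, 0 < r ∧ ∃ η : ℝ≥0∞, 0 < η ∧ ∀ σ : Measure (E d), IsProbabilityMeasure σ →
      NullSingletonClass σ → loss μ σ ≠ ∞ → gradNormSq μ σ ≤ η →
      (σ.prod σ) {p | ‖p.1 - p.2‖ ≤ r} ≤ κ := by
  have := isProbabilityMeasure_uniformSphere hd
  have hd1 : (1 : ℝ) ≤ d := by exact_mod_cast hd
  obtain ⟨s, hs, hslab⟩ := exists_uniformSphere_slab_le (κ := ENNReal.ofReal (1 / 2)) hd (by simp)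
  -- Markov's inequality at level 1/4 turns this `κ / 8` into the bound `κ / 2` for `B`; the two
  -- large-gradient events receive `κ / 4` each.
  obtain ⟨τ, hτ, hω⟩ := exists_prod_slab_le μ (κ := κ / 8)
    (ENNReal.div_pos hκ.ne' (by simp))
  -- If `‖x - y‖` and both gradients are at most `c`, `mul_le_of_gradLoss_le` reads 4dc ≤ dc + 2c ≤
  -- 3dc, which is absurd since `c > 0`.
  set c := τ * s / 16 with hc
  have hc0 : 0 < c := by positivity
  have hc2 : ENNReal.ofReal (c ^ 2) ≠ 0 := by simpa using hc0.ne'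
  refine ⟨c, hc0, κ / 4 * ENNReal.ofReal (c ^ 2), ENNReal.mul_pos
    (ENNReal.div_pos hκ.ne' (by simp)).ne' hc2, ?_⟩
  intro σ _ _ hloss hG
  set B := {p : E d × E d | ENNReal.ofReal (1 / 4) ≤
    uniformSphere d {θ | |sliceVal μ σ θ p.1 - sliceVal μ σ θ p.2| ≤ τ}} with hB
  have hcov : ({p : E d × E d | ‖p.1 - p.2‖ ≤ c} : Set (E d × E d)) ≤ᵐ[σ.prod σ]
      (({p | c ≤ ‖gradLoss μ σ p.1‖} ∪ {p | c ≤ ‖gradLoss μ σ p.2‖}) ∪ B : Set (E d × E d)) := by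
    have hfst := Measure.quasiMeasurePreserving_fst (μ := σ) (ν := σ)
    have hsnd := Measure.quasiMeasurePreserving_snd (μ := σ) (ν := σ)
    have hne : ∀ᵐ p ∂(σ.prod σ), p.1 ≠ p.2 := by
      rw [ae_iff]; simpa using prod_diagonal_eq_zero σ
    filter_upwards [hfst.ae (ae_memLp_residual μ σ hloss), hsnd.ae (ae_memLp_residual μ σ hloss),
      hfst.ae (ae_ae_rank_mem_Ioo σ), hsnd.ae (ae_ae_rank_mem_Ioo σ), hne] with p h1 h2 h3 h4 h5 hp
    by_contra hnot
    have hnot1 : ¬ c ≤ ‖gradLoss μ σ p.1‖ := fun h => hnot (Or.inl (Or.inl h))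
    have hnot2 : ¬ c ≤ ‖gradLoss μ σ p.2‖ := fun h => hnot (Or.inl (Or.inr h))
    have hnot3 : ¬ ENNReal.ofReal (1 / 4) ≤
      uniformSphere d {θ | |sliceVal μ σ θ p.1 - sliceVal μ σ θ p.2| ≤ τ} := fun h => hnot (Or.inr h)
    have hp : ‖p.1 - p.2‖ ≤ c := hp
    have key := mul_le_of_gradLoss_le μ σ h1 h2 h3 h4 h5 hs.le hτ.le
      (hslab _ (sub_ne_zero.2 h5)) (not_le.1 hnot3).le (not_le.1 hnot1).le (not_le.1 hnot2).le
    have : (d : ℝ) * ‖p.1 - p.2‖ ≤ d * c := by gcongr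
    nlinarith [mul_le_mul_of_nonneg_right hd1 hc0.le]
  have hgrad : σ {x | c ≤ ‖gradLoss μ σ x‖} ≤ κ / 4 := by
    refine (measure_gradLoss_ge_le μ σ hc0).trans ?_
    rw [ENNReal.div_le_iff hc2 ENNReal.ofReal_ne_top]
    exact hG
  have hgm : MeasurableSet {x | c ≤ ‖gradLoss μ σ x‖} :=
    measurableSet_le measurable_const (measurable_gradLoss_right μ σ).norm
  have hB1 : (σ.prod σ) {p | c ≤ ‖gradLoss μ σ p.1‖} ≤ κ / 4 := by
    refine le_trans (le_of_eq ?_) hgrad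
    have := Measure.prod_prod (μ := σ) (ν := σ) {x | c ≤ ‖gradLoss μ σ x‖} Set.univ
    rw [measure_univ, mul_one, Set.prod_univ] at this
    exact this
  have hB2 : (σ.prod σ) {p | c ≤ ‖gradLoss μ σ p.2‖} ≤ κ / 4 := by
    refine le_trans (le_of_eq ?_) hgrad
    have := Measure.prod_prod (μ := σ) (ν := σ) Set.univ {x | c ≤ ‖gradLoss μ σ x‖}
    rw [measure_univ, one_mul, Set.univ_prod] at this
    exact this
  have hB3 : (σ.prod σ) B ≤ κ / 2 := by
    have hms := measurableSet_sliceVal_sub_le μ σ τ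
    have h1 := meas_ge_le_lintegral_div (μ := σ.prod σ)
      (measurable_measure_prodMk_right (μ := uniformSphere d) hms).aemeasurable
      (ε := ENNReal.ofReal (1 / 4)) (by simp) ENNReal.ofReal_ne_top
    rw [← Measure.prod_apply_symm hms, prod_sliceVal_sub_le_eq] at h1
    refine h1.trans ?_
    rw [ENNReal.div_le_iff (by simp) ENNReal.ofReal_ne_top]
    refine hω.trans (le_of_eq ?_)
    rw [ENNReal.ofReal_div_of_pos (by norm_num), ENNReal.ofReal_one, ENNReal.ofReal_ofNat, one_div,
      ENNReal.div_eq_inv_mul, ENNReal.div_eq_inv_mul, mul_comm (2⁻¹ * κ), ← mul_assoc,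
      ← ENNReal.mul_inv (by simp) (by simp)]
    norm_num
  calc (σ.prod σ) {p | ‖p.1 - p.2‖ ≤ c}
      ≤ (σ.prod σ) (({p | c ≤ ‖gradLoss μ σ p.1‖} ∪ {p | c ≤ ‖gradLoss μ σ p.2‖}) ∪ B) :=
        measure_mono_ae hcov
    _ ≤ κ / 4 + κ / 4 + κ / 2 := (measure_union_le _ _).trans (add_le_add
        ((measure_union_le _ _).trans (add_le_add hB1 hB2)) hB3)
    _ = κ := by
        have : κ / 4 + κ / 4 = κ / 2 := by
          rw [← two_mul, ENNReal.div_eq_inv_mul, ENNReal.div_eq_inv_mul, ← mul_assoc]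
          congr 1
          rw [show (4 : ℝ≥0∞) = 2 * 2 by norm_num, ENNReal.mul_inv (by simp) (by simp), ← mul_assoc,
            ENNReal.mul_inv_cancel (by simp) (by simp), one_mul]
        rw [this, ENNReal.add_halves]

end SliceMatching

namespace SliceMatching

variable {d : ℕ}

/-! ### Continuity of the gradient norm along couplings -/

lemma sliceVal_eq_quantile_rank (μ σ : Measure (E d)) (θ x : E d) :
    sliceVal μ σ θ x = quantile (proj μ θ) (rank σ θ x) := rfl

lemma rank_mem_Icc (σ : Measure (E d)) (θ x : E d) : rank σ θ x ∈ Set.Icc (0 : ℝ) 1 :=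
  ⟨cdf_nonneg _ _, cdf_le_one _ _⟩

section Coupling

variable {α : Type*} [MeasurableSpace α] (m : Measure α) [IsProbabilityMeasure m]

lemma rank_map {X : α → E d} (hX : Measurable X) (θ x : E d) :
    rank (m.map X) θ x = m.real {a | ⟪X a, θ⟫ ≤ ⟪x, θ⟫} := by
  have := Measure.isProbabilityMeasure_map (μ := m) hX.aemeasurable
  rw [rank, cdf_proj, Measure.map_apply hX (measurableSet_le (by fun_prop) measurable_const)]
  rfl

attribute [local irreducible] sliceMap sliceVal rank

/-- The difference of ranks is bounded by the probability of an order reversal. -/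
lemma enorm_rank_sub_le {X Y : α → E d} (hX : Measurable X) (hY : Measurable Y) (θ : E d) (a : α) :
    ‖rank (m.map X) θ (X a) - rank (m.map Y) θ (Y a)‖ₑ ≤
      m {b | |⟪X a - X b, θ⟫| ≤ |⟪(X a - Y a) - (X b - Y b), θ⟫|} := by
  rw [rank_map m hX, rank_map m hY, Real.enorm_eq_ofReal_abs]
  refine ENNReal.ofReal_le_of_le_toReal ?_
  refine (abs_measureReal_sub_le_measureReal_symmDiff
    (measurableSet_le (by fun_prop) measurable_const).nullMeasurableSet
    (measurableSet_le (by fun_prop) measurable_const).nullMeasurableSet).trans ?_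
  refine measureReal_mono ?_
  intro b hb
  simp only [Set.mem_symmDiff, Set.mem_ofPred_eq, not_le] at hb
  change |⟪X a - X b, θ⟫| ≤ |⟪(X a - Y a) - (X b - Y b), θ⟫|
  simp only [inner_sub_left]
  -- A point counted by exactly one of the two ranks is ordered differently relative to `a` under
  -- `X` and under `Y`; the relative displacement must therefore cover the gap.
  rcases hb with ⟨h1, h2⟩ | ⟨h1, h2⟩
  · rw [abs_of_nonneg (sub_nonneg.2 h1)]
    refine le_trans ?_ (le_abs_self _)
    linarith
  · rw [abs_of_neg (sub_neg.2 h2)]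
    refine le_trans ?_ (neg_le_abs _)
    linarith

/-- If the law of `X` does not concentrate, the ranks of `X` and of a nearby `Y` are close. -/
lemma lintegral_rank_sub_le [IsProbabilityMeasure (uniformSphere d)] {X Y : α → E d}
    (hX : Measurable X) (hY : Measurable Y) {r s : ℝ} (hr : 0 ≤ r) (hs : 0 < s) {κ : ℝ≥0∞}
    (hconc : ((m.map X).prod (m.map X)) {p | ‖p.1 - p.2‖ ≤ r} ≤ κ)
    (hslab : ∀ z : E d, z ≠ 0 → uniformSphere d {θ | |⟪z, (θ : E d)⟫| ≤ s * ‖z‖} ≤ κ) :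
    ∫⁻ θ : Metric.sphere (0 : E d) 1, ∫⁻ a, ‖rank (m.map X) θ (X a) - rank (m.map Y) θ (Y a)‖ₑ ∂m
      ∂(uniformSphere d) ≤ 2 * κ + 2 * m {a | s * r / 2 ≤ ‖X a - Y a‖} := by
  set U := uniformSphere d
  set K := U.prod (m.prod m)
  set T : Set (Metric.sphere (0 : E d) 1 × α × α) := {q | |⟪X q.2.1 - X q.2.2, (q.1 : E d)⟫| ≤
    |⟪(X q.2.1 - Y q.2.1) - (X q.2.2 - Y q.2.2), (q.1 : E d)⟫|}
  set T1 : Set (α × α) := {p | ‖X p.1 - X p.2‖ ≤ r}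
  set T2 : Set (Metric.sphere (0 : E d) 1 × α × α) := {q | |⟪X q.2.1 - X q.2.2, (q.1 : E d)⟫| ≤
    s * ‖X q.2.1 - X q.2.2‖} ∩ {q | r < ‖X q.2.1 - X q.2.2‖}
  set T3 : Set α := {a | s * r / 2 ≤ ‖X a - Y a‖}
  have hT : MeasurableSet T := measurableSet_le (by fun_prop) (by fun_prop)
  have hT2 : MeasurableSet T2 :=
    (measurableSet_le (by fun_prop) (by fun_prop)).inter (measurableSet_lt (by fun_prop) (by fun_prop))
  -- Outside the exceptional events the gap exceeds `s * r`, while two displacements below `s * r /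
  -- 2` cannot close it.
  have hsub : T ⊆ ((Set.univ ×ˢ T1) ∪ T2) ∪
      ((Set.univ ×ˢ (T3 ×ˢ Set.univ)) ∪ (Set.univ ×ˢ (Set.univ ×ˢ T3))) := by
    rintro ⟨θ, a, b⟩ hq
    have hq : |⟪X a - X b, (θ : E d)⟫| ≤ |⟪(X a - Y a) - (X b - Y b), (θ : E d)⟫| := hq
    by_cases h1 : ‖X a - X b‖ ≤ r
    · exact Or.inl (Or.inl ⟨trivial, h1⟩)
    by_cases h2 : |⟪X a - X b, (θ : E d)⟫| ≤ s * ‖X a - X b‖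
    · exact Or.inl (Or.inr ⟨h2, not_le.1 h1⟩)
    by_cases h3 : s * r / 2 ≤ ‖X a - Y a‖
    · exact Or.inr (Or.inl ⟨trivial, h3, trivial⟩)
    by_cases h4 : s * r / 2 ≤ ‖X b - Y b‖
    · exact Or.inr (Or.inr ⟨trivial, trivial, h4⟩)
    exfalso
    rw [not_le] at h1 h2 h3 h4
    have h5 : |⟪(X a - Y a) - (X b - Y b), (θ : E d)⟫| ≤ ‖X a - Y a‖ + ‖X b - Y b‖ := by
      refine (abs_real_inner_le_norm _ _).trans ?_
      simpa using norm_sub_le (X a - Y a) (X b - Y b)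
    nlinarith [mul_lt_mul_of_pos_left h1 hs]
  have hK1 : K (Set.univ ×ˢ T1) ≤ κ := by
    rw [Measure.prod_prod, measure_univ, one_mul]
    refine le_trans (le_of_eq ?_) hconc
    rw [Measure.map_prod_map _ _ hX hX, Measure.map_apply (hX.prodMap hX)
      (measurableSet_le (by fun_prop) (by fun_prop))]
    rfl
  have hK2 : K T2 ≤ κ := by
    rw [Measure.prod_apply_symm hT2]
    calc _ ≤ ∫⁻ _p : α × α, κ ∂(m.prod m) := by
          refine lintegral_mono fun p => ?_
          by_cases hp : r < ‖X p.1 - X p.2‖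
          · have hz : X p.1 - X p.2 ≠ 0 := norm_pos_iff.1 (hr.trans_lt hp)
            exact (measure_mono fun θ hθ => hθ.1).trans (hslab _ hz)
          · have : (fun θ : Metric.sphere (0 : E d) 1 => (θ, p)) ⁻¹' T2 = ∅ :=
              Set.eq_empty_of_forall_notMem fun θ hθ => hp hθ.2
            rw [this, measure_empty]
            exact zero_le
      _ = κ := by simp
  calc _ ≤ ∫⁻ θ, ∫⁻ a, m {b | (θ, a, b) ∈ T} ∂m ∂U :=
        lintegral_mono fun θ => lintegral_mono fun a => by
          refine (enorm_rank_sub_le m hX hY (θ : E d) a).trans (measure_mono fun b hb => ?_)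
          exact hb
    _ = K T := by
        rw [Measure.prod_apply hT]
        refine lintegral_congr fun θ => ?_
        rw [Measure.prod_apply (measurable_prodMk_left hT)]
        rfl
    _ ≤ (κ + κ) + (m T3 + m T3) := by
        refine (measure_mono hsub).trans ((measure_union_le _ _).trans (add_le_add
          ((measure_union_le _ _).trans (add_le_add hK1 hK2))
          ((measure_union_le _ _).trans (add_le_add ?_ ?_))))
        · rw [Measure.prod_prod, Measure.prod_prod, measure_univ, measure_univ, one_mul, mul_one]
        · rw [Measure.prod_prod, Measure.prod_prod, measure_univ, measure_univ, one_mul, one_mul]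
    _ = _ := by rw [two_mul, two_mul]

lemma measurable_rank_comp {X : α → E d} (hX : Measurable X) :
    Measurable fun p : Metric.sphere (0 : E d) 1 × α => rank (m.map X) p.1 (X p.2) := by
  have := Measure.isProbabilityMeasure_map (μ := m) hX.aemeasurable
  exact (measurable_rank_uncurry (m.map X)).comp
    (f := fun p : Metric.sphere (0 : E d) 1 × α => ((p.1 : E d), X p.2)) (by fun_prop)

/-- Ranks are uniform in almost every direction, so a direction paired with a rank has the same law
for every `X`. One approximation of the quantiles of `μ` thus serves all couplings. -/
lemma lintegral_rank_eq [IsFiniteMeasure (uniformSphere d)] {X : α → E d} (hX : Measurable X)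
    [NullSingletonClass (m.map X)] {h : Metric.sphere (0 : E d) 1 × ℝ → ℝ≥0∞} (hh : Measurable h) :
    ∫⁻ θ : Metric.sphere (0 : E d) 1, ∫⁻ a, h (θ, rank (m.map X) θ (X a)) ∂m ∂(uniformSphere d) =
      ∫⁻ p, h p ∂((uniformSphere d).prod (volume.restrict (Set.Icc 0 1))) := by
  have := Measure.isProbabilityMeasure_map (μ := m) hX.aemeasurable
  rw [lintegral_prod _ hh.aemeasurable]
  refine lintegral_congr_ae ?_
  filter_upwards [ae_nullSingletonClass_proj (m.map X)] with θ hθ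
  have hr : Measurable (rank (m.map X) (θ : E d)) :=
    (measurable_rank_uncurry (m.map X)).comp (f := fun x => ((θ : E d), x)) (by fun_prop)
  have hhθ : Measurable fun u => h (θ, u) := hh.comp (by fun_prop)
  have hhr : Measurable fun x => h (θ, rank (m.map X) θ x) := hhθ.comp hr
  rw [← map_rank (m.map X) (θ : E d), lintegral_map hhθ hr, lintegral_map hhr hX]

/-- The quantile functions of the slices, approximated in `L²` by a continuous function. -/
lemma exists_continuous_quantile_approx [IsProbabilityMeasure (uniformSphere d)]
    (μ : Measure (E d)) [IsProbabilityMeasure μ] (hμ : ∫⁻ x, ‖x‖ₑ ^ 2 ∂μ < ∞) {t : ℝ} (ht : 0 < t) :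
    ∃ g : BoundedContinuousFunction (Metric.sphere (0 : E d) 1 × ℝ) ℝ,
      ∫⁻ p : Metric.sphere (0 : E d) 1 × ℝ, ‖quantile (proj μ p.1) p.2 - g p‖ₑ ^ 2
        ∂((uniformSphere d).prod (volume.restrict (Set.Icc 0 1))) ≤ ENNReal.ofReal (t ^ 2) := by
  set K := (uniformSphere d).prod (volume.restrict (Set.Icc (0 : ℝ) 1))
  set q : Metric.sphere (0 : E d) 1 × ℝ → ℝ := fun p => quantile (proj μ p.1) p.2
  have hq : Measurable q := (measurable_quantile_proj μ).comp
    (f := fun p : Metric.sphere (0 : E d) 1 × ℝ => ((p.1 : E d), p.2)) (by fun_prop)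
  -- For each direction the quantile of a uniform variable has the law of the slice of `μ`, so the
  -- squared norm is at most the second moment of `μ`.
  have hmem : MemLp q 2 K := by
    refine ⟨hq.aestronglyMeasurable, ?_⟩
    rw [eLpNorm_lt_top_iff_lintegral_rpow_enorm_lt_top (by norm_num) (by norm_num)]
    simp only [ENNReal.toReal_ofNat, ENNReal.rpow_ofNat]
    rw [lintegral_prod _ (hq.enorm.pow_const 2).aemeasurable]
    refine lt_of_le_of_lt (le_trans (le_of_eq ?_) (lintegral_lintegral_inner_sq_le μ)) hμ
    refine lintegral_congr fun θ => ?_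
    have hm : Measurable fun t : ℝ => ‖t‖ₑ ^ 2 := by fun_prop
    have h1 := lintegral_map (μ := volume.restrict (Set.Icc (0 : ℝ) 1)) hm
      (measurable_quantile (proj μ θ))
    have h2 := lintegral_map (μ := μ) hm (measurable_inner_right (θ : E d))
    rw [map_quantile] at h1
    exact h1.symm.trans h2
  obtain ⟨g, hg, -⟩ := hmem.exists_boundedContinuous_eLpNorm_sub_le (by norm_num)
    (ε := ENNReal.ofReal t) (by simpa using ht)
  refine ⟨g, ?_⟩
  have h := eLpNorm_nnreal_pow_eq_lintegral (f := q - ⇑g) (μ := K) (p := 2) (by norm_num)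
  simp only [NNReal.coe_ofNat, ENNReal.rpow_ofNat, ENNReal.coe_ofNat] at h
  refine (le_of_eq h.symm).trans ?_
  rw [ENNReal.ofReal_pow ht.le]
  gcongr

/-- Close ranks give close transported slices, uniformly in the coupling. -/
lemma exists_lintegral_sliceVal_sub_le [IsProbabilityMeasure (uniformSphere d)]
    (μ : Measure (E d)) [IsProbabilityMeasure μ] (hμ : ∫⁻ x, ‖x‖ₑ ^ 2 ∂μ < ∞) {t : ℝ} (ht : 0 < t) :
    ∃ δ : ℝ, 0 < δ ∧ ∀ X Y : α → E d, Measurable X → Measurable Y →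
      NullSingletonClass (m.map X) → NullSingletonClass (m.map Y) →
      ∫⁻ θ : Metric.sphere (0 : E d) 1, ∫⁻ a, ‖rank (m.map X) θ (X a) - rank (m.map Y) θ (Y a)‖ₑ ∂m
        ∂(uniformSphere d) ≤ ENNReal.ofReal δ →
      ∫⁻ θ : Metric.sphere (0 : E d) 1, ∫⁻ a,
        ‖sliceVal μ (m.map X) θ (X a) - sliceVal μ (m.map Y) θ (Y a)‖ₑ ^ 2 ∂m
        ∂(uniformSphere d) ≤ ENNReal.ofReal (16 * t ^ 2) := by
  obtain ⟨g, hg⟩ := exists_continuous_quantile_approx μ hμ ht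
  have huc : UniformContinuousOn g (Set.univ ×ˢ Set.Icc (0 : ℝ) 1) :=
    (isCompact_univ.prod isCompact_Icc).uniformContinuousOn_of_continuous g.continuous.continuousOn
  rw [Metric.uniformContinuousOn_iff] at huc
  obtain ⟨η, hη, huc⟩ := huc t ht
  -- Ranks closer than `η` are handled by uniform continuity on the compact sphere × [0, 1]; for the
  -- others the sup bound on `g` is at most `C * |u - v|`, which is linear in the rank difference.
  set C := (2 * ‖g‖) ^ 2 / η
  have hC : 0 ≤ C := by positivity
  refine ⟨t ^ 2 / (C + 1), by positivity, fun X Y hX hY _ _ hδ => ?_⟩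
  set q : Metric.sphere (0 : E d) 1 × ℝ → ℝ := fun p => quantile (proj μ p.1) p.2
  have hq : Measurable q := (measurable_quantile_proj μ).comp
    (f := fun p : Metric.sphere (0 : E d) 1 × ℝ => ((p.1 : E d), p.2)) (by fun_prop)
  have hqg : Measurable fun p => ‖q p - g p‖ₑ ^ 2 := by
    have := g.continuous.measurable
    fun_prop
  have hgpt : ∀ (θ : Metric.sphere (0 : E d) 1) (u v : ℝ), u ∈ Set.Icc (0 : ℝ) 1 →
      v ∈ Set.Icc (0 : ℝ) 1 →
      ‖g (θ, u) - g (θ, v)‖ₑ ^ 2 ≤ ENNReal.ofReal (t ^ 2) + ENNReal.ofReal C * ‖u - v‖ₑ := by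
    intro θ u v hu hv
    rw [enorm_sq_eq_ofReal, Real.enorm_eq_ofReal_abs, ← ENNReal.ofReal_mul hC,
      ← ENNReal.ofReal_add (by positivity) (by positivity)]
    refine ENNReal.ofReal_le_ofReal ?_
    rw [← sq_abs]
    by_cases huv : |u - v| < η
    · have h := huc (θ, u) ⟨trivial, hu⟩ (θ, v) ⟨trivial, hv⟩ (by
        rw [Prod.dist_eq, dist_self, Real.dist_eq]
        exact max_lt hη huv)
      rw [Real.dist_eq] at h
      have := pow_le_pow_left₀ (abs_nonneg _) h.le 2
      nlinarith [mul_nonneg hC (abs_nonneg (u - v))]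
    · have h1 : |g (θ, u) - g (θ, v)| ≤ 2 * ‖g‖ := by
        rw [← Real.dist_eq]; exact g.dist_le_two_norm _ _
      have h2 := pow_le_pow_left₀ (abs_nonneg _) h1 2
      have h3 : (2 * ‖g‖) ^ 2 ≤ C * |u - v| := by
        rw [div_mul_eq_mul_div, le_div_iff₀ hη]
        exact mul_le_mul_of_nonneg_left (not_lt.1 huv) (by positivity)
      nlinarith [sq_nonneg t]
  have hpt : ∀ (θ : Metric.sphere (0 : E d) 1) (a : α),
      ‖sliceVal μ (m.map X) θ (X a) - sliceVal μ (m.map Y) θ (Y a)‖ₑ ^ 2 ≤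
      4 * (‖q (θ, rank (m.map X) θ (X a)) - g (θ, rank (m.map X) θ (X a))‖ₑ ^ 2 +
        (‖q (θ, rank (m.map Y) θ (Y a)) - g (θ, rank (m.map Y) θ (Y a))‖ₑ ^ 2 +
        (ENNReal.ofReal (t ^ 2) + ENNReal.ofReal C *
          ‖rank (m.map X) θ (X a) - rank (m.map Y) θ (Y a)‖ₑ))) := by
    intro θ a
    set u := rank (m.map X) θ (X a)
    set v := rank (m.map Y) θ (Y a)
    have e : sliceVal μ (m.map X) θ (X a) - sliceVal μ (m.map Y) θ (Y a) =
        (q (θ, u) - g (θ, u)) + ((g (θ, v) - q (θ, v)) + (g (θ, u) - g (θ, v))) := by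
      rw [sliceVal_eq_quantile_rank, sliceVal_eq_quantile_rank]
      ring
    rw [e]
    calc _ ≤ 2 * (‖q (θ, u) - g (θ, u)‖ₑ ^ 2 +
          2 * (‖g (θ, v) - q (θ, v)‖ₑ ^ 2 + ‖g (θ, u) - g (θ, v)‖ₑ ^ 2)) :=
          (enorm_add_sq_le _ _).trans (by gcongr; exact enorm_add_sq_le _ _)
      _ ≤ 2 * (2 * ‖q (θ, u) - g (θ, u)‖ₑ ^ 2 +
          2 * (‖q (θ, v) - g (θ, v)‖ₑ ^ 2 + (ENNReal.ofReal (t ^ 2) + ENNReal.ofReal C * ‖u - v‖ₑ))) := by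
          rw [← enorm_neg (g (θ, v) - q (θ, v)), neg_sub]
          gcongr
          · exact le_mul_of_one_le_left zero_le (by norm_num)
          · exact hgpt θ u v (rank_mem_Icc _ _ _) (rank_mem_Icc _ _ _)
      _ = _ := by ring
  have hrX := measurable_rank_comp m hX
  have hrY := measurable_rank_comp m hY
  have hm1 : Measurable fun p : Metric.sphere (0 : E d) 1 × α =>
      ‖q (p.1, rank (m.map X) p.1 (X p.2)) - g (p.1, rank (m.map X) p.1 (X p.2))‖ₑ ^ 2 :=
    hqg.comp (f := fun p : Metric.sphere (0 : E d) 1 × α => (p.1, rank (m.map X) p.1 (X p.2)))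
      (measurable_fst.prodMk hrX)
  have hm2 : Measurable fun p : Metric.sphere (0 : E d) 1 × α =>
      ‖q (p.1, rank (m.map Y) p.1 (Y p.2)) - g (p.1, rank (m.map Y) p.1 (Y p.2))‖ₑ ^ 2 :=
    hqg.comp (f := fun p : Metric.sphere (0 : E d) 1 × α => (p.1, rank (m.map Y) p.1 (Y p.2)))
      (measurable_fst.prodMk hrY)
  have hm3 : Measurable fun p : Metric.sphere (0 : E d) 1 × α =>
      ‖rank (m.map X) p.1 (X p.2) - rank (m.map Y) p.1 (Y p.2)‖ₑ := (hrX.sub hrY).enorm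
  have hI1 := lintegral_rank_eq m hX hqg
  have hI2 := lintegral_rank_eq m hY hqg
  set V := uniformSphere d
  calc _ ≤ ∫⁻ θ, ∫⁻ a, _ ∂m ∂V := lintegral_mono fun θ => lintegral_mono fun a => hpt θ a
    _ = 4 * (∫⁻ θ, ∫⁻ a, ‖q (θ, rank (m.map X) θ (X a)) - g (θ, rank (m.map X) θ (X a))‖ₑ ^ 2 ∂m ∂V +
        (∫⁻ θ, ∫⁻ a, ‖q (θ, rank (m.map Y) θ (Y a)) - g (θ, rank (m.map Y) θ (Y a))‖ₑ ^ 2 ∂m ∂V +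
        (ENNReal.ofReal (t ^ 2) + ENNReal.ofReal C *
          ∫⁻ θ : Metric.sphere (0 : E d) 1, ∫⁻ a, ‖rank (m.map X) θ (X a) - rank (m.map Y) θ (Y a)‖ₑ ∂m ∂V))) := by
        have hc1 : ∀ θ : Metric.sphere (0 : E d) 1, Measurable fun a =>
          ‖q (θ, rank (m.map X) θ (X a)) - g (θ, rank (m.map X) θ (X a))‖ₑ ^ 2 :=
          fun θ => hm1.comp (f := fun a => (θ, a)) (by fun_prop)
        have hc2 : ∀ θ : Metric.sphere (0 : E d) 1, Measurable fun a =>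
          ‖q (θ, rank (m.map Y) θ (Y a)) - g (θ, rank (m.map Y) θ (Y a))‖ₑ ^ 2 :=
          fun θ => hm2.comp (f := fun a => (θ, a)) (by fun_prop)
        simp_rw [fun θ => lintegral_const_mul' (μ := m) 4 (fun a =>
            ‖q (θ, rank (m.map X) θ (X a)) - g (θ, rank (m.map X) θ (X a))‖ₑ ^ 2 +
            (‖q (θ, rank (m.map Y) θ (Y a)) - g (θ, rank (m.map Y) θ (Y a))‖ₑ ^ 2 +
            (ENNReal.ofReal (t ^ 2) + ENNReal.ofReal C *
            ‖rank (m.map X) θ (X a) - rank (m.map Y) θ (Y a)‖ₑ))) (by simp),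
          fun θ => lintegral_add_left (μ := m) (hc1 θ), fun θ => lintegral_add_left (μ := m) (hc2 θ),
          lintegral_add_left measurable_const, lintegral_const_mul' _ _ ENNReal.ofReal_ne_top]
        rw [lintegral_const_mul' _ _ (by simp), lintegral_add_left hm1.lintegral_prod_right',
          lintegral_add_left hm2.lintegral_prod_right', lintegral_add_left measurable_const,
          lintegral_const_mul' _ _ ENNReal.ofReal_ne_top]
        simp
    _ ≤ 4 * (ENNReal.ofReal (t ^ 2) + (ENNReal.ofReal (t ^ 2) + (ENNReal.ofReal (t ^ 2) +
        ENNReal.ofReal C * ENNReal.ofReal (t ^ 2 / (C + 1))))) := by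
        gcongr
        · exact hI1.trans_le hg
        · exact hI2.trans_le hg
    _ ≤ 4 * (ENNReal.ofReal (t ^ 2) + (ENNReal.ofReal (t ^ 2) + (ENNReal.ofReal (t ^ 2) +
        ENNReal.ofReal (t ^ 2)))) := by
        gcongr
        rw [← ENNReal.ofReal_mul hC]
        refine ENNReal.ofReal_le_ofReal ?_
        rw [mul_div_assoc', div_le_iff₀ (by positivity)]
        nlinarith [sq_nonneg t]
    _ = ENNReal.ofReal (16 * t ^ 2) := by
        rw [ENNReal.ofReal_mul (by norm_num), ENNReal.ofReal_ofNat]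
        ring

end Coupling

end SliceMatching

/-! ### Persistence of a small gradient norm, and the deterministic window argument -/

namespace SliceMatching

variable {d : ℕ}

attribute [local irreducible] sliceMap sliceVal rank

lemma lintegral_enorm_sq_le {α F : Type*} [MeasurableSpace α] [NormedAddCommGroup F]
    (m : Measure α) [IsProbabilityMeasure m] {f : α → F} (hf : AEStronglyMeasurable f m) :
    (∫⁻ a, ‖f a‖ₑ ∂m) ^ 2 ≤ ∫⁻ a, ‖f a‖ₑ ^ 2 ∂m := by
  have h := eLpNorm_le_eLpNorm_of_exponent_le (p := 1) (q := 2) (by norm_num) hf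
  have h2 := eLpNorm_nnreal_pow_eq_lintegral (f := f) (μ := m) (p := 2) (by norm_num)
  simp only [NNReal.coe_ofNat, ENNReal.rpow_ofNat, ENNReal.coe_ofNat] at h2
  rw [← h2, ← eLpNorm_one_eq_lintegral_enorm]
  gcongr

/-- Comparison of the gradients of two measures at two points. -/
lemma enorm_gradLoss_sub_sq_le [IsProbabilityMeasure (uniformSphere d)] (μ σ ρ : Measure (E d))
    [IsProbabilityMeasure μ] [IsProbabilityMeasure σ] [IsProbabilityMeasure ρ] {x y : E d}
    (hx : MemLp (fun θ : Metric.sphere (0 : E d) 1 => ⟪x, (θ : E d)⟫ - sliceVal μ σ θ x) 2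
      (uniformSphere d))
    (hy : MemLp (fun θ : Metric.sphere (0 : E d) 1 => ⟪y, (θ : E d)⟫ - sliceVal μ ρ θ y) 2
      (uniformSphere d)) :
    ‖gradLoss μ ρ y - gradLoss μ σ x‖ₑ ^ 2 ≤ (d : ℝ≥0∞) ^ 2 * (2 * (‖x - y‖ₑ ^ 2 +
      ∫⁻ θ : Metric.sphere (0 : E d) 1, ‖sliceVal μ σ θ x - sliceVal μ ρ θ y‖ₑ ^ 2
        ∂(uniformSphere d))) := by
  set U := uniformSphere d
  set v : Metric.sphere (0 : E d) 1 → ℝ := fun θ => ⟪x, (θ : E d)⟫ - sliceVal μ σ θ x with hv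
  set w : Metric.sphere (0 : E d) 1 → ℝ := fun θ => ⟪y, (θ : E d)⟫ - sliceVal μ ρ θ y with hw
  have hint : ∀ {f : Metric.sphere (0 : E d) 1 → ℝ}, MemLp f 2 U →
      Integrable (fun θ => f θ • (θ : E d)) U := fun {f} hf => by
    refine (hf.integrable (by norm_num)).norm.mono' (hf.1.smul (by fun_prop)) (ae_of_all _ fun θ => ?_)
    rw [norm_smul]; simp
  have hvw : MemLp (fun θ => w θ - v θ) 2 U := hy.sub hx
  have e1 : gradLoss μ ρ y - gradLoss μ σ x = (d : ℝ) • ∫ θ, (w θ - v θ) • (θ : E d) ∂U := by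
    rw [gradLoss_eq, gradLoss_eq, ← smul_sub, ← integral_sub (hint hy) (hint hx)]
    simp only [sub_smul, hv, hw]
  rw [e1, enorm_smul, mul_pow, Real.enorm_natCast]
  gcongr
  have h1 : ‖∫ θ, (w θ - v θ) • (θ : E d) ∂U‖ₑ ^ 2 ≤ ∫⁻ θ, ‖w θ - v θ‖ₑ ^ 2 ∂U := by
    calc _ ≤ (∫⁻ θ, ‖(w θ - v θ) • (θ : E d)‖ₑ ∂U) ^ 2 := by
          gcongr; exact enorm_integral_le_lintegral_enorm _
      _ = (∫⁻ θ, ‖w θ - v θ‖ₑ ∂U) ^ 2 := by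
          congr 2 with θ
          rw [enorm_smul, ← ofReal_norm (θ : E d)]
          simp
      _ ≤ _ := lintegral_enorm_sq_le U hvw.1
  refine h1.trans ?_
  calc _ ≤ ∫⁻ θ : Metric.sphere (0 : E d) 1, 2 * (‖x - y‖ₑ ^ 2 +
        ‖sliceVal μ σ θ x - sliceVal μ ρ θ y‖ₑ ^ 2) ∂U := by
        refine lintegral_mono fun θ => ?_
        have e2 : w θ - v θ = ⟪y - x, (θ : E d)⟫ + (sliceVal μ σ θ x - sliceVal μ ρ θ y) := by
          simp only [hv, hw, inner_sub_left]; ring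
        rw [e2]
        refine (enorm_add_sq_le _ _).trans ?_
        gcongr
        rw [enorm_le_iff_norm_le, norm_sub_rev x y]
        simpa using norm_inner_le_norm (𝕜 := ℝ) (y - x) (θ : E d)
    _ = _ := by
        rw [lintegral_const_mul' _ _ (by simp), lintegral_add_left measurable_const]
        simp

/-- A small gradient norm persists under small perturbations in `L²`. -/
lemma exists_gradNormSq_le {α : Type*} [MeasurableSpace α] (m : Measure α) [IsProbabilityMeasure m]
    (hd : 1 ≤ d) (μ : Measure (E d)) (hμ : IsP2 μ) {ε : ℝ} (hε : 0 < ε) :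
    ∃ η : ℝ≥0∞, 0 < η ∧ ∃ δ : ℝ, 0 < δ ∧ ∀ X Y : α → E d, Measurable X → Measurable Y →
      NullSingletonClass (m.map X) → NullSingletonClass (m.map Y) →
      loss μ (m.map X) ≠ ∞ → loss μ (m.map Y) ≠ ∞ →
      ∫⁻ a, ‖X a - Y a‖ₑ ^ 2 ∂m ≤ ENNReal.ofReal (δ ^ 2) → gradNormSq μ (m.map X) ≤ η →
      gradNormSq μ (m.map Y) ≤ ENNReal.ofReal ε := by
  have := isProbabilityMeasure_uniformSphere hd
  have := hμ.1
  have := hμ.3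
  -- Chosen so that the final bound 2(A + d² · 2(A + A)) equals `ε`.
  set A : ℝ := ε / (2 + 8 * d ^ 2) with hA
  have hA0 : 0 < A := by positivity
  set t : ℝ := Real.sqrt (A / 16)
  have ht : 0 < t := Real.sqrt_pos.2 (by positivity)
  have ht2 : 16 * t ^ 2 = A := by rw [Real.sq_sqrt (by positivity)]; ring
  obtain ⟨δ₁, hδ₁, hclose⟩ := exists_lintegral_sliceVal_sub_le m μ hμ.2 ht
  -- The rank estimate produces four terms of size `κ`: concentration, slab, and twice the
  -- probability of a large displacement.
  set κ := ENNReal.ofReal (δ₁ / 4)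
  have hκ : 0 < κ := by simpa [κ] using hδ₁
  obtain ⟨r, hr, η, hη, hconc⟩ := exists_concentration_le hd μ hκ
  obtain ⟨s, hs, hslab⟩ := exists_uniformSphere_slab_le hd hκ
  have hsr : 0 < s * r / 2 := by positivity
  have hB : 0 < δ₁ / 4 * (s * r / 2) ^ 2 := by positivity
  -- The first entry bounds the displacement term in the gradient difference; the second, by
  -- Chebyshev, makes displacements above `s * r / 2` unlikely.
  set δ : ℝ := Real.sqrt (min A (δ₁ / 4 * (s * r / 2) ^ 2)) with hδdef
  have hδsq : δ ^ 2 = min A (δ₁ / 4 * (s * r / 2) ^ 2) := Real.sq_sqrt (lt_min hA0 hB).le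
  refine ⟨min η (ENNReal.ofReal A), lt_min hη (by simpa using hA0), δ,
    Real.sqrt_pos.2 (lt_min hA0 hB), ?_⟩
  intro X Y hX hY _ _ hlX hlY hXY hG
  have := Measure.isProbabilityMeasure_map (μ := m) hX.aemeasurable
  have := Measure.isProbabilityMeasure_map (μ := m) hY.aemeasurable
  have hfar : m {a | s * r / 2 ≤ ‖X a - Y a‖} ≤ κ := by
    have hm : Measurable fun a => ‖X a - Y a‖ₑ ^ 2 := by fun_prop
    have hne : ENNReal.ofReal ((s * r / 2) ^ 2) ≠ 0 := by simpa using hsr.ne'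
    refine (measure_mono fun a ha => ?_).trans ((meas_ge_le_lintegral_div hm.aemeasurable
      (ε := ENNReal.ofReal ((s * r / 2) ^ 2)) hne ENNReal.ofReal_ne_top).trans ?_)
    · change ENNReal.ofReal ((s * r / 2) ^ 2) ≤ ‖X a - Y a‖ₑ ^ 2
      rw [enorm_sq_eq_ofReal_norm_sq]
      exact ENNReal.ofReal_le_ofReal (pow_le_pow_left₀ hsr.le ha 2)
    · rw [ENNReal.div_le_iff hne ENNReal.ofReal_ne_top, ← ENNReal.ofReal_mul (by positivity)]
      refine hXY.trans (ENNReal.ofReal_le_ofReal ?_)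
      rw [hδsq]
      exact min_le_right _ _
  have hrank := lintegral_rank_sub_le m hX hY hr.le hs
    (hconc _ inferInstance inferInstance hlX (hG.trans (min_le_left _ _))) hslab
  have hrank2 : 2 * κ + 2 * m {a | s * r / 2 ≤ ‖X a - Y a‖} ≤ ENNReal.ofReal δ₁ := by
    calc _ ≤ 2 * κ + 2 * κ := by gcongr
      _ = ENNReal.ofReal δ₁ := by
        rw [← two_mul, ← mul_assoc, show (2 : ℝ≥0∞) * 2 = ENNReal.ofReal 4 by norm_num,
          ← ENNReal.ofReal_mul (by norm_num)]
        congr 1; ring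
  have hD := hclose X Y hX hY inferInstance inferInstance (hrank.trans hrank2)
  rw [ht2] at hD
  have hmgX : Measurable fun a => gradLoss μ (m.map X) (X a) :=
    (measurable_gradLoss_right μ (m.map X)).comp hX
  have hmg : ∀ ρ : Measure (E d), [IsProbabilityMeasure ρ] →
      Measurable fun x => ‖gradLoss μ ρ x‖ₑ ^ 2 := fun ρ _ =>
    (measurable_gradLoss_right μ ρ).enorm.pow_const 2
  have hGX : ∫⁻ a, ‖gradLoss μ (m.map X) (X a)‖ₑ ^ 2 ∂m ≤ ENNReal.ofReal A := by
    have := lintegral_map (μ := m) (hmg (m.map X)) hX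
    rw [← this]
    exact hG.trans (min_le_right _ _)
  have hsub : Measurable fun p : α × Metric.sphere (0 : E d) 1 =>
      ‖sliceVal μ (m.map X) p.2 (X p.1) - sliceVal μ (m.map Y) p.2 (Y p.1)‖ₑ ^ 2 := by
    have h1 : Measurable fun p : α × Metric.sphere (0 : E d) 1 => sliceVal μ (m.map X) p.2 (X p.1) :=
      (measurable_sliceVal_uncurry μ (m.map X)).comp
        (f := fun p : α × Metric.sphere (0 : E d) 1 => ((p.2 : E d), X p.1)) (by fun_prop)
    have h2 : Measurable fun p : α × Metric.sphere (0 : E d) 1 => sliceVal μ (m.map Y) p.2 (Y p.1) :=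
      (measurable_sliceVal_uncurry μ (m.map Y)).comp
        (f := fun p : α × Metric.sphere (0 : E d) 1 => ((p.2 : E d), Y p.1)) (by fun_prop)
    fun_prop
  have hD' : ∫⁻ a, ∫⁻ θ : Metric.sphere (0 : E d) 1,
      ‖sliceVal μ (m.map X) θ (X a) - sliceVal μ (m.map Y) θ (Y a)‖ₑ ^ 2 ∂(uniformSphere d) ∂m ≤
      ENNReal.ofReal A := by
    have hswap := lintegral_lintegral_swap (μ := m) (ν := uniformSphere d)
      (f := fun a (θ : Metric.sphere (0 : E d) 1) =>
        ‖sliceVal μ (m.map X) θ (X a) - sliceVal μ (m.map Y) θ (Y a)‖ₑ ^ 2) hsub.aemeasurable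
    rw [hswap]; exact hD
  have hXYA : ∫⁻ a, ‖X a - Y a‖ₑ ^ 2 ∂m ≤ ENNReal.ofReal A := by
    refine hXY.trans (ENNReal.ofReal_le_ofReal ?_)
    rw [hδsq]; exact min_le_left _ _
  have hmXY : Measurable fun a => ‖X a - Y a‖ₑ ^ 2 := by fun_prop
  have hlast := lintegral_map (μ := m) (hmg (m.map Y)) hY
  rw [gradNormSq, hlast]
  calc _ ≤ ∫⁻ a, 2 * (‖gradLoss μ (m.map X) (X a)‖ₑ ^ 2 + (d : ℝ≥0∞) ^ 2 *
        (2 * (‖X a - Y a‖ₑ ^ 2 + ∫⁻ θ : Metric.sphere (0 : E d) 1,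
          ‖sliceVal μ (m.map X) θ (X a) - sliceVal μ (m.map Y) θ (Y a)‖ₑ ^ 2
            ∂(uniformSphere d)))) ∂m := by
        refine lintegral_mono_ae ?_
        filter_upwards [ae_of_ae_map hX.aemeasurable (ae_memLp_residual μ (m.map X) hlX),
          ae_of_ae_map hY.aemeasurable (ae_memLp_residual μ (m.map Y) hlY)] with a h1 h2
        have h3 := enorm_gradLoss_sub_sq_le μ (m.map X) (m.map Y) h1 h2
        have h4 := enorm_add_sq_le (gradLoss μ (m.map X) (X a))
          (gradLoss μ (m.map Y) (Y a) - gradLoss μ (m.map X) (X a))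
        rw [add_sub_cancel] at h4
        exact h4.trans (by gcongr)
    _ = 2 * (∫⁻ a, ‖gradLoss μ (m.map X) (X a)‖ₑ ^ 2 ∂m + (d : ℝ≥0∞) ^ 2 *
        (2 * (∫⁻ a, ‖X a - Y a‖ₑ ^ 2 ∂m + ∫⁻ a, ∫⁻ θ : Metric.sphere (0 : E d) 1,
          ‖sliceVal μ (m.map X) θ (X a) - sliceVal μ (m.map Y) θ (Y a)‖ₑ ^ 2
            ∂(uniformSphere d) ∂m))) := by
        rw [lintegral_const_mul' _ _ (by simp), lintegral_add_left (hmgX.enorm.pow_const 2),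
          lintegral_const_mul' _ _ (by simp), lintegral_const_mul' _ _ (by simp),
          lintegral_add_left hmXY]
    _ ≤ 2 * (ENNReal.ofReal A + (d : ℝ≥0∞) ^ 2 * (2 * (ENNReal.ofReal A + ENNReal.ofReal A))) := by
        gcongr
    _ ≤ ENNReal.ofReal ε := by
        have e1 : (d : ℝ≥0∞) = ENNReal.ofReal (d : ℝ) := (ENNReal.ofReal_natCast d).symm
        have e2 : (2 : ℝ≥0∞) = ENNReal.ofReal 2 := by norm_num
        rw [e1, e2, ← ENNReal.ofReal_pow (by positivity), ← ENNReal.ofReal_add hA0.le hA0.le,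
          ← ENNReal.ofReal_mul (by norm_num), ← ENNReal.ofReal_mul (by positivity),
          ← ENNReal.ofReal_add hA0.le (by positivity), ← ENNReal.ofReal_mul (by norm_num)]
        refine ENNReal.ofReal_le_ofReal (le_of_eq ?_)
        have : ε = A * (2 + 8 * d ^ 2) := by rw [hA]; field_simp
        rw [this]; ring

/-- A weighted summable sequence that cannot leave a neighbourhood of zero abruptly converges. -/
lemma eventually_le_of_tsum_ne_top {γ : ℕ → ℝ} (hγ : ∀ k, 0 < γ k)
    (hsum : Tendsto (fun n => ∑ k ∈ Finset.range n, γ k) atTop atTop) {G : ℕ → ℝ≥0∞}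
    (hG : ∑' k, ENNReal.ofReal (γ k) * G k ≠ ∞) {ε : ℝ≥0∞} {η : ℝ≥0∞} (hη : 0 < η) {δ : ℝ}
    (hδ : 0 < δ) (h : ∀ k j, k ≤ j → ∑ i ∈ Finset.Ico k j, γ i ≤ δ → G j ≤ η → G k ≤ ε) :
    ∀ᶠ k in atTop, G k ≤ ε := by
  have htail := ENNReal.tendsto_sum_nat_add _ hG
  have hpos : 0 < ENNReal.ofReal δ * η := ENNReal.mul_pos (by simpa using hδ) hη.ne'
  filter_upwards [htail.eventually (gt_mem_nhds hpos)] with k hk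
  by_contra hGk
  have hex : ∃ j, δ < ∑ i ∈ Finset.Ico k j, γ i := by
    obtain ⟨j, hj, hkj⟩ := ((hsum.eventually (eventually_gt_atTop
      (∑ i ∈ Finset.range k, γ i + δ))).and (eventually_ge_atTop k)).exists
    refine ⟨j, ?_⟩
    rw [Finset.sum_Ico_eq_sub _ hkj]
    linarith
  classical
  have hJ := Nat.find_spec hex
  -- By minimality of `J`, every earlier index of the window is within step mass `δ` of `k`, so `h`
  -- would make `G k` small if `G` were below `η` there.
  set J := Nat.find hex
  have hwin : ∀ i ∈ Finset.Ico k J, η ≤ G i := by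
    intro i hi
    rw [Finset.mem_Ico] at hi
    by_contra hlt
    exact hGk (h k i hi.1 (not_lt.1 (Nat.find_min hex hi.2)) (not_le.1 hlt).le)
  refine absurd hk (not_lt.2 ?_)
  calc ENNReal.ofReal δ * η ≤ ENNReal.ofReal (∑ i ∈ Finset.Ico k J, γ i) * η := by
        gcongr
    _ = ∑ i ∈ Finset.Ico k J, ENNReal.ofReal (γ i) * η := by
        rw [ENNReal.ofReal_sum_of_nonneg fun i _ => (hγ i).le, Finset.sum_mul]
    _ ≤ ∑ i ∈ Finset.Ico k J, ENNReal.ofReal (γ i) * G i :=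
        Finset.sum_le_sum fun i hi => by gcongr; exact hwin i hi
    _ = ∑ i ∈ Finset.range (J - k), ENNReal.ofReal (γ (i + k)) * G (i + k) := by
        rw [Finset.sum_Ico_eq_sum_range]
        exact Finset.sum_congr rfl fun i _ => by rw [add_comm]
    _ ≤ _ := ENNReal.sum_le_tsum _

end SliceMatching

namespace SliceMatching

variable {d : ℕ}

attribute [local irreducible] sliceMap sliceVal rank

/-! ### Trajectories of the scheme for a fixed sequence of bases -/

section Trajectory

variable (μ σ₀ : Measure (E d)) (γ : ℕ → ℝ) (p : ℕ → Orth d)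

lemma iterate_succ (k : ℕ) : iterate μ σ₀ γ p (k + 1) = (iterate μ σ₀ γ p k).map
    fun x => (1 - γ k) • x + γ k • sliceMap μ (iterate μ σ₀ γ p k) (p k) x := rfl

lemma iterate_congr {p p' : ℕ → Orth d} {k : ℕ} (h : ∀ i < k, p i = p' i) :
    iterate μ σ₀ γ p k = iterate μ σ₀ γ p' k := by
  induction k with
  | zero => rfl
  | succ k ih =>
    rw [iterate_succ, iterate_succ, ih fun i hi => h i (hi.trans k.lt_succ_self), h k k.lt_succ_self]

/-- The position at time `k` of the particle that starts at `x`. -/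
noncomputable def flow : ℕ → E d → E d
  | 0 => id
  | k + 1 => fun x =>
    (1 - γ k) • flow k x + γ k • sliceMap μ (iterate μ σ₀ γ p k) (p k) (flow k x)

variable [IsProbabilityMeasure μ] [IsProbabilityMeasure σ₀]

instance isProbabilityMeasure_iterate (k : ℕ) : IsProbabilityMeasure (iterate μ σ₀ γ p k) := by
  induction k with
  | zero => exact ‹IsProbabilityMeasure σ₀›
  | succ k ih =>
    exact Measure.isProbabilityMeasure_map (measurable_stepMap μ _ (γ k) (p k)).aemeasurable

lemma measurable_flow (k : ℕ) : Measurable (flow μ σ₀ γ p k) := by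
  induction k with
  | zero => exact measurable_id
  | succ k ih => exact (measurable_stepMap μ (iterate μ σ₀ γ p k) (γ k) (p k)).comp ih

lemma map_flow (k : ℕ) : σ₀.map (flow μ σ₀ γ p k) = iterate μ σ₀ γ p k := by
  induction k with
  | zero => exact Measure.map_id
  | succ k ih =>
    have h := Measure.map_map (μ := σ₀)
      (measurable_stepMap μ (iterate μ σ₀ γ p k) (γ k) (p k)) (measurable_flow μ σ₀ γ p k)
    rw [ih] at h
    exact h.symm

/-- All slices of `μ` and of the current iterate along the next basis are atomless. -/
def AtomlessColumns (k : ℕ) : Prop :=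
  ∀ i, NullSingletonClass (proj (iterate μ σ₀ γ p k) (basisVec (p k) i)) ∧
    NullSingletonClass (proj μ (basisVec (p k) i))

variable {μ σ₀ γ p}

lemma lintegral_iterate_sq_le (hγ0 : ∀ k, 0 < γ k) (hγ1 : ∀ k, γ k ≤ 1) {M : ℝ≥0∞}
    (hμM : ∫⁻ x, ‖x‖ₑ ^ 2 ∂μ ≤ M) (hσM : ∫⁻ x, ‖x‖ₑ ^ 2 ∂σ₀ ≤ M) {k : ℕ}
    (hp : ∀ j < k, AtomlessColumns μ σ₀ γ p j) : ∫⁻ x, ‖x‖ₑ ^ 2 ∂(iterate μ σ₀ γ p k) ≤ M := by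
  induction k with
  | zero => exact hσM
  | succ k ih =>
    exact lintegral_step_sq_le μ _ (hγ0 k).le (hγ1 k) (p k)
      (fun i => (hp k k.lt_succ_self i).1) (ih fun j hj => hp j (hj.trans k.lt_succ_self)) hμM

/-- No induction is needed: a single step along atomless slices already produces an atomless
measure. -/
lemma nullSingletonClass_iterate (hd : 1 ≤ d) (hγ0 : ∀ k, 0 < γ k) (hγ1 : ∀ k, γ k ≤ 1)
    [NullSingletonClass σ₀] {k : ℕ} (hp : ∀ j < k, AtomlessColumns μ σ₀ γ p j) :
    NullSingletonClass (iterate μ σ₀ γ p k) := by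
  cases k with
  | zero => exact ‹NullSingletonClass σ₀›
  | succ k =>
    have h := hp k k.lt_succ_self ⟨0, hd⟩
    have := h.1
    have := h.2
    exact nullSingletonClass_step μ _ (hγ0 k) (hγ1 k) (p k) ⟨0, hd⟩

lemma eLpNorm_two_le_iff {α F : Type*} [MeasurableSpace α] [NormedAddCommGroup F] {m : Measure α}
    {f : α → F} {t : ℝ} (ht : 0 ≤ t) :
    eLpNorm f 2 m ≤ ENNReal.ofReal t ↔ ∫⁻ a, ‖f a‖ₑ ^ 2 ∂m ≤ ENNReal.ofReal (t ^ 2) := by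
  have h := eLpNorm_nnreal_pow_eq_lintegral (f := f) (μ := m) (p := 2) (by norm_num)
  simp only [NNReal.coe_ofNat, ENNReal.rpow_ofNat, ENNReal.coe_ofNat] at h
  rw [← h, ENNReal.ofReal_pow ht, ENNReal.pow_le_pow_left_iff two_ne_zero]

lemma lintegral_flow_succ_sub_le {C : ℝ} {k : ℕ} (hp : AtomlessColumns μ σ₀ γ p k)
    (hC : 2 * (∫⁻ x, ‖x‖ₑ ^ 2 ∂μ + ∫⁻ x, ‖x‖ₑ ^ 2 ∂(iterate μ σ₀ γ p k)) ≤ ENNReal.ofReal (C ^ 2)) :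
    ∫⁻ x, ‖flow μ σ₀ γ p (k + 1) x - flow μ σ₀ γ p k x‖ₑ ^ 2 ∂σ₀ ≤
      ENNReal.ofReal ((C * γ k) ^ 2) := by
  set σ := iterate μ σ₀ γ p k
  have hT : Measurable fun x => sliceMap μ σ (p k) x :=
    (measurable_sliceMap_uncurry μ σ).comp (f := fun x : E d => (p k, x)) (by fun_prop)
  have hm : Measurable fun x => ‖sliceMap μ σ (p k) x - x‖ₑ ^ 2 := by fun_prop
  have h1 : ∀ x, ‖flow μ σ₀ γ p (k + 1) x - flow μ σ₀ γ p k x‖ₑ ^ 2 = ENNReal.ofReal (γ k ^ 2) *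
      ‖sliceMap μ σ (p k) (flow μ σ₀ γ p k x) - flow μ σ₀ γ p k x‖ₑ ^ 2 := fun x => by
    have : flow μ σ₀ γ p (k + 1) x - flow μ σ₀ γ p k x =
        γ k • (sliceMap μ σ (p k) (flow μ σ₀ γ p k x) - flow μ σ₀ γ p k x) := by
      change (1 - γ k) • flow μ σ₀ γ p k x + γ k • sliceMap μ σ (p k) (flow μ σ₀ γ p k x) -
        flow μ σ₀ γ p k x = _
      module
    rw [this, enorm_smul, mul_pow, enorm_sq_eq_ofReal]
  have hmap := lintegral_map (μ := σ₀) hm (measurable_flow μ σ₀ γ p k)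
  rw [map_flow] at hmap
  simp_rw [h1]
  rw [lintegral_const_mul' _ _ ENNReal.ofReal_ne_top, ← hmap, mul_pow, mul_comm (C ^ 2),
    ENNReal.ofReal_mul (sq_nonneg _)]
  gcongr
  refine le_trans ?_ hC
  calc _ ≤ ∫⁻ x, 2 * (‖sliceMap μ σ (p k) x‖ₑ ^ 2 + ‖x‖ₑ ^ 2) ∂σ := by
        refine lintegral_mono fun x => ?_
        have := enorm_add_sq_le (sliceMap μ σ (p k) x) (-x)
        rwa [enorm_neg, ← sub_eq_add_neg] at this
    _ = _ := by
        rw [lintegral_const_mul' _ _ (by simp), lintegral_add_left (by fun_prop),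
          lintegral_sliceMap_sq μ σ (p k) fun i => (hp i).1]

/-- Following each particle from its starting point couples all iterates on one space; the triangle
inequality measures their distance by the elapsed step size. -/
lemma eLpNorm_flow_sub_le (hγ0 : ∀ k, 0 < γ k) {C : ℝ} (hC0 : 0 ≤ C)
    (hp : ∀ k, AtomlessColumns μ σ₀ γ p k)
    (hC : ∀ k, 2 * (∫⁻ x, ‖x‖ₑ ^ 2 ∂μ + ∫⁻ x, ‖x‖ₑ ^ 2 ∂(iterate μ σ₀ γ p k)) ≤
      ENNReal.ofReal (C ^ 2)) {k j : ℕ} (hkj : k ≤ j) :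
    eLpNorm (flow μ σ₀ γ p j - flow μ σ₀ γ p k) 2 σ₀ ≤
      ENNReal.ofReal (C * ∑ i ∈ Finset.Ico k j, γ i) := by
  induction j, hkj using Nat.le_induction with
  | base => simp
  | succ j hkj ih =>
    have e : flow μ σ₀ γ p (j + 1) - flow μ σ₀ γ p k =
        (flow μ σ₀ γ p (j + 1) - flow μ σ₀ γ p j) + (flow μ σ₀ γ p j - flow μ σ₀ γ p k) := by abel
    have hms := fun k => (measurable_flow μ σ₀ γ p k).aestronglyMeasurable (μ := σ₀)
    have hstep : eLpNorm (flow μ σ₀ γ p (j + 1) - flow μ σ₀ γ p j) 2 σ₀ ≤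
        ENNReal.ofReal (C * γ j) := by
      rw [eLpNorm_two_le_iff (mul_nonneg hC0 (hγ0 j).le)]
      exact lintegral_flow_succ_sub_le (hp j) (hC j)
    rw [e]
    refine (eLpNorm_add_le ((hms _).sub (hms _)) ((hms _).sub (hms _)) (by norm_num)).trans ?_
    refine (add_le_add hstep ih).trans (le_of_eq ?_)
    rw [Finset.sum_Ico_succ_top hkj, mul_add, add_comm (C * _), ENNReal.ofReal_add
      (mul_nonneg hC0 (hγ0 j).le)
      (mul_nonneg hC0 (Finset.sum_nonneg fun i _ => (hγ0 i).le))]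

/-- Along a trajectory with summable weighted gradients, the gradient norms vanish. -/
theorem eventually_gradNormSq_le (hd : 1 ≤ d) (hμ : IsP2 μ) (hσ₀ : IsP2 σ₀)
    (hγ0 : ∀ k, 0 < γ k) (hγ1 : ∀ k, γ k ≤ 1)
    (hsum : Tendsto (fun n => ∑ k ∈ Finset.range n, γ k) atTop atTop)
    (hp : ∀ k, AtomlessColumns μ σ₀ γ p k)
    (hG : ∑' k, ENNReal.ofReal (γ k) * gradNormSq μ (iterate μ σ₀ γ p k) ≠ ∞) {ε : ℝ} (hε : 0 < ε) :
    ∀ᶠ k in atTop, gradNormSq μ (iterate μ σ₀ γ p k) ≤ ENNReal.ofReal ε := by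
  have := isProbabilityMeasure_uniformSphere hd
  have := hσ₀.3
  have hna : ∀ k, NullSingletonClass (iterate μ σ₀ γ p k) := fun k =>
    nullSingletonClass_iterate hd hγ0 hγ1 fun j _ => hp j
  obtain ⟨η, hη, δ, hδ, h⟩ := exists_gradNormSq_le σ₀ hd μ hμ hε
  set M := ∫⁻ x, ‖x‖ₑ ^ 2 ∂μ + ∫⁻ x, ‖x‖ₑ ^ 2 ∂σ₀
  have hM : M ≠ ∞ := ENNReal.add_ne_top.2 ⟨hμ.2.ne, hσ₀.2.ne⟩
  have hMk : ∀ k, ∫⁻ x, ‖x‖ₑ ^ 2 ∂(iterate μ σ₀ γ p k) ≤ M := fun k =>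
    lintegral_iterate_sq_le hγ0 hγ1 (le_add_of_nonneg_right zero_le)
      (le_add_of_nonneg_left zero_le) fun j _ => hp j
  have hloss : ∀ k, loss μ (iterate μ σ₀ γ p k) ≠ ∞ := fun k =>
    ne_top_of_le_ne_top (ENNReal.mul_ne_top (by simp) (ENNReal.add_ne_top.2
      ⟨ne_top_of_le_ne_top hM (hMk k), hμ.2.ne⟩)) (loss_le μ _)
  set C := Real.sqrt (2 * (M + M)).toReal
  have hC0 : 0 ≤ C := Real.sqrt_nonneg _
  have hC : ∀ k, 2 * (∫⁻ x, ‖x‖ₑ ^ 2 ∂μ + ∫⁻ x, ‖x‖ₑ ^ 2 ∂(iterate μ σ₀ γ p k)) ≤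
      ENNReal.ofReal (C ^ 2) := fun k => by
    rw [Real.sq_sqrt ENNReal.toReal_nonneg, ENNReal.ofReal_toReal (by finiteness)]
    gcongr
    · exact le_add_of_nonneg_right zero_le
    · exact hMk k
  -- A window of this mass moves the flow by at most `δ` in L²; adding 1 to `C` covers `C = 0`.
  refine eventually_le_of_tsum_ne_top hγ0 hsum hG hη (δ := δ / (C + 1)) (by positivity)
    fun k j hkj hw hGj => ?_
  have hf := map_flow μ σ₀ γ p
  have hfm := measurable_flow μ σ₀ γ p
  rw [← hf k]
  -- Smallness is propagated backwards in time, from the later position `j` to the earlier `k`.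
  refine h (flow μ σ₀ γ p j) (flow μ σ₀ γ p k) (hfm j) (hfm k) (by rw [hf]; exact hna j)
    (by rw [hf]; exact hna k) (by rw [hf]; exact hloss j) (by rw [hf]; exact hloss k) ?_
    (by rw [hf]; exact hGj)
  have h1 := (eLpNorm_flow_sub_le hγ0 hC0 hp hC hkj).trans
    (ENNReal.ofReal_le_ofReal (q := δ) (by
      rw [le_div_iff₀ (by positivity)] at hw
      nlinarith [Finset.sum_nonneg (s := Finset.Ico k j) fun i _ => (hγ0 i).le]))
  rw [eLpNorm_two_le_iff hδ.le] at h1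
  exact h1

end Trajectory

end SliceMatching

namespace SliceMatching

variable {d : ℕ}

attribute [local irreducible] sliceMap sliceVal rank

/-! ### The randomized scheme -/

section Independence

variable {Ω 𝒳 : Type*} [MeasurableSpace Ω] [MeasurableSpace 𝒳] {Pr : Measure Ω}
  [IsProbabilityMeasure Pr] {X : ℕ → Ω → 𝒳}

/-- A function of the past and of the present of an independent sequence may be integrated
over the present first. -/
lemma lintegral_past_present (hX : ∀ k, Measurable (X k)) (hI : iIndepFun X Pr) (k : ℕ)
    {h : (ℕ → 𝒳) → 𝒳 → ℝ≥0∞} (hh : Measurable h.uncurry)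
    (hdep : ∀ p p' Q, (∀ i < k, p i = p' i) → h p Q = h p' Q) :
    ∫⁻ ω, h (fun j => X j ω) (X k ω) ∂Pr =
      ∫⁻ ω, ∫⁻ Q, h (fun j => X j ω) Q ∂(Pr.map (X k)) ∂Pr := by
  obtain ⟨ω₀⟩ : Nonempty Ω := nonempty_of_isProbabilityMeasure Pr
  -- Freezing the coordinates from `k` on makes `T` a function of the past only, hence independent
  -- of `X k`; by `hdep` the frozen values do not affect `h`.
  set T : Ω → ℕ → 𝒳 := fun ω j => if j < k then X j ω else X j ω₀ with hTdef
  have hT : Measurable T := by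
    refine measurable_pi_lambda _ fun j => ?_
    by_cases hj : j < k
    · simpa [hTdef, hj] using hX j
    · simp [hTdef, hj]
  have hTX : ∀ ω Q, h (fun j => X j ω) Q = h (T ω) Q := fun ω Q =>
    hdep _ _ _ fun j hj => by simp [hTdef, hj]
  have hind : IndepFun T (X k) Pr := by
    have h0 := hI.indepFun_finset (Finset.range k) {k} (by simp) hX
    have hφ : Measurable fun (a : Finset.range k → 𝒳) (j : ℕ) =>
        if hj : j < k then a ⟨j, Finset.mem_range.2 hj⟩ else X j ω₀ := by
      refine measurable_pi_lambda _ fun j => ?_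
      by_cases hj : j < k
      · simpa [hj] using measurable_pi_apply _
      · simp [hj]
    have h1 := h0.comp hφ (measurable_pi_apply (⟨k, by simp⟩ : ({k} : Finset ℕ)))
    have e : T = (fun (a : Finset.range k → 𝒳) (j : ℕ) =>
        if hj : j < k then a ⟨j, Finset.mem_range.2 hj⟩ else X j ω₀) ∘ fun ω i => X i ω := by
      funext ω j
      by_cases hj : j < k <;> simp [hTdef, hj]
    rw [e]
    exact h1
  have := Measure.isProbabilityMeasure_map (μ := Pr) (hX k).aemeasurable
  have := Measure.isProbabilityMeasure_map (μ := Pr) hT.aemeasurable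
  rw [indepFun_iff_map_prod_eq_prod_map_map hT.aemeasurable (hX k).aemeasurable] at hind
  simp_rw [hTX]
  calc ∫⁻ ω, h (T ω) (X k ω) ∂Pr
      = ∫⁻ q, h.uncurry q ∂(Pr.map fun ω => (T ω, X k ω)) :=
        (lintegral_map hh (hT.prodMk (hX k))).symm
    _ = ∫⁻ p, ∫⁻ Q, h.uncurry (p, Q) ∂(Pr.map (X k)) ∂(Pr.map T) := by
        rw [hind, lintegral_prod _ hh.aemeasurable]
    _ = _ := lintegral_map hh.lintegral_prod_right' hT

end Independence

/-- Telescoping of the Robbins–Monro recursion. -/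
lemma tsum_ne_top_of_add_le {a b c e : ℕ → ℝ≥0∞} {L : ℝ≥0∞} (hL : L ≠ ∞) (ha : ∀ k, a k ≤ L)
    (he : ∑' k, e k ≠ ∞) (h : ∀ k, a (k + 1) + c k * b k ≤ a k + e k * L) :
    ∑' k, c k * b k ≠ ∞ := by
  have key : ∀ n, a n + ∑ k ∈ Finset.range n, c k * b k ≤
      a 0 + (∑ k ∈ Finset.range n, e k) * L := fun n => by
    induction n with
    | zero => simp
    | succ n ih =>
      rw [Finset.sum_range_succ, Finset.sum_range_succ, add_mul]
      calc _ = (a (n + 1) + c n * b n) + ∑ k ∈ Finset.range n, c k * b k := by ring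
        _ ≤ (a n + e n * L) + ∑ k ∈ Finset.range n, c k * b k := add_le_add_left (h n) _
        _ = (a n + ∑ k ∈ Finset.range n, c k * b k) + e n * L := by ring
        _ ≤ _ := by rw [← add_assoc]; gcongr
  refine ne_top_of_le_ne_top (b := L + (∑' k, e k) * L) (by finiteness) ?_
  rw [ENNReal.tsum_eq_iSup_nat]
  refine iSup_le fun n => le_add_self.trans ((key n).trans ?_)
  gcongr
  · exact ha 0
  · exact ENNReal.sum_le_tsum _

section Measurability

variable (μ σ₀ : Measure (E d)) (γ : ℕ → ℝ) [IsProbabilityMeasure μ] [IsProbabilityMeasure σ₀]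

lemma measurable_iterate (k : ℕ) : Measurable fun p : ℕ → Orth d => iterate μ σ₀ γ p k := by
  induction k with
  | zero => exact measurable_const
  | succ k ih =>
    let κ : Kernel (ℕ → Orth d) (E d) := ⟨fun p => iterate μ σ₀ γ p k, ih⟩
    have : IsMarkovKernel κ := ⟨fun p => isProbabilityMeasure_iterate μ σ₀ γ p k⟩
    have hp : Measurable fun p : ℕ → Orth d => (p, p k) := by fun_prop
    exact (stepKernel κ μ (γ k)).measurable.comp (f := fun p : ℕ → Orth d => (p, p k)) hp

/-- The `k`-th iterate as a kernel from the sequences of bases. -/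
noncomputable def iterateKernel (k : ℕ) : Kernel (ℕ → Orth d) (E d) :=
  ⟨fun p => iterate μ σ₀ γ p k, measurable_iterate μ σ₀ γ k⟩

lemma iterateKernel_apply (k : ℕ) (p : ℕ → Orth d) :
    iterateKernel μ σ₀ γ k p = iterate μ σ₀ γ p k := rfl

instance isMarkovKernel_iterateKernel (k : ℕ) : IsMarkovKernel (iterateKernel μ σ₀ γ k) :=
  ⟨fun p => isProbabilityMeasure_iterate μ σ₀ γ p k⟩

lemma measurable_gradNormSq_iterate [SFinite (uniformSphere d)] (k : ℕ) :
    Measurable fun p : ℕ → Orth d => gradNormSq μ (iterate μ σ₀ γ p k) :=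
  measurable_gradNormSq (iterateKernel μ σ₀ γ k) μ

/-- The probability that two independent samples of `σ` have the same `i`-th coordinate in the
basis `Q`. -/
noncomputable def collision (σ : Measure (E d)) (i : Fin d) (Q : Orth d) : ℝ≥0∞ :=
  (σ.prod σ) {q | ⟪q.1 - q.2, basisVec Q i⟫ = 0}

/-- Atomlessness of a random slice is encoded by the vanishing of this measurable quantity, so that
past and present can be separated by integration. -/
lemma measurable_collision_iterate (k : ℕ) (i : Fin d) :
    Measurable fun q : (ℕ → Orth d) × Orth d => collision (iterate μ σ₀ γ q.1 k) i q.2 := by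
  set κ := iterateKernel μ σ₀ γ k
  have hms : MeasurableSet {q : ((ℕ → Orth d) × Orth d) × E d × E d |
      ⟪q.2.1 - q.2.2, basisVec q.1.2 i⟫ = 0} :=
    measurableSet_inner_sub_eq_zero (by fun_prop) (by fun_prop)
      ((continuous_basisVec i).measurable.comp (by fun_prop))
  have := Kernel.measurable_kernel_prodMk_left
    (κ := (κ ×ₖ κ).comap (Prod.fst : (ℕ → Orth d) × Orth d → _) measurable_fst) hms
  simp only [Kernel.comap_apply, Kernel.prod_apply] at this
  exact this

end Measurability

section Collision

variable (σ : Measure (E d)) [IsProbabilityMeasure σ] (H : Measure (Orth d))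
  [IsProbabilityMeasure H] [H.IsMulLeftInvariant]

lemma lintegral_collision (hd : 1 ≤ d) [NullSingletonClass σ] (i : Fin d) :
    ∫⁻ Q, collision σ i Q ∂H = 0 := by
  have := isProbabilityMeasure_uniformSphere hd
  have hms := measurableSet_setOf_inner_eq_zero (d := d)
  have h0 := prod_inner_eq_zero σ
  rw [Measure.prod_apply hms, ← map_colSphere hd H i,
    lintegral_map (measurable_measure_prodMk_left hms) (measurable_colSphere i)] at h0
  exact h0

variable {σ}

lemma ae_nullSingletonClass_column (hd : 1 ≤ d) [NullSingletonClass σ] :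
    ∀ᵐ Q ∂H, ∀ i, NullSingletonClass (proj σ (basisVec Q i)) := by
  have := isProbabilityMeasure_uniformSphere hd
  refine ae_all_iff.2 fun i => ?_
  have h := ae_nullSingletonClass_proj σ
  rw [← map_colSphere hd H i] at h
  exact ae_of_ae_map (measurable_colSphere i).aemeasurable h

end Collision

section Random

variable {μ σ₀ : Measure (E d)} {γ : ℕ → ℝ} {Ω : Type*} [MeasurableSpace Ω] {Pr : Measure Ω}
  [IsProbabilityMeasure Pr] {P : ℕ → Ω → Orth d}

/-- Strong induction on time: good earlier bases make the current iterate atomless, and the next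
basis, being independent of it and invariant in law, almost surely avoids its atomic slices and
those of `μ`. -/
lemma ae_atomlessColumns (hd : 1 ≤ d) (hμ : IsP2 μ) (hσ₀ : IsP2 σ₀) (hγ0 : ∀ k, 0 < γ k)
    (hγ1 : ∀ k, γ k ≤ 1) (hP : ∀ k, Measurable (P k))
    (hH : ∀ k, (Pr.map (P k)).IsMulLeftInvariant) (hI : iIndepFun P Pr) :
    ∀ᵐ ω ∂Pr, ∀ k, AtomlessColumns μ σ₀ γ (fun j => P j ω) k := by
  have := hμ.1
  have := hσ₀.1
  have := hμ.3
  have := hσ₀.3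
  refine ae_all_iff.2 fun k => ?_
  induction k using Nat.strong_induction_on with
  | _ k ih =>
    have := hH k
    have := Measure.isProbabilityMeasure_map (μ := Pr) (hP k).aemeasurable
    have hna : ∀ᵐ ω ∂Pr, NullSingletonClass (iterate μ σ₀ γ (fun j => P j ω) k) := by
      have : ∀ᵐ ω ∂Pr, ∀ j : Fin k, AtomlessColumns μ σ₀ γ (fun j => P j ω) j :=
        ae_all_iff.2 fun j => ih j j.2
      filter_upwards [this] with ω hω
      exact nullSingletonClass_iterate hd hγ0 hγ1 fun j hj => hω ⟨j, hj⟩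
    have hcol : ∀ i, ∀ᵐ ω ∂Pr,
        collision (iterate μ σ₀ γ (fun j => P j ω) k) i (P k ω) = 0 := fun i => by
      have hm := measurable_collision_iterate μ σ₀ γ k i
      have hmω : Measurable fun ω => collision (iterate μ σ₀ γ (fun j => P j ω) k) i (P k ω) :=
        hm.comp (f := fun ω => ((fun j => P j ω), P k ω)) (by fun_prop)
      refine (lintegral_eq_zero_iff hmω).1 ?_
      rw [lintegral_past_present hP hI k (h := fun p Q => collision (iterate μ σ₀ γ p k) i Q) hm
        fun p p' Q h => by simp only [iterate_congr μ σ₀ γ h]]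
      refine (lintegral_congr_ae ?_).trans lintegral_zero
      filter_upwards [hna] with ω hω
      exact lintegral_collision _ _ hd i
    have hμcol := ae_of_ae_map (hP k).aemeasurable
      (ae_nullSingletonClass_column (σ := μ) (Pr.map (P k)) hd)
    filter_upwards [ae_all_iff.2 hcol, hμcol] with ω h1 h2 i
    exact ⟨nullSingletonClass_proj_of_prod _ (h1 i), h2 i⟩

/-- Expected decrease of the loss along the randomized scheme. -/
lemma lintegral_loss_iterate_succ_add_le (hd : 1 ≤ d) (hμ : IsP2 μ) (hσ₀ : IsP2 σ₀)
    (hγ0 : ∀ k, 0 < γ k) (hγ1 : ∀ k, γ k ≤ 1) (hP : ∀ k, Measurable (P k))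
    (hH : ∀ k, (Pr.map (P k)).IsMulLeftInvariant) (hI : iIndepFun P Pr) {L : ℝ≥0∞} (hL : L ≠ ∞)
    (hloss : ∀ᵐ ω ∂Pr, ∀ k, loss μ (iterate μ σ₀ γ (fun j => P j ω) k) ≤ L)
    (hna : ∀ᵐ ω ∂Pr, ∀ k, NullSingletonClass (iterate μ σ₀ γ (fun j => P j ω) k)) (k : ℕ) :
    ∫⁻ ω, loss μ (iterate μ σ₀ γ (fun j => P j ω) (k + 1)) ∂Pr +
      ENNReal.ofReal (2 * γ k / d) * ∫⁻ ω, gradNormSq μ (iterate μ σ₀ γ (fun j => P j ω) k) ∂Pr ≤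
      ∫⁻ ω, loss μ (iterate μ σ₀ γ (fun j => P j ω) k) ∂Pr +
        ENNReal.ofReal (γ k ^ 2) * (d * L) := by
  have := hμ.1
  have := hσ₀.1
  have := hμ.3
  have := isProbabilityMeasure_uniformSphere hd
  have := hH k
  have := Measure.isProbabilityMeasure_map (μ := Pr) (hP k).aemeasurable
  set κ := iterateKernel μ σ₀ γ k
  have : IsMarkovKernel (stepKernel κ μ (γ k)) := ⟨fun q => by
    rw [stepKernel_apply]
    exact Measure.isProbabilityMeasure_map (measurable_stepMap μ _ (γ k) q.2).aemeasurable⟩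
  have hseq : Measurable fun ω j => P j ω := measurable_pi_lambda _ hP
  have hGm : Measurable fun ω => gradNormSq μ (iterate μ σ₀ γ (fun j => P j ω) k) :=
    (measurable_gradNormSq_iterate μ σ₀ γ k).comp hseq
  have hlm : Measurable fun ω => loss μ (iterate μ σ₀ γ (fun j => P j ω) k) :=
    (measurable_loss κ μ).comp hseq
  have hsucc := lintegral_past_present hP hI k
    (h := fun p Q => loss μ (stepKernel κ μ (γ k) (p, Q)))
    (measurable_loss (stepKernel κ μ (γ k)) μ) fun p p' Q h => by
      simp only [stepKernel_apply, κ, iterateKernel_apply, iterate_congr μ σ₀ γ h]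
  change ∫⁻ ω, loss μ (iterate μ σ₀ γ (fun j => P j ω) (k + 1)) ∂Pr = _ at hsucc
  rw [hsucc, ← lintegral_const_mul _ hGm, ← lintegral_add_right _ (hGm.const_mul _)]
  calc _ ≤ ∫⁻ ω, (loss μ (iterate μ σ₀ γ (fun j => P j ω) k) +
        ENNReal.ofReal (γ k ^ 2) * (d * L)) ∂Pr := by
        refine lintegral_mono_ae ?_
        filter_upwards [hloss, hna] with ω h1 h2
        have := h2 k
        have hstep : ∀ᵐ Q ∂(Pr.map (P k)), NullSingletonClass
            ((iterate μ σ₀ γ (fun j => P j ω) k).map fun x => (1 - γ k) • x +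
              γ k • sliceMap μ (iterate μ σ₀ γ (fun j => P j ω) k) Q x) := by
          filter_upwards [ae_nullSingletonClass_column
            (σ := iterate μ σ₀ γ (fun j => P j ω) k) (Pr.map (P k)) hd,
            ae_nullSingletonClass_column (σ := μ) (Pr.map (P k)) hd] with Q hQ hQ'
          have := hQ ⟨0, hd⟩
          have := hQ' ⟨0, hd⟩
          exact nullSingletonClass_step μ _ (hγ0 k) (hγ1 k) Q ⟨0, hd⟩
        refine (lintegral_loss_step_add_le μ _ (Pr.map (P k)) hd
          (ne_top_of_le_ne_top hL (h1 k)) (hγ0 k).le hstep).trans ?_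
        gcongr
        exact h1 k
    _ = _ := by
        rw [lintegral_add_left hlm, lintegral_const, measure_univ, mul_one]

/-- Almost surely, the gradient norms vanish along the randomized scheme. -/
theorem ae_eventually_gradNormSq_le (hd : 1 ≤ d) (hμ : IsP2 μ) (hσ₀ : IsP2 σ₀)
    (hγ0 : ∀ k, 0 < γ k) (hγ1 : ∀ k, γ k ≤ 1)
    (hsum : Tendsto (fun n => ∑ k ∈ Finset.range n, γ k) atTop atTop)
    (hsq : Summable fun k => γ k ^ 2) (hP : ∀ k, Measurable (P k))
    (hH : ∀ k, (Pr.map (P k)).IsMulLeftInvariant) (hI : iIndepFun P Pr) {ε : ℝ} (hε : 0 < ε) :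
    ∀ᵐ ω ∂Pr, ∀ᶠ k in atTop,
      gradNormSq μ (iterate μ σ₀ γ (fun j => P j ω) k) ≤ ENNReal.ofReal ε := by
  have := hμ.1
  have := hσ₀.1
  have := hσ₀.3
  have := isProbabilityMeasure_uniformSphere hd
  have hd0 : (0 : ℝ) < d := by exact_mod_cast hd
  have hcol := ae_atomlessColumns hd hμ hσ₀ hγ0 hγ1 hP hH hI
  have hna : ∀ᵐ ω ∂Pr, ∀ k, NullSingletonClass (iterate μ σ₀ γ (fun j => P j ω) k) := by
    filter_upwards [hcol] with ω hω k
    exact nullSingletonClass_iterate hd hγ0 hγ1 fun j _ => hω j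
  set M := ∫⁻ x, ‖x‖ₑ ^ 2 ∂μ + ∫⁻ x, ‖x‖ₑ ^ 2 ∂σ₀
  have hM : M ≠ ∞ := ENNReal.add_ne_top.2 ⟨hμ.2.ne, hσ₀.2.ne⟩
  have hμM : ∫⁻ x, ‖x‖ₑ ^ 2 ∂μ ≤ M := le_add_of_nonneg_right zero_le
  have hσM : ∫⁻ x, ‖x‖ₑ ^ 2 ∂σ₀ ≤ M := le_add_of_nonneg_left zero_le
  set L := 2 * (M + M)
  have hL : L ≠ ∞ := by finiteness
  have hloss : ∀ᵐ ω ∂Pr, ∀ k, loss μ (iterate μ σ₀ γ (fun j => P j ω) k) ≤ L := by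
    filter_upwards [hcol, hna] with ω hω hω' k
    have := hω' k
    refine (loss_le μ _).trans ?_
    change _ ≤ 2 * (M + M)
    gcongr
    exact lintegral_iterate_sq_le hγ0 hγ1 hμM hσM fun j _ => hω j
  have hGm : ∀ k, Measurable fun ω => gradNormSq μ (iterate μ σ₀ γ (fun j => P j ω) k) := fun k =>
    (measurable_gradNormSq_iterate μ σ₀ γ k).comp (measurable_pi_lambda _ hP)
  have hfin : ∑' k, ENNReal.ofReal (2 * γ k / d) *
      ∫⁻ ω, gradNormSq μ (iterate μ σ₀ γ (fun j => P j ω) k) ∂Pr ≠ ∞ := by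
    refine tsum_ne_top_of_add_le (L := L) (e := fun k => ENNReal.ofReal (γ k ^ 2) * d) hL
      (a := fun k => ∫⁻ ω, loss μ (iterate μ σ₀ γ (fun j => P j ω) k) ∂Pr) (fun k => ?_) ?_
      fun k => ?_
    · refine (lintegral_mono_ae (g := fun _ => L) ?_).trans (by simp)
      filter_upwards [hloss] with ω hω using hω k
    · rw [ENNReal.tsum_mul_right]
      exact ENNReal.mul_ne_top hsq.tsum_ofReal_ne_top (by simp)
    · rw [mul_assoc]
      exact lintegral_loss_iterate_succ_add_le hd hμ hσ₀ hγ0 hγ1 hP hH hI hL hloss hna k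
  have hc : ∀ k, ENNReal.ofReal (2 * γ k / d) = ENNReal.ofReal (2 / d) * ENNReal.ofReal (γ k) :=
    fun k => by rw [← ENNReal.ofReal_mul (by positivity)]; congr 1; ring
  have hc0 : ENNReal.ofReal (2 / d) ≠ 0 := by simpa using hd0
  -- Pulling out the constant 2/d and exchanging sum and expectation leaves a series with finite
  -- mean, hence almost surely finite.
  simp_rw [hc, mul_assoc, ENNReal.tsum_mul_left, ← lintegral_const_mul _ (hGm _)] at hfin
  rw [← lintegral_tsum fun k => ((hGm k).const_mul _).aemeasurable] at hfin
  have hfin' := ae_lt_top (Measurable.tsum fun k => (hGm k).const_mul _)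
    fun h => hfin (by rw [h, ENNReal.mul_top hc0])
  filter_upwards [hcol, hfin'] with ω h1 h2
  exact eventually_gradNormSq_le hd hμ hσ₀ hγ0 hγ1 hsum h1 h2.ne hε

end Random

/-- Evaluating an almost surely vanishing sequence at a uniform random index in `{1, …, K}` gives
convergence in probability. -/
lemma tendsto_measure_lt_comp_uniform {Ω : Type*} [MeasurableSpace Ω] {Pr : Measure Ω}
    [IsProbabilityMeasure Pr] {G : ℕ → Ω → ℝ≥0∞} (hG : ∀ k, Measurable (G k)) {c : ℝ≥0∞}
    (h : ∀ᵐ ω ∂Pr, ∀ᶠ k in atTop, G k ω ≤ c) {i : ℕ → Ω → ℕ} (hi : ∀ K, Measurable (i K))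
    (hunif : ∀ K, 1 ≤ K → ∀ k ∈ Finset.Icc 1 K, Pr {ω | i K ω = k} = 1 / (K : ℝ≥0∞)) :
    Tendsto (fun K => Pr {ω | c < G (i K ω) ω}) atTop (𝓝 0) := by
  set A : ℕ → Set Ω := fun m => ⋃ k ≥ m, {ω | c < G k ω} with hA
  have hAm : ∀ m, MeasurableSet (A m) := fun m => MeasurableSet.iUnion fun k =>
    MeasurableSet.iUnion fun _ => measurableSet_lt measurable_const (hG k)
  have hA0 : Tendsto (fun m => Pr (A m)) atTop (𝓝 0) := by
    have hanti : Antitone A := fun m n hmn =>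
      Set.iUnion_mono fun k => Set.iUnion_mono' fun hk => ⟨hmn.trans hk, le_rfl⟩
    have h1 := tendsto_measure_iInter_atTop (μ := Pr) (fun m => (hAm m).nullMeasurableSet) hanti
      ⟨0, measure_ne_top _ _⟩
    have h2 : Pr (⋂ m, A m) = 0 := by
      refine measure_mono_null ?_ h
      intro ω hω hω'
      obtain ⟨m, hm⟩ := eventually_atTop.1 hω'
      obtain ⟨k, hk, hk'⟩ := Set.mem_iUnion₂.1 (Set.mem_iInter.1 hω m)
      exact absurd (hm k hk) (not_le.2 hk')
    rwa [h2] at h1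
  -- The `K` prescribed probabilities already add up to one.
  have hout : ∀ K, 1 ≤ K → Pr {ω | i K ω ∉ Finset.Icc 1 K} = 0 := fun K hK => by
    have hms : MeasurableSet {ω | i K ω ∈ Finset.Icc 1 K} :=
      hi K (Finset.measurableSet _ : MeasurableSet (Finset.Icc 1 K : Set ℕ))
    have e : {ω | i K ω ∈ Finset.Icc 1 K} = ⋃ k ∈ Finset.Icc 1 K, {ω | i K ω = k} := by
      ext ω; simp
    have : Pr {ω | i K ω ∈ Finset.Icc 1 K} = 1 := by
      rw [e, measure_biUnion_finset (f := fun k => {ω | i K ω = k}) (fun k _ l _ hkl => Set.disjoint_left.2 fun ω hk hl =>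
        hkl (hk.symm.trans hl)) fun k _ => hi K (measurableSet_singleton k),
        Finset.sum_congr rfl (hunif K hK)]
      have hK0 : (K : ℝ≥0∞) ≠ 0 := by exact_mod_cast (Nat.one_le_iff_ne_zero.1 hK)
      simp [ENNReal.mul_inv_cancel hK0]
    have := (prob_compl_eq_zero_iff hms).2 this
    exact this
  -- Either the index is at most `m`, with probability m/K, or some time from `m` on is bad. A union
  -- bound suffices, whatever the dependence between the index and `G`.
  have hbound : ∀ m K, 1 ≤ K → m ≤ K →
      Pr {ω | c < G (i K ω) ω} ≤ m * (1 / (K : ℝ≥0∞)) + Pr (A m) := fun m K hK hmK => by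
    have hsub : {ω | c < G (i K ω) ω} ⊆
        {ω | i K ω ∉ Finset.Icc 1 K} ∪ ((⋃ k ∈ Finset.Icc 1 m, {ω | i K ω = k}) ∪ A m) := by
      intro ω hω
      by_cases h1 : i K ω ∈ Finset.Icc 1 K
      · right
        by_cases h2 : i K ω ≤ m
        · left
          simp only [Set.mem_iUnion]
          exact ⟨i K ω, Finset.mem_Icc.2 ⟨(Finset.mem_Icc.1 h1).1, h2⟩, rfl⟩
        · exact Or.inr (Set.mem_iUnion₂.2 ⟨i K ω, (not_le.1 h2).le, hω⟩)
      · exact Or.inl h1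
    refine (measure_mono hsub).trans ((measure_union_le _ _).trans ?_)
    rw [hout K hK, zero_add]
    refine (measure_union_le _ _).trans ?_
    gcongr
    refine (measure_biUnion_finset_le _ _).trans (le_of_eq ?_)
    rw [Finset.sum_congr rfl fun k hk => hunif K hK k
      (Finset.mem_Icc.2 ⟨(Finset.mem_Icc.1 hk).1, (Finset.mem_Icc.1 hk).2.trans hmK⟩)]
    simp
  rw [ENNReal.tendsto_nhds_zero]
  intro δ hδ
  have hδ2 : 0 < δ / 2 := ENNReal.half_pos hδ.ne'
  obtain ⟨m, hm⟩ := (ENNReal.tendsto_nhds_zero.1 hA0 _ hδ2).exists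
  have hmK : Tendsto (fun K : ℕ => (m : ℝ≥0∞) * (1 / (K : ℝ≥0∞))) atTop (𝓝 0) := by
    have := ENNReal.Tendsto.const_mul (a := (m : ℝ≥0∞)) ENNReal.tendsto_inv_nat_nhds_zero
      (Or.inr (ENNReal.natCast_ne_top m))
    simpa using this
  filter_upwards [ENNReal.tendsto_nhds_zero.1 hmK _ hδ2, eventually_ge_atTop 1,
    eventually_ge_atTop m] with K h1 h2 h3
  exact (hbound m K h2 h3).trans ((add_le_add h1 hm).trans_eq (ENNReal.add_halves δ))

end SliceMatching

theorem mainTheorem11 {d : ℕ} (hd : 1 ≤ d)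
    (μ σ₀ : MeasureTheory.Measure (SliceMatching.E d))
    (hμ : SliceMatching.IsP2ac μ) (hσ₀ : SliceMatching.IsP2ac σ₀)
    (γ : ℕ → ℝ) (hγ_pos : ∀ k, 0 < γ k) (hγ_le : ∀ k, γ k ≤ 1)
    (hγ_sum : Tendsto (fun n => ∑ k ∈ Finset.range n, γ k) atTop atTop)
    (hγ_sq : Summable (fun k => γ k ^ 2))
    {Ω : Type*} [MeasurableSpace Ω] (Pr : Measure Ω) [IsProbabilityMeasure Pr]
    (P : ℕ → Ω → SliceMatching.Orth d) (hP_meas : ∀ k, Measurable (P k))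
    (hP_haar : ∀ k, (Pr.map (P k)).IsHaarMeasure)
    (hP_indep : iIndepFun P Pr)
    (i : ℕ → Ω → ℕ) (hi_meas : ∀ K, Measurable (i K))
    (hi_unif : ∀ K, 1 ≤ K → ∀ k ∈ Finset.Icc 1 K, Pr {ω | i K ω = k} = 1 / (K : ℝ≥0∞)) :
    ∀ ε : ℝ, 0 < ε →
      Tendsto
        (fun K : ℕ => Pr {ω | ENNReal.ofReal ε <
          SliceMatching.gradNormSq μ
            (SliceMatching.iterate μ σ₀ γ (fun k => P k ω) (i K ω))})
        atTop (𝓝 0) := by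
  have := hμ.1
  have := hσ₀.1
  have := SliceMatching.isProbabilityMeasure_uniformSphere hd
  intro ε hε
  have hG : ∀ k, Measurable fun ω => SliceMatching.gradNormSq μ
      (SliceMatching.iterate μ σ₀ γ (fun j => P j ω) k) := fun k =>
    (SliceMatching.measurable_gradNormSq_iterate μ σ₀ γ k).comp (measurable_pi_lambda _ hP_meas)
  exact SliceMatching.tendsto_measure_lt_comp_uniform hG
    (SliceMatching.ae_eventually_gradNormSq_le hd (hμ.isP2 hd) (hσ₀.isP2 hd) hγ_pos hγ_le hγ_sum
      hγ_sq hP_meas (fun k => (hP_haar k).toIsMulLeftInvariant) hP_indep hε) hi_meas hi_unif
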